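/- All graphs are finite undirected multigraphs with non-negative rational edge costs, given with the costs in binary; solutions are spanning subgraphs, i.e. sets of edges. For an edge set $H$ and a vertex set $A$ let $\delta_H(A)$ be the set of edges of $H$ with exactly one end in $A$, and $d_H(A)=|\delta_H(A)|$. An $st$-set is a vertex set containing $s$ but not $t$, and $\lambda_H(s,t)$ is the minimum of $d_H(A)$ over all $st$-sets $A$. SD-3-RSND: given a graph $G=(V,E)$ and two distinct vertices $s,t$, find a minimum-cost $H\subseteq E$ such that for every $F\subseteq E$ with $|F|<3$, if $G\setminus F$ has an $st$-path then $H\setminus F$ has an $st$-path. 3-Subset 3-EC: given a graph $J=(V',E')$ and a set $R\subseteq V'$ of at most $4$ terminals, find a minimum-cost $H\subseteq E'$ such that $R$ is a $3$-edge-connected subset in $H$, i.e. $\lambda_H(u,v)\ge 3$ for all distinct $u,v\in R$. A minimization problem admits approximation ratio $\rho$ if there is a polynomial-time algorithm that, on every instance that has a feasible solution, outputs a feasible solution of cost at most $\rho$ times the cost of every feasible solution. Theorem. Let $\rho\ge 1$ be a real number. SD-3-RSND admits approximation ratio $\rho$ if and only if 3-Subset 3-EC admits approximation ratio $\rho$ on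 the class of those instances $(J,R)$ for which there are distinct vertices $s,t$ of $J$ such that the edges incident to $s$ or $t$ (the forced edges) have cost $0$ and the following hold: (A) $d_J(s)=d_J(t)=2$, and $R$ is the set of all neighbours of $s$ and of $t$; (B) if $d_J(A)=2$ for some $st$-set $A$, then $A=\{s\}$ or $A=V'\setminus\{t\}$. -/

import Mathlib

/-! ## The machine model: WHILE programs over binary trees, with a step count

Every subexpression that is evaluated is charged one step plus the size of its value, so that
building, copying, reading and comparing data is paid for in full. -/

/-- Data values: binary trees. -/
inductive Data : Type
  | nil : Data
  | cons (a b : Data) : Data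
  deriving DecidableEq

namespace Data

/-- Number of nodes of a data value, leaves included. -/
def size : Data → ℕ
  | nil => 1
  | cons a b => 1 + a.size + b.size

/-- First component. -/
def hd : Data → Data
  | nil => nil
  | cons a _ => a

/-- Second component. -/
def tl : Data → Data
  | nil => nil
  | cons _ b => b

/-- Truth values as data; any value other than `nil` counts as true in a test. -/
def ofBool : Bool → Data
  | false => nil
  | true => cons nil nil

/-- Lists as data. -/
def ofList : List Data → Data
  | [] => nil
  | a :: l => cons a (ofList l)

/-- A natural number in unary. -/
def unary (k : ℕ) : Data := ofList (List.replicate k nil)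

/-- A natural number in binary, least significant bit first. -/
def binary (k : ℕ) : Data := ofList (k.bits.map ofBool)

/-- A non-negative rational number: numerator and denominator in binary. -/
def ofRat (q : ℚ≥0) : Data := cons (binary q.num) (binary q.den)

/-- A subset of `Fin k` as the list of its `k` membership bits. -/
def ofFinset {k : ℕ} (S : Finset (Fin k)) : Data :=
  ofList (List.ofFn fun i => ofBool (decide (i ∈ S)))

end Data

/-- A store: the contents of the variables `0, 1, 2, …`. -/
abbrev Store : Type := ℕ → Data

/-- The store at the start of a run: the input is in variable `0`, all others hold `nil`. -/
def Store.start (x : Data) : Store := fun i => if i = 0 then x else Data.nil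

/-- Expressions. -/
inductive Expr : Type
  | var (i : ℕ) : Expr
  | nil : Expr
  | cons (e f : Expr) : Expr
  | hd (e : Expr) : Expr
  | tl (e : Expr) : Expr
  | eq (e f : Expr) : Expr

namespace Expr

/-- Value of an expression. -/
def eval (σ : Store) : Expr → Data
  | var i => σ i
  | nil => Data.nil
  | cons e f => Data.cons (e.eval σ) (f.eval σ)
  | hd e => (e.eval σ).hd
  | tl e => (e.eval σ).tl
  | eq e f => Data.ofBool (decide (e.eval σ = f.eval σ))

/-- Time to evaluate an expression: every subexpression costs one plus the size of its value. -/
def time (σ : Store) : Expr → ℕ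
  | var i => 1 + (σ i).size
  | nil => 1 + Data.nil.size
  | cons e f => e.time σ + f.time σ + (1 + ((cons e f).eval σ).size)
  | hd e => e.time σ + (1 + ((hd e).eval σ).size)
  | tl e => e.time σ + (1 + ((tl e).eval σ).size)
  | eq e f => e.time σ + f.time σ + (1 + ((eq e f).eval σ).size)

end Expr

/-- Programs. -/
inductive Prog : Type
  | skip : Prog
  | assign (i : ℕ) (e : Expr) : Prog
  | seq (c d : Prog) : Prog
  | ite (e : Expr) (c d : Prog) : Prog
  | loop (e : Expr) (c : Prog) : Prog

/-- `Exec c σ τ k`: started in store `σ`, program `c` halts in store `τ` after `k` steps.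
`loop e c` is the command "while `e` is not `nil` do `c`". -/
inductive Exec : Prog → Store → Store → ℕ → Prop
  | skip (σ : Store) : Exec Prog.skip σ σ 1
  | assign (i : ℕ) (e : Expr) (σ : Store) :
      Exec (Prog.assign i e) σ (Function.update σ i (e.eval σ)) (1 + e.time σ)
  | seq {c d : Prog} {σ τ υ : Store} {k l : ℕ} (h₁ : Exec c σ τ k) (h₂ : Exec d τ υ l) :
      Exec (Prog.seq c d) σ υ (k + l)
  | ite_true {e : Expr} {c d : Prog} {σ τ : Store} {k : ℕ} (he : e.eval σ ≠ Data.nil)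
      (h : Exec c σ τ k) : Exec (Prog.ite e c d) σ τ (1 + e.time σ + k)
  | ite_false {e : Expr} {c d : Prog} {σ τ : Store} {k : ℕ} (he : e.eval σ = Data.nil)
      (h : Exec d σ τ k) : Exec (Prog.ite e c d) σ τ (1 + e.time σ + k)
  | loop_stop {e : Expr} {c : Prog} {σ : Store} (he : e.eval σ = Data.nil) :
      Exec (Prog.loop e c) σ σ (1 + e.time σ)
  | loop_step {e : Expr} {c : Prog} {σ τ υ : Store} {k l : ℕ} (he : e.eval σ ≠ Data.nil)
      (h₁ : Exec c σ τ k) (h₂ : Exec (Prog.loop e c) τ υ l) :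
      Exec (Prog.loop e c) σ υ (1 + e.time σ + k + l)

/-- On input `x`, the program `c` halts within `T` steps with output `y` (in variable `0`). -/
def Prog.OutputsIn (c : Prog) (x y : Data) (T : ℕ) : Prop :=
  ∃ (τ : Store) (k : ℕ), Exec c (Store.start x) τ k ∧ τ 0 = y ∧ k ≤ T

/-! ## Minimization problems and approximation ratios -/

/-- A minimization problem with encoded instances and solutions. -/
structure MinProblem where
  /-- instances -/
  Inst : Type
  /-- candidate solutions of an instance -/
  Sol : Inst → Type
  /-- encoding of the instances -/
  encInst : Inst → Data
  /-- encoding of the candidate solutions -/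
  encSol : (I : Inst) → Sol I → Data
  /-- the feasible solutions -/
  Feasible : (I : Inst) → Sol I → Prop
  /-- the cost of a solution, to be minimized -/
  cost : (I : Inst) → Sol I → ℚ≥0

namespace MinProblem

/-- The same problem, restricted to the instances with property `p`. -/
def restrict (P : MinProblem) (p : P.Inst → Prop) : MinProblem where
  Inst := {I : P.Inst // p I}
  Sol I := P.Sol I.1
  encInst I := P.encInst I.1
  encSol I := P.encSol I.1
  Feasible I := P.Feasible I.1
  cost I := P.cost I.1

/-- `P` admits approximation ratio `ρ`: some polynomial-time program outputs, on every instance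
that has a feasible solution, a feasible solution whose cost is at most `ρ` times the cost of
every feasible solution. -/
def AdmitsRatio (P : MinProblem) (ρ : ℝ) : Prop :=
  ∃ (c : Prog) (p : Polynomial ℕ), ∀ I : P.Inst, (∃ S : P.Sol I, P.Feasible I S) →
    ∃ S : P.Sol I,
      c.OutputsIn (P.encInst I) (P.encSol I S) (p.eval (P.encInst I).size) ∧
      P.Feasible I S ∧
      ∀ S' : P.Sol I, P.Feasible I S' → (P.cost I S : ℝ) ≤ ρ * (P.cost I S' : ℝ)

end MinProblem

/-! ## Multigraphs with edge costs -/

/-- A finite undirected multigraph with vertex set `Fin n`, edge set `Fin m` and non-negative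
edge costs. The two ends of an edge are listed in an arbitrary order. -/
structure CostGraph where
  /-- number of vertices -/
  n : ℕ
  /-- number of edges -/
  m : ℕ
  /-- the two ends of an edge -/
  ends : Fin m → Fin n × Fin n
  /-- the cost of an edge -/
  cost : Fin m → ℚ≥0

namespace CostGraph

/-- Vertices. -/
abbrev Vert (G : CostGraph) : Type := Fin G.n

/-- Edges. -/
abbrev Edge (G : CostGraph) : Type := Fin G.m

/-- The edge `e` joins `u` and `v`. -/
def Joins (G : CostGraph) (e : G.Edge) (u v : G.Vert) : Prop :=
  G.ends e = (u, v) ∨ G.ends e = (v, u)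

/-- There is a path from `s` to `t` in the spanning subgraph with edge set `H`. -/
def Reach (G : CostGraph) (H : Finset G.Edge) (s t : G.Vert) : Prop :=
  Relation.ReflTransGen (fun u v => ∃ e ∈ H, G.Joins e u v) s t

/-- `δ_H(A)`: the edges of `H` with exactly one end in `A`. -/
def cut (G : CostGraph) (H : Finset G.Edge) (A : Finset G.Vert) : Finset G.Edge :=
  H.filter fun e => ¬((G.ends e).1 ∈ A ↔ (G.ends e).2 ∈ A)

/-- `λ_H(s,t)`: the minimum size of an `st`-cut of `H` (infinite if `s = t`). -/
noncomputable def minCut (G : CostGraph) (H : Finset G.Edge) (s t : G.Vert) : ℕ∞ :=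
  ⨅ (A : Finset G.Vert) (_ : s ∈ A ∧ t ∉ A), ((G.cut H A).card : ℕ∞)

/-- `R` is a `k`-edge-connected subset in `H`. -/
def EdgeConnectedSubset (G : CostGraph) (H : Finset G.Edge) (k : ℕ) (R : Finset G.Vert) : Prop :=
  ∀ u ∈ R, ∀ v ∈ R, (k : ℕ∞) ≤ G.minCut H u v

/-- Feasibility of the subgraph `H` for the relative demands in the list `D`. -/
def RelFeasible (G : CostGraph) (D : List (G.Vert × G.Vert × ℕ)) (H : Finset G.Edge) : Prop :=
  ∀ d ∈ D, ∀ F : Finset G.Edge, F.card < d.2.2 →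
    G.Reach (Finset.univ \ F) d.1 d.2.1 → G.Reach (H \ F) d.1 d.2.1

/-- Total cost of a set of edges. -/
def totalCost (G : CostGraph) (H : Finset G.Edge) : ℚ≥0 := ∑ e ∈ H, G.cost e

/-- Encoding of a graph: the number of vertices in unary and the list of the edges with their
ends (in unary) and costs (in binary). -/
def enc (G : CostGraph) : Data :=
  Data.cons (Data.unary G.n) (Data.ofList (List.ofFn fun e : G.Edge =>
    Data.cons (Data.unary (G.ends e).1) (Data.cons (Data.unary (G.ends e).2)
      (Data.ofRat (G.cost e)))))

end CostGraph

/-! ## The two problems -/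

/-- An instance of single-demand relative survivable network design. -/
structure SDInstance where
  /-- the graph -/
  G : CostGraph
  /-- the source of the demand -/
  s : G.Vert
  /-- the target of the demand -/
  t : G.Vert
  /-- source and target differ -/
  ne : s ≠ t

/-- SD-`k`-RSND: find a cheapest subgraph that is feasible for the single relative demand
`(s, t, k)`. -/
def SDRSND (k : ℕ) : MinProblem where
  Inst := SDInstance
  Sol I := Finset I.G.Edge
  encInst I := Data.cons I.G.enc (Data.cons (Data.unary I.s) (Data.unary I.t))
  encSol _ H := Data.ofFinset H
  Feasible I H := I.G.RelFeasible [(I.s, I.t, k)] H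
  cost I H := I.G.totalCost H

/-- An instance of 3-Subset 3-EC. -/
structure SubsetInstance where
  /-- the graph -/
  J : CostGraph
  /-- the terminals -/
  R : Finset J.Vert
  /-- there are at most four terminals -/
  card_le : R.card ≤ 4

/-- 3-Subset 3-EC: find a cheapest subgraph in which the terminals form a 3-edge-connected
subset. -/
def Subset3EC : MinProblem where
  Inst := SubsetInstance
  Sol I := Finset I.J.Edge
  encInst I := Data.cons I.J.enc (Data.ofFinset I.R)
  encSol _ H := Data.ofFinset H
  Feasible I H := I.J.EdgeConnectedSubset H 3 I.R
  cost I H := I.J.totalCost H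

namespace SubsetInstance

/-- Property (A): `s` and `t` have degree two, and the terminals are their neighbours. -/
def PropA (I : SubsetInstance) (s t : I.J.Vert) : Prop :=
  (I.J.cut Finset.univ {s}).card = 2 ∧ (I.J.cut Finset.univ {t}).card = 2 ∧
    ∀ v : I.J.Vert, v ∈ I.R ↔
      (v ≠ s ∧ ∃ e, I.J.Joins e s v) ∨ (v ≠ t ∧ ∃ e, I.J.Joins e t v)

/-- Property (B): the only `st`-sets `A` with two leaving edges are `{s}` and `V ∖ {t}`. -/
def PropB (I : SubsetInstance) (s t : I.J.Vert) : Prop :=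
  ∀ A : Finset I.J.Vert, s ∈ A → t ∉ A → (I.J.cut Finset.univ A).card = 2 →
    A = {s} ∨ A = Finset.univ \ {t}

/-- The forced edges, those leaving `s` or `t`, have cost zero. -/
def ForcedFree (I : SubsetInstance) (s t : I.J.Vert) : Prop :=
  ∀ e ∈ I.J.cut Finset.univ {s} ∪ I.J.cut Finset.univ {t}, I.J.cost e = 0

/-- The instances of 3-Subset 3-EC with properties (A), (B) for some distinct vertices `s`, `t`
whose edges are free. -/
def Special (I : SubsetInstance) : Prop :=
  ∃ s t : I.J.Vert, s ≠ t ∧ I.PropA s t ∧ I.PropB s t ∧ I.ForcedFree s t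

end SubsetInstance

/-! ## Runs of programs -/

/-! Both directions rest on a cut form of feasibility, `CostGraph.relFeasible_iff`: a set `H` is
feasible for the demand `(s, t, 3)` iff every `st`-cut of `H` with at most two edges contains a full
`st`-cut of the graph.

From SD-3-RSND to 3-Subset 3-EC the graph is kept. Suppose `s` and `t` have degree two and their
neighbours `R` are 3-edge-connected in the whole graph. An `st`-cut with at most two edges cannot
split `R`, so it contains all edges at `s` or all edges at `t`. Hence a solution for `R` plus the
forced edges is feasible for the demand (`Terminals.relFeasible`), and conversely a set feasible for
the demand makes `R` 3-edge-connected (`Terminals.edgeConnectedSubset`). The forced edges are free,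
so costs agree. A suitable pair `s`, `t` is found by exhaustive search.

For the converse, give weight 2 to an edge whose removal separates `s` from `t` and weight 1 to all
others, and add two virtual edges into `s` and two out of `t`. The resulting cut function `phi` is
submodular and at least 2. Its minimizers inside the component of `s`, the tight sets, are closed
under union and intersection, and a maximal chain of them from `∅` to the component cuts it into
layers. Every feasible solution contains all edges of tight cuts (`Tight.cut_subset`), so the choice
is only about edges inside layers. A layer between consecutive tight sets `A ⊂ B` is entered with
weight at most 2 and left with weight at most 2, so it has at most four ports, and its contribution
to `phi` depends only on its inner edges and on the sides of the ports (`Piece.phi_union`).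

The demand then decouples: the layers of a feasible solution satisfy a local condition `Solves`
(`Piece.solves_of_relFeasible`), and local solutions together with the tight cuts are feasible
(`Chain.relFeasible`), both by uncrossing. `Solves` is 3-edge-connectivity of the ports in a small
gadget (`gadget.solves`, `gadget.edgeConnectedSubset_lift`). The gadget is a special instance
because a further cut with two edges would give a tight set strictly between `A` and `B`
(`gadget.eq_of_card_cut_eq_two`). Since the layers are disjoint, costs add up, and the tight cuts
are bought by every solution (`Chain.totalCost_assemble_le`).

All of this is computable in polynomial time: apart from `∅` and the whole component, the tight sets
are the sides of minimal separations by at most two edges, and these can be listed. The programs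
come from closure properties of `PolyTime`, applied to versions of the constructions on lists of
numbers, which are proved to agree with the ones on graphs. -/

theorem Data.one_le_size (x : Data) : 1 ≤ x.size := by
  cases x <;> simp [Data.size]; omega

/-- A strict upper bound for the variables of an expression. -/
def Expr.bound : Expr → ℕ
  | var i => i + 1
  | nil => 0
  | cons e f => max e.bound f.bound
  | hd e => e.bound
  | tl e => e.bound
  | eq e f => max e.bound f.bound

/-- A strict upper bound for the variables of a program. -/
def Prog.bound : Prog → ℕ
  | skip => 0
  | assign i e => max (i + 1) e.bound
  | seq c d => max c.bound d.bound
  | ite e c d => max e.bound (max c.bound d.bound)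
  | loop e c => max e.bound c.bound

theorem Expr.eval_congr (e : Expr) {σ τ : Store} (h : ∀ i < e.bound, σ i = τ i) :
    e.eval σ = e.eval τ ∧ e.time σ = e.time τ := by
  induction e with
  | var i => simp [Expr.eval, Expr.time, h i (by simp [Expr.bound])]
  | nil => simp [Expr.eval, Expr.time]
  | cons e f he hf =>
    have h1 := he fun i hi => h i (lt_max_of_lt_left hi)
    have h2 := hf fun i hi => h i (lt_max_of_lt_right hi)
    simp [Expr.eval, Expr.time, h1, h2]
  | hd e he => have h1 := he h; simp [Expr.eval, Expr.time, h1]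
  | tl e he => have h1 := he h; simp [Expr.eval, Expr.time, h1]
  | eq e f he hf =>
    have h1 := he fun i hi => h i (lt_max_of_lt_left hi)
    have h2 := hf fun i hi => h i (lt_max_of_lt_right hi)
    simp [Expr.eval, Expr.time, h1, h2]

theorem Exec.trans_eq {c : Prog} {σ τ υ : Store} {k : ℕ} (h : Exec c σ τ k) (e : τ = υ) :
    Exec c σ υ k := e ▸ h

theorem Exec.trans_eq' {c : Prog} {σ τ υ : Store} {k l : ℕ} (h : Exec c σ τ k) (e : τ = υ)
    (e' : k = l) : Exec c σ υ l := e ▸ e' ▸ h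

theorem Exec.unchanged {c : Prog} {σ τ : Store} {k : ℕ} (h : Exec c σ τ k) :
    ∀ i, c.bound ≤ i → τ i = σ i := by
  induction h with
  | skip => simp
  | assign j e σ =>
    intro i hi
    have : i ≠ j := by simp [Prog.bound] at hi; omega
    simp [this]
  | seq _ _ h1 h2 =>
    intro i hi
    simp only [Prog.bound, max_le_iff] at hi
    rw [h2 i hi.2, h1 i hi.1]
  | ite_true _ _ h1 => intro i hi; simp only [Prog.bound, max_le_iff] at hi; exact h1 i hi.2.1
  | ite_false _ _ h1 => intro i hi; simp only [Prog.bound, max_le_iff] at hi; exact h1 i hi.2.2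
  | loop_stop => simp
  | loop_step _ _ _ h1 h2 =>
    intro i hi
    rw [h2 i hi]
    simp only [Prog.bound, max_le_iff] at hi
    exact h1 i hi.2

/-- A run depends only on the variables of the program. -/
theorem Exec.frame {c : Prog} {σ τ : Store} {k : ℕ} (h : Exec c σ τ k) (N : ℕ)
    (hN : c.bound ≤ N) (σ' : Store) (hσ : ∀ i < N, σ' i = σ i) :
    Exec c σ' (fun i => if i < N then τ i else σ' i) k := by
  induction h generalizing σ' with
  | skip σ =>
    have : (fun i => if i < N then σ i else σ' i) = σ' := by
      ext i; split_ifs with hi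
      · rw [hσ i hi]
      · rfl
    rw [this]; exact Exec.skip _
  | assign j e σ =>
    simp only [Prog.bound, max_le_iff] at hN
    have h1 := e.eval_congr (σ := σ') (τ := σ) fun i hi => hσ i (by omega)
    have : (fun i => if i < N then Function.update σ j (e.eval σ) i else σ' i) =
        Function.update σ' j (e.eval σ') := by
      ext i
      by_cases hij : i = j
      · subst hij; simp [h1.1]; omega
      · simp only [Function.update_of_ne hij]
        split_ifs with hi
        · rw [hσ i hi]
        · rfl
    rw [this, ← h1.2]; exact Exec.assign _ _ _
  | @seq c d σ τ υ k l _ _ h1 h2 =>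
    simp only [Prog.bound, max_le_iff] at hN
    have e1 := h1 hN.1 σ' hσ
    have e2 := h2 hN.2 (fun i => if i < N then τ i else σ' i) fun i hi => if_pos hi
    refine (e1.seq e2).trans_eq ?_
    ext i; by_cases hi : i < N <;> simp [hi]
  | ite_true he _ h1 =>
    simp only [Prog.bound, max_le_iff] at hN
    have h3 := Expr.eval_congr _ (τ := _) (σ := σ') fun i hi => hσ i (lt_of_lt_of_le hi hN.1)
    rw [← h3.2]
    exact Exec.ite_true (by rw [h3.1]; exact he) (h1 hN.2.1 σ' hσ)
  | ite_false he _ h1 =>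
    simp only [Prog.bound, max_le_iff] at hN
    have h3 := Expr.eval_congr _ (τ := _) (σ := σ') fun i hi => hσ i (lt_of_lt_of_le hi hN.1)
    rw [← h3.2]
    exact Exec.ite_false (by rw [h3.1]; exact he) (h1 hN.2.2 σ' hσ)
  | loop_stop he =>
    rename_i σ
    simp only [Prog.bound, max_le_iff] at hN
    have h3 := Expr.eval_congr _ (τ := _) (σ := σ') fun i hi => hσ i (lt_of_lt_of_le hi hN.1)
    have : (fun i => if i < N then σ i else σ' i) = σ' := by
      ext i; split_ifs with hi
      · rw [hσ i hi]
      · rfl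
    rw [← h3.2, this]
    exact Exec.loop_stop (by rw [h3.1]; exact he)
  | @loop_step e c σ τ υ k l he _ _ h1 h2 =>
    have hN' := hN
    simp only [Prog.bound, max_le_iff] at hN
    have h3 := Expr.eval_congr _ (τ := _) (σ := σ') fun i hi => hσ i (lt_of_lt_of_le hi hN.1)
    rw [← h3.2]
    have e1 := h1 hN.2 σ' hσ
    have e2 := h2 hN' (fun i => if i < N then τ i else σ' i) fun i hi => if_pos hi
    refine (Exec.loop_step (by rw [h3.1]; exact he) e1 e2).trans_eq ?_
    ext i; by_cases hi : i < N <;> simp [hi]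

theorem Expr.size_eval_lt (e : Expr) (σ : Store) : (e.eval σ).size < e.time σ := by
  cases e <;> simp only [Expr.eval, Expr.time] <;> omega

/-- Writing a value costs more steps than its size, so memory grows by at most the running time.
This is what keeps the outputs of polynomial-time functions polynomially large. -/
theorem Exec.size_le {c : Prog} {σ τ : Store} {k : ℕ} (h : Exec c σ τ k) :
    ∀ i, (τ i).size ≤ (σ i).size + k := by
  induction h with
  | skip => intro i; omega
  | assign j e σ =>
    intro i
    have := e.size_eval_lt σ
    by_cases hij : i = j
    · subst hij; simp; omega
    · simp [hij]
  | seq _ _ h1 h2 => intro i; have := h1 i; have := h2 i; omega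
  | ite_true _ _ h1 => intro i; have := h1 i; omega
  | ite_false _ _ h1 => intro i; have := h1 i; omega
  | loop_stop => intro i; omega
  | loop_step _ _ _ h1 h2 => intro i; have := h1 i; have := h2 i; omega

/-- Empty the variables `1, …, k`. -/
def Prog.clear : ℕ → Prog
  | 0 => skip
  | k + 1 => seq (clear k) (assign (k + 1) Expr.nil)

theorem Prog.exec_clear (k : ℕ) (σ : Store) :
    Exec (clear k) σ (fun i => if 1 ≤ i ∧ i ≤ k then Data.nil else σ i) (3 * k + 1) := by
  induction k with
  | zero =>
    refine (Exec.skip σ).trans_eq ?_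
    ext i
    rw [if_neg (by omega)]
  | succ k ih =>
    refine (ih.seq (Exec.assign (k + 1) Expr.nil _)).trans_eq ?_
    ext i
    by_cases hi : i = k + 1
    · subst hi; simp [Expr.eval]
    · simp only [Function.update_of_ne hi]
      congr 1
      simp only [eq_iff_iff]
      omega

/-- After clearing, the final store is again a start store, so that programs can be chained without
leftovers in memory. -/
theorem Prog.exec_clear_start {c : Prog} {x : Data} {τ : Store} {k : ℕ}
    (h : Exec c (Store.start x) τ k) :
    Exec (seq c (clear c.bound)) (Store.start x) (Store.start (τ 0)) (k + (3 * c.bound + 1)) := by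
  refine (h.seq (exec_clear c.bound τ)).trans_eq ?_
  ext i
  by_cases h0 : i = 0
  · simp [h0, Store.start]
  · simp only [Store.start, h0, if_false]
    split_ifs with hi
    · rfl
    · rw [h.unchanged i (by omega)]; simp [Store.start, h0]

/-! ## Polynomial-time functions between encoded types -/

/-- Types whose elements are encoded as data. -/
class Enc (α : Type) where
  /-- the encoding -/
  enc : α → Data

/-- Size of the encoding. -/
def esize {α : Type} [Enc α] (a : α) : ℕ := (Enc.enc a).size

theorem one_le_esize {α : Type} [Enc α] (a : α) : 1 ≤ esize a := Data.one_le_size _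

/-- Functions bounded by a polynomial in the size of the argument. -/
def PolyBound {α : Type} [Enc α] (T : α → ℕ) : Prop :=
  ∃ p : Polynomial ℕ, ∀ a, T a ≤ p.eval (esize a)

/-- Functions computed by a program in polynomial time; the program cleans up its memory. -/
def PolyTime {α β : Type} [Enc α] [Enc β] (f : α → β) : Prop :=
  ∃ (c : Prog) (T : α → ℕ), PolyBound T ∧ ∀ a, ∃ k ≤ T a,
    Exec c (Store.start (Enc.enc a)) (Store.start (Enc.enc (f a))) k

theorem eval_mono_nat (p : Polynomial ℕ) {m n : ℕ} (h : m ≤ n) : p.eval m ≤ p.eval n := by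
  induction p using Polynomial.induction_on' with
  | add p q hp hq => simp only [Polynomial.eval_add]; omega
  | monomial k a =>
    simp only [Polynomial.eval_monomial]
    gcongr

namespace PolyBound

variable {α β : Type} [Enc α] [Enc β] {S T : α → ℕ}

theorem mono (hT : PolyBound T) (h : ∀ a, S a ≤ T a) : PolyBound S :=
  let ⟨p, hp⟩ := hT; ⟨p, fun a => (h a).trans (hp a)⟩

theorem const (k : ℕ) : PolyBound fun _ : α => k := ⟨Polynomial.C k, fun a => by simp⟩

theorem size : PolyBound fun a : α => esize a := ⟨Polynomial.X, fun a => by simp⟩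

theorem add (hS : PolyBound S) (hT : PolyBound T) : PolyBound fun a => S a + T a := by
  obtain ⟨p, hp⟩ := hS
  obtain ⟨q, hq⟩ := hT
  exact ⟨p + q, fun a => by rw [Polynomial.eval_add]; exact add_le_add (hp a) (hq a)⟩

theorem mul (hS : PolyBound S) (hT : PolyBound T) : PolyBound fun a => S a * T a := by
  obtain ⟨p, hp⟩ := hS
  obtain ⟨q, hq⟩ := hT
  exact ⟨p * q, fun a => by rw [Polynomial.eval_mul]; exact Nat.mul_le_mul (hp a) (hq a)⟩

theorem eval (p : Polynomial ℕ) (hS : PolyBound S) : PolyBound fun a => p.eval (S a) := by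
  obtain ⟨q, hq⟩ := hS
  exact ⟨p.comp q, fun a => by rw [Polynomial.eval_comp]; exact eval_mono_nat p (hq a)⟩

theorem comp {U : β → ℕ} {f : α → β} (hU : PolyBound U) (hf : PolyBound fun a => esize (f a)) :
    PolyBound fun a => U (f a) := by
  obtain ⟨p, hp⟩ := hU
  exact (hf.eval p).mono fun a => hp (f a)

end PolyBound

/-- Evaluation of a fixed expression takes linear time. -/
theorem Expr.time_linear (e : Expr) :
    ∃ C, ∀ x : Data, e.time (Store.start x) ≤ C * x.size := by
  induction e with
  | var i =>
    refine ⟨2, fun x => ?_⟩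
    have := x.one_le_size
    simp only [Expr.time, Store.start]
    split_ifs
    · omega
    · simp only [Data.size]; omega
  | nil => exact ⟨2, fun x => by have := x.one_le_size; simp only [Expr.time, Data.size]; omega⟩
  | cons e f he hf =>
    obtain ⟨C, hC⟩ := he
    obtain ⟨D, hD⟩ := hf
    refine ⟨2 * C + 2 * D + 2, fun x => ?_⟩
    have := hC x
    have := hD x
    have := x.one_le_size
    have := e.size_eval_lt (Store.start x)
    have := f.size_eval_lt (Store.start x)
    simp only [Expr.time, Expr.eval, Data.size, add_mul, mul_assoc]
    omega
  | hd e he =>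
    obtain ⟨C, hC⟩ := he
    refine ⟨2 * C + 2, fun x => ?_⟩
    have := hC x
    have := x.one_le_size
    have := e.size_eval_lt (Store.start x)
    have : (e.eval (Store.start x)).hd.size ≤ (e.eval (Store.start x)).size := by
      cases e.eval (Store.start x) <;> simp [Data.hd, Data.size]; omega
    simp only [Expr.time, Expr.eval, add_mul, mul_assoc]
    omega
  | tl e he =>
    obtain ⟨C, hC⟩ := he
    refine ⟨2 * C + 2, fun x => ?_⟩
    have := hC x
    have := x.one_le_size
    have := e.size_eval_lt (Store.start x)
    have : (e.eval (Store.start x)).tl.size ≤ (e.eval (Store.start x)).size := by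
      cases e.eval (Store.start x) <;> simp [Data.tl, Data.size]
    simp only [Expr.time, Expr.eval, add_mul, mul_assoc]
    omega
  | eq e f he hf =>
    obtain ⟨C, hC⟩ := he
    obtain ⟨D, hD⟩ := hf
    refine ⟨C + D + 4, fun x => ?_⟩
    have := hC x
    have := hD x
    have := x.one_le_size
    have : ∀ b, (Data.ofBool b).size ≤ 3 := by intro b; cases b <;> simp [Data.ofBool, Data.size]
    have := this (decide (e.eval (Store.start x) = f.eval (Store.start x)))
    simp only [Expr.time, Expr.eval, add_mul]
    omega

/-! ### Encodings of the basic types -/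

instance : Enc Data := ⟨id⟩

instance {α β : Type} [Enc α] [Enc β] : Enc (α × β) := ⟨fun z => Data.cons (Enc.enc z.1) (Enc.enc z.2)⟩

instance : Enc Bool := ⟨Data.ofBool⟩

instance : Enc Unit := ⟨fun _ => Data.nil⟩

instance {α : Type} [Enc α] : Enc (List α) := ⟨fun l => Data.ofList (l.map Enc.enc)⟩

instance : Enc ℕ := ⟨Data.unary⟩

instance : Enc ℚ≥0 := ⟨Data.ofRat⟩

theorem Store.update_start (x y : Data) : Function.update (Store.start x) 0 y = Store.start y := by
  ext i; by_cases hi : i = 0 <;> simp [Store.start, hi]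

/-! ### Closure of polynomial time under composition, pairing and case distinction -/

namespace PolyTime

open Enc

variable {α β γ δ : Type} [Enc α] [Enc β] [Enc γ] [Enc δ]

theorem size_bound {f : α → β} (hf : PolyTime f) : PolyBound fun a => esize (f a) := by
  obtain ⟨c, T, hT, h⟩ := hf
  refine (PolyBound.size.add hT).mono fun a => ?_
  obtain ⟨k, hk, hc⟩ := h a
  have := hc.size_le 0
  simp only [Store.start, if_true] at this
  simp only [esize]
  omega

/-- A program sees only encodings, so functions with equal encodings share a program. This moves
results between a type and its presentations: numbers and lists of units, graphs and their raw
lists. -/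
theorem congr_enc {f : α → β} {g : α → γ} (hf : PolyTime f) (h : ∀ a, enc (g a) = enc (f a)) :
    PolyTime g := by
  obtain ⟨c, T, hT, hc⟩ := hf
  exact ⟨c, T, hT, fun a => by rw [h]; exact hc a⟩

theorem of_expr {f : α → β} (e : Expr) (h : ∀ a, e.eval (Store.start (enc a)) = enc (f a)) :
    PolyTime f := by
  obtain ⟨C, hC⟩ := e.time_linear
  refine ⟨Prog.assign 0 e, fun a => 1 + C * esize a,
    (PolyBound.const 1).add ((PolyBound.const C).mul PolyBound.size), fun a =>
    ⟨1 + e.time (Store.start (enc a)), by have := hC (enc a); simp only [esize]; omega, ?_⟩⟩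
  refine (Exec.assign 0 e _).trans_eq ?_
  rw [Store.update_start, h]

theorem comp {g : β → γ} {f : α → β} (hg : PolyTime g) (hf : PolyTime f) :
    PolyTime fun a => g (f a) := by
  have hs := hf.size_bound
  obtain ⟨c, T, hT, hc⟩ := hf
  obtain ⟨d, U, hU, hd⟩ := hg
  refine ⟨Prog.seq c d, fun a => T a + U (f a), hT.add (hU.comp hs), fun a => ?_⟩
  obtain ⟨k, hk, h1⟩ := hc a
  obtain ⟨l, hl, h2⟩ := hd (f a)
  exact ⟨k + l, by beta_reduce; omega, h1.seq h2⟩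

theorem id : PolyTime fun a : α => a := of_expr (Expr.var 0) fun a => by simp [Expr.eval, Store.start]

theorem fst {f : α → β × γ} (hf : PolyTime f) : PolyTime fun a => (f a).1 :=
  comp (g := Prod.fst) (of_expr (Expr.hd (Expr.var 0)) fun a => by
    simp [Expr.eval, Store.start, enc, Data.hd]) hf

theorem snd {f : α → β × γ} (hf : PolyTime f) : PolyTime fun a => (f a).2 :=
  comp (g := Prod.snd) (of_expr (Expr.tl (Expr.var 0)) fun a => by
    simp [Expr.eval, Store.start, enc, Data.tl]) hf

/-- An expression denoting a given value. -/
def _root_.Data.toExpr : Data → Expr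
  | Data.nil => Expr.nil
  | Data.cons x y => Expr.cons x.toExpr y.toExpr

theorem _root_.Data.eval_toExpr (x : Data) (σ : Store) : x.toExpr.eval σ = x := by
  induction x with
  | nil => rfl
  | cons x y hx hy => simp [Data.toExpr, Expr.eval, hx, hy]

theorem const (b : β) : PolyTime fun _ : α => b :=
  of_expr (enc b).toExpr fun _ => Data.eval_toExpr _ _

/-- The input and the first result are parked in two variables that neither program touches; by
`Exec.frame` both runs ignore them. -/
theorem pair {f : α → β} {g : α → γ} (hf : PolyTime f) (hg : PolyTime g) :
    PolyTime fun a => (f a, g a) := by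
  have hs := hf.size_bound
  have hs' := hg.size_bound
  obtain ⟨c, T, hT, hc⟩ := hf
  obtain ⟨d, U, hU, hd⟩ := hg
  -- The variables `N` and `N + 1` are fresh for both programs, and the summand `1` keeps `N` away
  -- from the input variable `0`.
  obtain ⟨N, hN⟩ : ∃ N, N = c.bound + d.bound + 1 := ⟨_, rfl⟩
  refine ⟨.seq (.assign N (.var 0)) (.seq c (.seq (.assign (N + 1) (.var 0))
    (.seq (.assign 0 (.var N)) (.seq d (.seq (.assign 0 (.cons (.var (N + 1)) (.var 0)))
      (.seq (.assign N .nil) (.assign (N + 1) .nil))))))),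
    fun a => 20 + 3 * esize a + 5 * esize (f a) + 5 * esize (g a) + T a + U a,
    ((((((PolyBound.const 20).add ((PolyBound.const 3).mul PolyBound.size)).add
      ((PolyBound.const 5).mul hs)).add ((PolyBound.const 5).mul hs')).add hT).add hU),
    fun a => ?_⟩
  obtain ⟨k, hk, h1⟩ := hc a
  obtain ⟨l, hl, h2⟩ := hd a
  set x := enc a with hx
  set y := enc (f a) with hy
  set z := enc (g a) with hz
  let st : Data → Data → Data → Store := fun u v w i =>
    if i = 0 then u else if i = N then v else if i = N + 1 then w else Data.nil
  have hN0 : N ≠ 0 := by omega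
  have r1 : Exec (.assign N (.var 0)) (Store.start x) (st x x .nil) (1 + (1 + x.size)) := by
    refine (Exec.assign N (.var 0) _).trans_eq ?_
    ext i
    by_cases h0 : i = 0
    · subst h0; simp [st, Store.start, hN0.symm]
    · by_cases hi : i = N
      · subst hi; simp [st, Store.start, Expr.eval, hN0]
      · simp [st, Store.start, h0, hi]
  have r2 : Exec c (st x x .nil) (st y x .nil) k := by
    refine (h1.frame N (by omega) (st x x .nil) fun i hi => ?_).trans_eq ?_
    · have h3 : i ≠ N := by omega
      have h4 : i ≠ N + 1 := by omega
      simp [st, Store.start, h3, h4]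
    · ext i
      by_cases hi : i < N
      · have h3 : i ≠ N := by omega
        have h4 : i ≠ N + 1 := by omega
        simp [st, Store.start, hi, h3, h4]
      · have h3 : i ≠ 0 := by omega
        simp [st, hi, h3]
  have r3 : Exec (.assign (N + 1) (.var 0)) (st y x .nil) (st y x y) (1 + (1 + y.size)) := by
    refine (Exec.assign (N + 1) (.var 0) _).trans_eq ?_
    ext i
    by_cases h0 : i = N + 1
    · subst h0; simp [st, Expr.eval]
    · simp [st, h0]
  have r4 : Exec (.assign 0 (.var N)) (st y x y) (st x x y) (1 + (1 + x.size)) := by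
    refine (Exec.assign 0 (.var N) _).trans_eq' ?_ ?_
    · ext i
      by_cases h0 : i = 0
      · subst h0; simp [st, Expr.eval, hN0]
      · simp [st, h0]
    · simp [Expr.time, st, hN0]
  have r5 : Exec d (st x x y) (st z x y) l := by
    refine (h2.frame N (by omega) (st x x y) fun i hi => ?_).trans_eq ?_
    · have h3 : i ≠ N := by omega
      have h4 : i ≠ N + 1 := by omega
      simp [st, Store.start, h3, h4]
    · ext i
      by_cases hi : i < N
      · have h3 : i ≠ N := by omega
        have h4 : i ≠ N + 1 := by omega
        simp [st, Store.start, hi, h3, h4]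
      · have h3 : i ≠ 0 := by omega
        simp [st, hi, h3]
  have r6 : Exec (.assign 0 (.cons (.var (N + 1)) (.var 0))) (st z x y) (st (.cons y z) x y)
      (1 + (1 + y.size + (1 + z.size) + (1 + (1 + y.size + z.size)))) := by
    refine (Exec.assign 0 (.cons (.var (N + 1)) (.var 0)) _).trans_eq' ?_ ?_
    · ext i
      by_cases h0 : i = 0
      · subst h0; simp [st, Expr.eval]
      · simp [st, h0]
    · simp [Expr.time, Expr.eval, st, Data.size]
  have r7 : Exec (.assign N .nil) (st (.cons y z) x y) (st (.cons y z) .nil y) 3 := by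
    refine (Exec.assign N .nil _).trans_eq' ?_ ?_
    · ext i
      by_cases h0 : i = N
      · subst h0; simp [st, Expr.eval, hN0]
      · simp [st, h0]
    · simp [Expr.time, Data.size]
  have r8 : Exec (.assign (N + 1) .nil) (st (.cons y z) .nil y) (Store.start (.cons y z)) 3 := by
    refine (Exec.assign (N + 1) .nil _).trans_eq' ?_ ?_
    · ext i
      by_cases h0 : i = N + 1
      · subst h0; simp [st, Expr.eval, Store.start]
      · by_cases h1 : i = 0 <;> simp [st, h0, Store.start, h1]
    · simp [Expr.time, Data.size]
  refine ⟨_, ?_, r1.seq (r2.seq (r3.seq (r4.seq (r5.seq (r6.seq (r7.seq r8))))))⟩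
  have e1 : esize a = x.size := rfl
  have e2 : esize (f a) = y.size := rfl
  have e3 : esize (g a) = z.size := rfl
  beta_reduce
  omega

/-- Case distinction on a decidable property. -/
theorem ite {p : α → Prop} [DecidablePred p] {f g : α → β}
    (hp : PolyTime fun a => decide (p a)) (hf : PolyTime f) (hg : PolyTime g) :
    PolyTime fun a => if p a then f a else g a := by
  have hq := hp.pair id
  have hs := hq.size_bound
  obtain ⟨c, T, hT, hc⟩ := hf
  obtain ⟨d, U, hU, hd⟩ := hg
  refine comp (f := fun a => (decide (p a), a)) (g := fun z : Bool × α =>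
    if z.1 then f z.2 else g z.2) ?_ hq |>.congr_enc fun a => by simp
  refine ⟨.ite (.hd (.var 0)) (.seq (.assign 0 (.tl (.var 0))) c)
    (.seq (.assign 0 (.tl (.var 0))) d), fun z => 6 + 4 * esize z + T z.2 + U z.2,
    (((PolyBound.const 6).add ((PolyBound.const 4).mul PolyBound.size)).add
      (hT.comp (snd id).size_bound)).add (hU.comp (snd id).size_bound), ?_⟩
  rintro ⟨b, a⟩
  have hz : esize (b, a) = 1 + (enc b).size + (enc a).size := rfl
  obtain ⟨k, hk, h1⟩ := hc a
  obtain ⟨l, hl, h2⟩ := hd a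
  have r : Exec (.assign 0 (.tl (.var 0))) (Store.start (enc (b, a))) (Store.start (enc a))
      (1 + (1 + esize (b, a) + (1 + (enc a).size))) := by
    refine (Exec.assign 0 (.tl (.var 0)) _).trans_eq' ?_ ?_
    · rw [Store.update_start]; rfl
    · simp [Expr.time, Expr.eval, Store.start, esize]; rfl
  have ht : (Expr.hd (.var 0)).time (Store.start (enc (b, a))) =
      1 + esize (b, a) + (1 + (enc b).size) := by
    simp [Expr.time, Expr.eval, Store.start, esize]; rfl
  cases b with
  | true =>
    refine ⟨_, ?_, Exec.ite_true ?_ (r.seq h1)⟩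
    · rw [ht]; simp only; omega
    · simp [Expr.eval, Store.start, enc, Data.hd, Data.ofBool]
  | false =>
    refine ⟨_, ?_, Exec.ite_false ?_ (r.seq h2)⟩
    · rw [ht]; simp only; omega
    · simp [Expr.eval, Store.start, enc, Data.hd, Data.ofBool]

end PolyTime

/-! ### Lists: folding, and the list functions derived from it -/

namespace PolyTime

open Enc

variable {α β γ δ : Type} [Enc α] [Enc β] [Enc γ] [Enc δ]

theorem _root_.esize_pair (a : α) (b : β) : esize (a, b) = 1 + esize a + esize b := rfl

theorem _root_.esize_nil : esize ([] : List α) = 1 := rfl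

theorem _root_.esize_cons (a : α) (l : List α) : esize (a :: l) = 1 + esize a + esize l := rfl

/-- The loop keeps the triple of parameter, remaining list and accumulator. Its test reads the
remaining list, which is `nil` exactly when the work is done. `B` bounds the list and all
intermediate accumulators, `M` the time of one round. -/
theorem exec_fold {F : α → γ → β → γ} {c : Prog} {T : α × (β × List β) × γ → ℕ}
    (hc : ∀ z, ∃ k ≤ T z, Exec c (Store.start (enc z))
      (Store.start (enc (z.1, z.2.1.2, F z.1 z.2.2 z.2.1.1))) k) (a : α) (M B : ℕ)
    (hM : ∀ b l acc, esize (b :: l) ≤ B → esize acc ≤ B → T (a, (b, l), acc) ≤ M) (l : List β) :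
    ∀ acc : γ, esize l ≤ B →
      (∀ l₁ l₂, l = l₁ ++ l₂ → esize (l₁.foldl (F a) acc) ≤ B) →
      ∃ k ≤ (l.length + 1) * (M + 7 + esize a + 5 * B),
        Exec (.loop (.hd (.tl (.var 0))) c) (Store.start (enc (a, l, acc)))
          (Store.start (enc (a, ([] : List β), l.foldl (F a) acc))) k := by
  have ht : ∀ (l : List β) (acc : γ), esize l ≤ B → esize acc ≤ B →
      (Expr.hd (.tl (.var 0))).time (Store.start (enc (a, l, acc))) + 1 ≤
        7 + esize a + 5 * B := by
    intro l acc hl hacc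
    have h1 : (Expr.hd (.tl (.var 0))).time (Store.start (enc (a, l, acc))) =
        6 + esize a + 3 * esize l + 2 * esize acc := by
      simp [Expr.time, Expr.eval, Store.start, enc, Data.hd, Data.tl, Data.size, esize]
      omega
    omega
  induction l with
  | nil =>
    intro acc hl hacc
    refine ⟨_, ?_, Exec.loop_stop ?_⟩
    · have := ht [] acc hl (hacc [] [] rfl)
      simp only [List.length_nil, zero_add, one_mul]
      omega
    · simp [Expr.eval, Store.start, enc, Data.hd, Data.tl, Data.ofList]
  | cons b l ih =>
    intro acc hl hacc
    have h0 := hacc [] (b :: l) rfl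
    rw [List.foldl_nil] at h0
    obtain ⟨k, hk, h1⟩ := hc (a, (b, l), acc)
    have hl' : esize l ≤ B := by rw [esize_cons] at hl; omega
    obtain ⟨k', hk', h2⟩ := ih (F a acc b) hl' fun l₁ l₂ h => by
      have := hacc (b :: l₁) l₂ (by rw [h]; rfl)
      simpa using this
    have := hM b l acc hl h0
    have := ht (b :: l) acc hl h0
    refine ⟨_, ?_, Exec.loop_step ?_ h1 h2⟩
    · rw [List.length_cons, add_mul (l.length + 1), one_mul]
      omega
    · simp [Expr.eval, Store.start, enc, Data.hd, Data.tl, Data.ofList]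

theorem _root_.length_lt_esize (l : List α) : l.length < esize l := by
  induction l with
  | nil => simp [esize_nil]
  | cons a l ih => rw [esize_cons, List.length_cons]; omega

/-- Folding over a list, if the accumulator stays small. -/
theorem foldl {l : α → List β} {init : α → γ} {F : α → γ → β → γ} (hl : PolyTime l)
    (hi : PolyTime init) (hF : PolyTime fun z : α × β × γ => F z.1 z.2.2 z.2.1) {B : α → ℕ}
    (hB : PolyBound B)
    (h : ∀ a l₁ l₂, l a = l₁ ++ l₂ → esize (l₁.foldl (F a) (init a)) ≤ B a) :
    PolyTime fun a => (l a).foldl (F a) (init a) := by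
  have hpre : PolyTime fun a => (a, l a, init a) := id.pair (hl.pair hi)
  have hstep : PolyTime fun z : α × (β × List β) × γ => (z.1, z.2.1.2, F z.1 z.2.2 z.2.1.1) :=
    id.fst.pair (id.snd.fst.snd.pair
      (hF.comp (id.fst.pair (id.snd.fst.fst.pair id.snd.snd))))
  have hs := hpre.size_bound
  have hls := hl.size_bound
  obtain ⟨c, T, hT, hc⟩ := hpre
  obtain ⟨d, U, ⟨p, hp⟩, hd⟩ := hstep
  have key : PolyTime fun a => (a, ([] : List β), (l a).foldl (F a) (init a)) := by
    -- One bound for both changing components of the loop state, the remaining list and the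
    -- accumulator.
    let C : α → ℕ := fun a => B a + esize (l a)
    have hC : PolyBound C := hB.add hls
    let M : α → ℕ := fun a => p.eval (2 + esize a + 2 * C a)
    have hM : PolyBound M :=
      (((PolyBound.const 2).add PolyBound.size).add ((PolyBound.const 2).mul hC)).eval p
    refine ⟨.seq c (.loop (.hd (.tl (.var 0))) d),
      fun a => T a + esize (l a) * (M a + 7 + esize a + 5 * C a),
      hT.add (hls.mul (((hM.add (.const 7)).add .size).add ((PolyBound.const 5).mul hC))),
      fun a => ?_⟩
    obtain ⟨k, hk, h1⟩ := hc a
    obtain ⟨k', hk', h2⟩ := exec_fold hd a (M a) (C a) (fun b l' acc hl' hacc => by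
        refine (hp _).trans (eval_mono_nat p ?_)
        rw [esize_pair, esize_pair, esize_pair]
        rw [esize_cons] at hl'
        omega) (l a) (init a) (Nat.le_add_left _ _) fun l₁ l₂ h' =>
          (h a l₁ l₂ h').trans (Nat.le_add_right _ _)
    refine ⟨k + k', ?_, h1.seq h2⟩
    have : ((l a).length + 1) * (M a + 7 + esize a + 5 * C a) ≤
        esize (l a) * (M a + 7 + esize a + 5 * C a) :=
      Nat.mul_le_mul_right _ (length_lt_esize (l a))
    beta_reduce
    omega
  exact key.snd.snd

/-- Types with an injective encoding. -/
class _root_.LawfulEnc (α : Type) [Enc α] : Prop where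
  /-- the encoding is injective -/
  inj : Function.Injective (enc : α → Data)

instance : LawfulEnc Bool := ⟨by rintro (_ | _) (_ | _) h <;> simp_all [enc, Data.ofBool]⟩

theorem _root_.Data.ofList_injective : Function.Injective Data.ofList := by
  intro l
  induction l with
  | nil => intro m h; cases m <;> simp_all [Data.ofList]
  | cons a l ih =>
    intro m h
    cases m with
    | nil => simp [Data.ofList] at h
    | cons b m =>
      simp only [Data.ofList, Data.cons.injEq] at h
      rw [h.1, ih h.2]

instance [LawfulEnc α] : LawfulEnc (List α) := ⟨fun _ _ h =>
  List.map_injective_iff.2 LawfulEnc.inj (Data.ofList_injective h)⟩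

instance : LawfulEnc ℕ := ⟨fun a b h => by
  have := congrArg List.length (Data.ofList_injective h)
  simpa using this⟩

theorem _root_.Data.binary_injective : Function.Injective Data.binary := by
  intro a b h
  have h1 := List.map_injective_iff.2 (LawfulEnc.inj (α := Bool)) (Data.ofList_injective h)
  apply Nat.digits.injective 2
  rw [Nat.digits_two_eq_bits, Nat.digits_two_eq_bits, h1]

instance : LawfulEnc ℚ≥0 := ⟨fun _ _ h => by
  simp only [enc, Data.ofRat, Data.cons.injEq] at h
  exact NNRat.ext_num_den (Data.binary_injective h.1) (Data.binary_injective h.2)⟩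

/-- The machine compares encodings; injectivity turns this into equality of the encoded objects. -/
theorem decide_eq [DecidableEq β] [LawfulEnc β] {f g : α → β} (hf : PolyTime f)
    (hg : PolyTime g) : PolyTime fun a => decide (f a = g a) :=
  comp (g := fun z : β × β => decide (z.1 = z.2))
    (of_expr (.eq (.hd (.var 0)) (.tl (.var 0))) fun z => by
      simp [Expr.eval, Store.start, enc, Data.hd, Data.tl, LawfulEnc.inj.eq_iff]) (hf.pair hg)

theorem of_eq {f g : α → β} (hf : PolyTime f) (h : ∀ a, g a = f a) : PolyTime g :=
  (funext h : g = f) ▸ hf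

theorem bnot {f : α → Bool} (hf : PolyTime f) : PolyTime fun a => !(f a) :=
  ((decide_eq hf (const false))).of_eq fun a => by cases f a <;> rfl

theorem band {f g : α → Bool} (hf : PolyTime f) (hg : PolyTime g) :
    PolyTime fun a => f a && g a :=
  (ite (p := fun a => f a = true) (decide_eq hf (const true)) hg (const false)).of_eq fun a => by
    cases f a <;> rfl

theorem bor {f g : α → Bool} (hf : PolyTime f) (hg : PolyTime g) :
    PolyTime fun a => f a || g a :=
  (ite (p := fun a => f a = true) (decide_eq hf (const true)) (const true) hg).of_eq fun a => by
    cases f a <;> rfl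

/-- Case distinction on a Boolean. -/
theorem cond {b : α → Bool} {f g : α → β} (hb : PolyTime b) (hf : PolyTime f) (hg : PolyTime g) :
    PolyTime fun a => if b a then f a else g a :=
  ite (p := fun a => b a = true) (decide_eq hb (const true)) hf hg

theorem cons {f : α → β} {g : α → List β} (hf : PolyTime f) (hg : PolyTime g) :
    PolyTime fun a => f a :: g a :=
  (hf.pair hg).congr_enc fun _ => rfl

theorem succ {f : α → ℕ} (hf : PolyTime f) : PolyTime fun a => f a + 1 :=
  ((const ()).pair hf).congr_enc fun _ => rfl

theorem tail {f : α → List β} (hf : PolyTime f) : PolyTime fun a => (f a).tail :=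
  comp (g := List.tail) (of_expr (.tl (.var 0)) fun l => by
    cases l <;> simp [Expr.eval, Store.start, enc, Data.ofList, Data.tl]) hf

theorem headD {f : α → List β} {g : α → β} (hf : PolyTime f) (hg : PolyTime g) :
    PolyTime fun a => (f a).headD (g a) := by
  have h1 : PolyTime fun z : List β × β => (z.1.isEmpty : Bool) :=
    comp (g := fun l : List β => l.isEmpty)
      (of_expr (.eq (.var 0) .nil) fun l => by
        cases l <;> simp [Expr.eval, Store.start, enc, Data.ofList]) id.fst
  have h2 : PolyTime fun z : List β × β => if z.1.isEmpty then enc z.2 else (enc z.1).hd :=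
    cond h1 (id.snd.congr_enc fun _ => rfl)
      (comp (g := Data.hd) (of_expr (.hd (.var 0)) fun _ => rfl) (id.fst.congr_enc fun _ => rfl))
  refine comp (g := fun z : List β × β => z.1.headD z.2) (h2.congr_enc ?_) (hf.pair hg)
  rintro ⟨_ | ⟨b, l⟩, d⟩ <;> rfl

theorem _root_.esize_append (l m : List α) : esize (l ++ m) + 1 = esize l + esize m := by
  induction l with
  | nil => rw [esize_nil, List.nil_append]; omega
  | cons a l ih => rw [List.cons_append, esize_cons, esize_cons]; omega

theorem _root_.esize_reverse (l : List α) : esize l.reverse = esize l := by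
  induction l with
  | nil => rfl
  | cons a l ih =>
    have := esize_append l.reverse [a]
    rw [esize_cons, esize_nil] at this
    rw [List.reverse_cons, esize_cons]; omega

theorem reverse {f : α → List β} (hf : PolyTime f) : PolyTime fun a => (f a).reverse := by
  refine (foldl (F := fun _ acc b => b :: acc) (init := fun _ => []) hf (const [])
    (cons id.snd.fst id.snd.snd) hf.size_bound fun a l₁ l₂ h => ?_).of_eq fun a => by simp
  have h1 : l₁.foldl (fun acc b => b :: acc) [] = l₁.reverse := by
    simp
  have := esize_append l₁ l₂
  have := one_le_esize l₂
  rw [h1, esize_reverse, h]; omega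

theorem _root_.esize_le_of_mem {l : List α} {a : α} (h : a ∈ l) : esize a < esize l := by
  induction l with
  | nil => simp at h
  | cons b l ih =>
    rw [esize_cons]
    rcases List.mem_cons.1 h with rfl | h
    · omega
    · have := ih h; omega

theorem _root_.esize_le_of_bounded (l : List α) (M : ℕ) (h : ∀ a ∈ l, esize a ≤ M) :
    esize l ≤ 1 + l.length * (1 + M) := by
  induction l with
  | nil => simp [esize_nil]
  | cons b l ih =>
    rw [esize_cons, List.length_cons, add_mul]
    have := h b (by simp)
    have := ih fun a ha => h a (by simp [ha])
    omega

theorem map {l : α → List β} {f : α → β → γ} (hl : PolyTime l)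
    (hf : PolyTime fun z : α × β => f z.1 z.2) : PolyTime fun a => (l a).map (f a) := by
  obtain ⟨p, hp⟩ := hf.size_bound
  have hb : ∀ a, ∀ b ∈ l a, esize (f a b) ≤ p.eval (1 + esize a + esize (l a)) := by
    intro a b hb
    refine (hp (a, b)).trans (eval_mono_nat p ?_)
    have := esize_le_of_mem hb
    rw [esize_pair]; omega
  refine (reverse (foldl (F := fun a acc b => f a b :: acc) (init := fun _ => []) hl (const [])
    (cons (hf.comp (id.fst.pair id.snd.fst)) id.snd.snd)
    (B := fun a => 1 + esize (l a) * (1 + p.eval (1 + esize a + esize (l a))))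
    ((PolyBound.const 1).add (hl.size_bound.mul ((PolyBound.const 1).add
      ((((PolyBound.const 1).add .size).add hl.size_bound).eval p))))
    fun a l₁ l₂ h => ?_)).of_eq fun a => ?_
  · have h1 : ∀ (l : List β), l.foldl (fun acc b => f a b :: acc) [] = (l.map (f a)).reverse := by
      intro l; rw [← List.foldl_map (f := f a) (g := fun acc b => b :: acc)]; simp
    rw [h1, esize_reverse]
    refine (esize_le_of_bounded _ (p.eval (1 + esize a + esize (l a))) ?_).trans ?_
    · intro c hc
      obtain ⟨b, hb', rfl⟩ := List.mem_map.1 hc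
      exact hb a b (by rw [h]; simp [hb'])
    · have : (l₁.map (f a)).length ≤ esize (l a) := by
        have := length_lt_esize (l a)
        rw [h, List.length_append] at this
        rw [List.length_map, h]; omega
      gcongr
  · rw [← List.foldl_map (f := f a) (g := fun acc b => b :: acc)]; simp

theorem any {l : α → List β} {f : α → β → Bool} (hl : PolyTime l)
    (hf : PolyTime fun z : α × β => f z.1 z.2) : PolyTime fun a => (l a).any (f a) := by
  refine (foldl (F := fun a acc b => acc || f a b) (init := fun _ => false) hl (const false)
    (bor id.snd.snd (hf.comp (id.fst.pair id.snd.fst))) (PolyBound.const 3)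
    fun a l₁ l₂ h => ?_).of_eq fun a => ?_
  · generalize l₁.foldl _ _ = b
    cases b <;> simp [esize, enc, Data.ofBool, Data.size]
  · have : ∀ (l : List β) (b : Bool), l.foldl (fun acc b => acc || f a b) b = (b || l.any (f a)) := by
      intro l
      induction l with
      | nil => simp
      | cons x l ih => intro b; simp [ih, Bool.or_assoc]
    simp [this]

theorem all {l : α → List β} {f : α → β → Bool} (hl : PolyTime l)
    (hf : PolyTime fun z : α × β => f z.1 z.2) : PolyTime fun a => (l a).all (f a) :=
  (bnot (any (f := fun a b => !(f a b)) hl (bnot hf))).of_eq fun a => by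
    simp [List.all_eq_not_any_not]

theorem mem [DecidableEq β] [LawfulEnc β] {f : α → β} {g : α → List β} (hf : PolyTime f)
    (hg : PolyTime g) : PolyTime fun a => decide (f a ∈ g a) :=
  (any (f := fun a b => decide (b = f a)) hg (decide_eq id.snd (hf.comp id.fst))).of_eq fun a => by
    rw [Bool.eq_iff_iff]; simp

theorem filter {l : α → List β} {f : α → β → Bool} (hl : PolyTime l)
    (hf : PolyTime fun z : α × β => f z.1 z.2) : PolyTime fun a => (l a).filter (f a) := by
  have h1 : ∀ a (l : List β), l.foldl (fun acc b => if f a b then b :: acc else acc) [] =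
      (l.filter (f a)).reverse := by
    intro a l
    rw [← List.foldl_filter (p := f a) (f := fun acc b => b :: acc)]; simp
  refine (reverse (foldl (F := fun a acc b => if f a b then b :: acc else acc) (init := fun _ => [])
    hl (const []) (cond (hf.comp (id.fst.pair id.snd.fst)) (cons id.snd.fst id.snd.snd) id.snd.snd)
    hl.size_bound fun a l₁ l₂ h => ?_)).of_eq fun a => ?_
  · rw [h1, esize_reverse, h]
    have h2 : ∀ l : List β, esize (l.filter (f a)) ≤ esize l := by
      intro l
      induction l with
      | nil => simp
      | cons b l ih =>
        rw [esize_cons, List.filter_cons]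
        split_ifs
        · rw [esize_cons]; omega
        · omega
    have := h2 l₁
    have := esize_append l₁ l₂
    have := one_le_esize l₂
    omega
  · rw [h1, List.reverse_reverse]

theorem append {f g : α → List β} (hf : PolyTime f) (hg : PolyTime g) :
    PolyTime fun a => f a ++ g a := by
  refine (foldl (F := fun _ acc b => b :: acc) (reverse hf) hg (cons id.snd.fst id.snd.snd)
    (hf.size_bound.add hg.size_bound) fun a l₁ l₂ h => ?_).of_eq fun a => by simp
  have h1 : l₁.foldl (fun acc b => b :: acc) (g a) = l₁.reverse ++ g a := by simp
  have h2 := esize_append l₁.reverse (g a)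
  have h3 := esize_append l₁ l₂
  rw [esize_reverse] at h2
  rw [← h, esize_reverse] at h3
  have := one_le_esize l₂
  rw [h1]; omega

theorem flatten {f : α → List (List β)} (hf : PolyTime f) : PolyTime fun a => (f a).flatten := by
  have h1 : ∀ (l : List (List β)) (acc : List β),
      l.foldl (fun acc b => acc ++ b) acc = acc ++ l.flatten := by
    intro l
    induction l with
    | nil => simp
    | cons b l ih => intro acc; simp [ih]
  have h2 : ∀ l : List (List β), esize l.flatten ≤ esize l := by
    intro l
    induction l with
    | nil => simp [esize_nil]
    | cons b l ih =>
      rw [List.flatten_cons, esize_cons]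
      have := esize_append b l.flatten
      omega
  refine (foldl (F := fun _ acc b => acc ++ b) (init := fun _ => []) hf (const [])
    (append id.snd.snd id.snd.fst) hf.size_bound fun a l₁ l₂ h => ?_).of_eq fun a => by simp [h1]
  have := h2 l₁
  have := esize_append l₁ l₂
  have := one_le_esize l₂
  rw [h1, List.nil_append, h]; omega

theorem flatMap {l : α → List β} {f : α → β → List γ} (hl : PolyTime l)
    (hf : PolyTime fun z : α × β => f z.1 z.2) : PolyTime fun a => (l a).flatMap (f a) :=
  flatten (map hl hf)

theorem length {l : α → List β} (hl : PolyTime l) : PolyTime fun a => (l a).length :=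
  (map (f := fun _ _ => ()) hl (const ())).congr_enc fun a => by
    simp only [enc, Data.unary, List.map_map]
    congr 1
    rw [← List.map_const']
    rfl

/-- A natural number as a list without content. -/
theorem units {n : α → ℕ} (hn : PolyTime n) : PolyTime fun a => List.replicate (n a) () :=
  hn.congr_enc fun a => by simp [enc, Data.unary]

theorem _root_.esize_nat (n : ℕ) : esize n = 1 + 2 * n := by
  induction n with
  | zero => rfl
  | succ n ih =>
    have : esize (n + 1) = 1 + 1 + esize n := rfl
    omega

theorem range {n : α → ℕ} (hn : PolyTime n) : PolyTime fun a => List.range (n a) := by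
  -- The length of the accumulator serves as the counter.
  have h1 : ∀ k, (List.replicate k ()).foldl (fun (acc : List ℕ) _ => acc.length :: acc) [] =
      (List.range k).reverse := by
    intro k
    induction k with
    | zero => rfl
    | succ k ih =>
      rw [List.replicate_succ', List.foldl_append, ih, List.range_succ]
      simp
  have hs := hn.size_bound
  refine (reverse (foldl (F := fun _ (acc : List ℕ) _ => acc.length :: acc) (init := fun _ => [])
    (units hn) (const []) (cons (length id.snd.snd) id.snd.snd)
    (B := fun a => 1 + esize (n a) * (1 + esize (n a)))
    ((PolyBound.const 1).add (hs.mul ((PolyBound.const 1).add hs)))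
    fun a l₁ l₂ h => ?_)).of_eq fun a => by rw [h1, List.reverse_reverse]
  have hl : l₁.length ≤ n a := by
    have := congrArg List.length h
    simp at this; omega
  have h2 : l₁ = List.replicate l₁.length () := by
    rw [List.eq_replicate_iff]; simp
  rw [h2, h1, esize_reverse]
  refine (esize_le_of_bounded _ (esize (n a)) fun k hk => ?_).trans ?_
  · rw [List.mem_range] at hk
    rw [esize_nat, esize_nat]; omega
  · rw [List.length_range]
    have : l₁.length ≤ esize (n a) := by rw [esize_nat]; omega
    gcongr

/-- A fold over a list of units. As the number of rounds is in unary, it is polynomial; only the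
size of the iterates has to be bounded by hand. -/
theorem iterate {n : α → ℕ} {init : α → β} {f : α → β → β} (hn : PolyTime n)
    (hi : PolyTime init) (hf : PolyTime fun z : α × β => f z.1 z.2) {B : α → ℕ} (hB : PolyBound B)
    (h : ∀ a, ∀ k ≤ n a, esize ((f a)^[k] (init a)) ≤ B a) :
    PolyTime fun a => (f a)^[n a] (init a) := by
  have h1 : ∀ a (l : List Unit), l.foldl (fun acc _ => f a acc) (init a) =
      (f a)^[l.length] (init a) := by
    intro a l
    generalize init a = b
    induction l generalizing b with
    | nil => rfl
    | cons _ l ih => simp [ih]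
  refine (foldl (F := fun a acc _ => f a acc) (units hn) hi
    (hf.comp (id.fst.pair id.snd.snd)) hB fun a l₁ l₂ h' => ?_).of_eq fun a => by
      rw [h1, List.length_replicate]
  rw [h1]
  refine h a _ ?_
  have := congrArg List.length h'
  simp at this; omega

theorem getD {l : α → List β} {i : α → ℕ} {d : α → β} (hl : PolyTime l) (hi : PolyTime i)
    (hd : PolyTime d) : PolyTime fun a => (l a).getD (i a) (d a) := by
  have h1 : ∀ (l : List β) (k : ℕ), List.tail^[k] l = l.drop k := by
    intro l k
    induction k generalizing l with
    | zero => rfl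
    | succ k ih => rw [Function.iterate_succ_apply, ih]; cases l <;> simp
  refine (headD (iterate (f := fun _ => List.tail) hi hl (tail id.snd) hl.size_bound
    fun a k _ => ?_) hd).of_eq fun a => ?_
  · have := esize_append ((l a).take k) ((l a).drop k)
    rw [List.take_append_drop] at this
    have := one_le_esize ((l a).take k)
    rw [h1]; omega
  · rw [h1, List.getD_eq_getElem?_getD, List.headD_eq_head?_getD, List.head?_drop]

theorem getLastD {l : α → List β} {d : α → β} (hl : PolyTime l) (hd : PolyTime d) :
    PolyTime fun a => (l a).getLastD (d a) :=
  (headD (reverse hl) hd).of_eq fun a => by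
    rw [List.headD_eq_head?_getD, List.head?_reverse, List.getLastD_eq_getLast?]

end PolyTime

/-! ### Reachability, cuts and relative feasibility -/

open scoped Classical in
/-- The set of vertices that can be reached from `s`. -/
noncomputable def CostGraph.comp (G : CostGraph) (H : Finset G.Edge) (s : G.Vert) : Finset G.Vert :=
  Finset.univ.filter fun v => G.Reach H s v

namespace CostGraph

variable {G : CostGraph}

theorem mem_cut {H : Finset G.Edge} {A : Finset G.Vert} {e : G.Edge} :
    e ∈ G.cut H A ↔ e ∈ H ∧ ¬((G.ends e).1 ∈ A ↔ (G.ends e).2 ∈ A) := by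
  simp [cut]

theorem mem_comp {H : Finset G.Edge} {s v : G.Vert} : v ∈ G.comp H s ↔ G.Reach H s v := by
  simp [comp]

theorem cut_mono {H H' : Finset G.Edge} (h : H ⊆ H') (A : Finset G.Vert) :
    G.cut H A ⊆ G.cut H' A := Finset.filter_subset_filter _ h

theorem cut_compl (H : Finset G.Edge) (A : Finset G.Vert) : G.cut H Aᶜ = G.cut H A := by
  ext e; simp only [mem_cut, Finset.mem_compl]; tauto

theorem joins_comm {e : G.Edge} {u v : G.Vert} : G.Joins e u v ↔ G.Joins e v u := by
  simp only [Joins]; tauto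

theorem joins_ends (e : G.Edge) : G.Joins e (G.ends e).1 (G.ends e).2 := Or.inl rfl

theorem Joins.mem_cut {e : G.Edge} {u v : G.Vert} (h : G.Joins e u v) {H : Finset G.Edge}
    {A : Finset G.Vert} : e ∈ G.cut H A ↔ e ∈ H ∧ ¬(u ∈ A ↔ v ∈ A) := by
  rw [CostGraph.mem_cut]
  rcases h with h | h <;> rw [h]
  tauto

/-- An edge of a cut, seen from the inner side. -/
theorem exists_joins_of_mem_cut {H : Finset G.Edge} {A : Finset G.Vert} {e : G.Edge}
    (h : e ∈ G.cut H A) : ∃ u ∈ A, ∃ v ∉ A, G.Joins e u v := by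
  rw [mem_cut] at h
  by_cases h1 : (G.ends e).1 ∈ A
  · exact ⟨_, h1, _, by tauto, joins_ends e⟩
  · exact ⟨(G.ends e).2, by tauto, _, h1, joins_comm.1 (joins_ends e)⟩

theorem comp_closed {H : Finset G.Edge} {s : G.Vert} : G.cut H (G.comp H s) = ∅ := by
  by_contra hne
  obtain ⟨e, he⟩ := Finset.nonempty_iff_ne_empty.2 hne
  obtain ⟨u, hu, v, hv, h⟩ := exists_joins_of_mem_cut he
  rw [mem_comp] at hu hv
  exact hv (hu.tail ⟨e, (mem_cut.1 he).1, h⟩)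

theorem Reach.mem_of_cut_eq_empty {H : Finset G.Edge} {s t : G.Vert} (h : G.Reach H s t)
    {C : Finset G.Vert} (hC : G.cut H C = ∅) (hs : s ∈ C) : t ∈ C := by
  induction h with
  | refl => exact hs
  | tail _ h ih =>
    obtain ⟨e, he, hj⟩ := h
    by_contra hn
    have : e ∈ G.cut H C := hj.mem_cut.2 ⟨he, by tauto⟩
    simp [hC] at this

/-- The witness is the component of `s`. -/
theorem not_reach_iff {H : Finset G.Edge} {s t : G.Vert} :
    ¬G.Reach H s t ↔ ∃ C, s ∈ C ∧ t ∉ C ∧ G.cut H C = ∅ := by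
  constructor
  · intro h
    exact ⟨G.comp H s, mem_comp.2 .refl, fun h' => h (mem_comp.1 h'), comp_closed⟩
  · rintro ⟨C, hs, ht, hC⟩ h
    exact ht (h.mem_of_cut_eq_empty hC hs)

theorem cut_sdiff (H F : Finset G.Edge) (C : Finset G.Vert) :
    G.cut (H \ F) C = ∅ ↔ G.cut H C ⊆ F := by
  simp only [Finset.eq_empty_iff_forall_notMem, Finset.subset_iff, mem_cut, Finset.mem_sdiff]
  exact forall_congr' fun e => by tauto

/-- Feasibility for a single relative demand, in terms of cuts. -/
theorem relFeasible_iff {H : Finset G.Edge} {s t : G.Vert} :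
    G.RelFeasible [(s, t, 3)] H ↔ ∀ C, s ∈ C → t ∉ C → (G.cut H C).card ≤ 2 →
      ∃ Z, s ∈ Z ∧ t ∉ Z ∧ G.cut Finset.univ Z ⊆ G.cut H C := by
  simp only [RelFeasible, List.mem_singleton, forall_eq]
  constructor
  · intro h C hs ht hC
    -- Delete the small cut itself: this separates `s` from `t` in `H`, hence also in the whole
    -- graph.
    have h1 := mt (h (G.cut H C) (by omega)) (not_reach_iff.2 ⟨C, hs, ht, by rw [cut_sdiff]⟩)
    obtain ⟨Z, hs, ht, hZ⟩ := not_reach_iff.1 h1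
    exact ⟨Z, hs, ht, (cut_sdiff _ _ _).1 hZ⟩
  · intro h F hF
    contrapose
    rw [not_reach_iff, not_reach_iff]
    rintro ⟨C, hs, ht, hC⟩
    rw [cut_sdiff] at hC
    obtain ⟨Z, hs, ht, hZ⟩ := h C hs ht (by have := Finset.card_le_card hC; omega)
    exact ⟨Z, hs, ht, (cut_sdiff _ _ _).2 (hZ.trans hC)⟩

theorem relFeasible_univ (s t : G.Vert) (k : ℕ) : G.RelFeasible [(s, t, k)] Finset.univ :=
  fun _ _ _ _ h => by simp_all

theorem edgeConnectedSubset_iff {H : Finset G.Edge} {k : ℕ} {R : Finset G.Vert} :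
    G.EdgeConnectedSubset H k R ↔ ∀ C, ∀ u ∈ R, ∀ v ∈ R, u ∈ C → v ∉ C → k ≤ (G.cut H C).card := by
  simp only [EdgeConnectedSubset, minCut, le_iInf_iff, Nat.cast_le]
  constructor
  · intro h C u hu v hv hC hC'; exact h u hu v hv C ⟨hC, hC'⟩
  · intro h u hu v hv C hC; exact h C u hu v hv hC.1 hC.2

/-- Indicator of the edges that cross `A`. -/
def cr (G : CostGraph) (A : Finset G.Vert) (e : G.Edge) : ℕ :=
  if ((G.ends e).1 ∈ A ↔ (G.ends e).2 ∈ A) then 0 else 1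

theorem card_cut (H : Finset G.Edge) (A : Finset G.Vert) :
    (G.cut H A).card = ∑ e ∈ H, G.cr A e := by
  rw [cut, Finset.card_filter]
  exact Finset.sum_congr rfl fun e _ => by simp only [cr]; split_ifs <;> simp_all

/-! ### The single-demand problem between two vertices of degree two -/

section Terminals

variable {s t : G.Vert} {R : Finset G.Vert}

/-- Splitting off a vertex of degree two from the side that contains it. -/
theorem card_cut_erase_le {H : Finset G.Edge} {X : Finset G.Vert} {a v : G.Vert} {e : G.Edge}
    (ha : a ∈ X) (hv : v ∉ X) (he : e ∈ H) (hj : G.Joins e a v)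
    (hd : (G.cut H {a}).card ≤ 2) : (G.cut H (X.erase a)).card ≤ (G.cut H X).card := by
  let q : G.Edge → ℕ := fun e =>
    if ((G.ends e).1 = a ∧ (G.ends e).2 ∉ X) ∨ ((G.ends e).2 = a ∧ (G.ends e).1 ∉ X) then 1 else 0
  -- Edge by edge, this is `d(X - a) = d(X) + d(a) - 2 d(a, Xᶜ)`, with `q` counting the edges from
  -- `a` to the outside of `X`. There is at least one of those, and `d(a) ≤ 2`.
  have h1 : ∀ f, G.cr (X.erase a) f + 2 * q f = G.cr X f + G.cr {a} f := by
    intro f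
    simp only [cr, q, Finset.mem_erase, Finset.mem_singleton]
    by_cases h1 : (G.ends f).1 = a <;> by_cases h2 : (G.ends f).2 = a <;>
      by_cases h3 : (G.ends f).1 ∈ X <;> by_cases h4 : (G.ends f).2 ∈ X <;>
      simp [h1, h2, h3, h4] <;> simp_all
  have h2 : ∑ f ∈ H, q f ≥ 1 := by
    have : q e = 1 := by
      simp only [q]
      rcases hj with hj | hj <;> simp [hj, hv]
    calc 1 = q e := this.symm
      _ ≤ _ := Finset.single_le_sum (f := q) (fun _ _ => Nat.zero_le _) he
  have h3 : ∑ f ∈ H, (G.cr (X.erase a) f + 2 * q f) = ∑ f ∈ H, (G.cr X f + G.cr {a} f) :=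
    Finset.sum_congr rfl fun f _ => h1 f
  rw [Finset.sum_add_distrib, Finset.sum_add_distrib, ← Finset.mul_sum] at h3
  rw [card_cut] at hd
  rw [card_cut, card_cut]
  omega

/-- `s` and `t` have degree two and `R` is the set of their neighbours. -/
structure Terminals (G : CostGraph) (s t : G.Vert) (R : Finset G.Vert) : Prop where
  ne : s ≠ t
  deg_s : (G.cut Finset.univ {s}).card = 2
  deg_t : (G.cut Finset.univ {t}).card = 2
  mem_iff : ∀ v, v ∈ R ↔ (v ≠ s ∧ ∃ e, G.Joins e s v) ∨ (v ≠ t ∧ ∃ e, G.Joins e t v)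

theorem Terminals.symm (h : Terminals G s t R) : Terminals G t s R :=
  ⟨h.ne.symm, h.deg_t, h.deg_s, fun v => by rw [h.mem_iff]; tauto⟩

/-- A terminal `s` would be a neighbour of `t`, which makes `t` a terminal too; but the two edges at
`s` separate them. -/
theorem Terminals.notMem (h : Terminals G s t R) (hR : G.EdgeConnectedSubset Finset.univ 3 R) :
    s ∉ R := by
  intro hs
  rw [edgeConnectedSubset_iff] at hR
  have h1 := hR {s} s hs
  have : t ∈ R := by
    obtain ⟨hn, e, he⟩ : s ≠ t ∧ ∃ e, G.Joins e t s := by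
      have := (h.mem_iff s).1 hs; tauto
    exact (h.mem_iff t).2 (Or.inl ⟨h.ne.symm, e, joins_comm.1 he⟩)
  have := h1 t this (by simp) (by simp [h.ne.symm])
  rw [h.deg_s] at this
  omega

/-- A cut with all the neighbours of `s` outside contains the edges at `s`. -/
theorem Terminals.cut_subset (h : Terminals G s t R) {H : Finset G.Edge} {C : Finset G.Vert}
    (hs : s ∈ C) (hH : G.cut Finset.univ {s} ⊆ H) (hR : ∀ v ∈ R, v ∉ C) :
    G.cut Finset.univ {s} ⊆ G.cut H C := by
  intro e he
  obtain ⟨u, hu, v, hv, hj⟩ := exists_joins_of_mem_cut he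
  simp only [Finset.mem_singleton] at hu hv
  subst hu
  have := hR v ((h.mem_iff v).2 (Or.inl ⟨hv, e, hj⟩))
  exact hj.mem_cut.2 ⟨hH he, by tauto⟩

/-- A small cut that does not split `R` contains the edges at `s` or those at `t`. -/
theorem Terminals.cut_subset_or (h : Terminals G s t R) {H : Finset G.Edge}
    (hR : G.EdgeConnectedSubset H 3 R) {H' : Finset G.Edge} (hH : H ⊆ H') {C : Finset G.Vert}
    (hs : s ∈ C) (ht : t ∉ C) (hC : (G.cut H' C).card ≤ 2)
    (hFs : G.cut Finset.univ {s} ⊆ H') (hFt : G.cut Finset.univ {t} ⊆ H') :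
    G.cut Finset.univ {s} ⊆ G.cut H' C ∨ G.cut Finset.univ {t} ⊆ G.cut H' C := by
  by_cases h1 : ∀ v ∈ R, v ∉ C
  · exact Or.inl (h.cut_subset hs hFs h1)
  · push Not at h1
    obtain ⟨u, hu, huC⟩ := h1
    right
    rw [← cut_compl H' C]
    refine h.symm.cut_subset (by simpa using ht) hFt fun v hv hvC => ?_
    have := edgeConnectedSubset_iff.1 hR C u hu v hv huC (by simpa using hvC)
    have := Finset.card_le_card (cut_mono (G := G) hH C)
    omega

/-- A small `st`-cut of `H'` contains all edges at `s` or all edges at `t`, and either set is a full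
`st`-cut of the graph. -/
theorem Terminals.relFeasible (h : Terminals G s t R) {H H' : Finset G.Edge}
    (hR : G.EdgeConnectedSubset H 3 R) (hH : H ⊆ H')
    (hFs : G.cut Finset.univ {s} ⊆ H') (hFt : G.cut Finset.univ {t} ⊆ H') :
    G.RelFeasible [(s, t, 3)] H' := by
  rw [relFeasible_iff]
  intro C hs ht hC
  rcases h.cut_subset_or hR hH hs ht hC hFs hFt with h1 | h1
  · exact ⟨{s}, by simp, by simp [h.ne.symm], h1⟩
  · exact ⟨{t}ᶜ, by simp [h.ne], by simp, by rwa [cut_compl]⟩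

theorem cut_univ_subset {C : Finset G.Vert} {H : Finset G.Edge} (h : G.cut Finset.univ C ⊆ H) :
    G.cut Finset.univ C ⊆ G.cut H C := fun _ he =>
  mem_cut.2 ⟨h he, (mem_cut.1 he).2⟩

/-- If an `st`-cut of the graph with two edges were not wholly in `H`, at most one edge of it would
remain in `H`. That edge would have to contain a full `st`-cut, but full `st`-cuts of size at most
two contain the two edges at `s` or at `t`. -/
theorem Terminals.forced_subset (h : Terminals G s t R)
    (hR : G.EdgeConnectedSubset Finset.univ 3 R) {H : Finset G.Edge}
    (hH : G.RelFeasible [(s, t, 3)] H) :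
    G.cut Finset.univ {s} ⊆ H ∧ G.cut Finset.univ {t} ⊆ H := by
  rw [relFeasible_iff] at hH
  have key : ∀ C, s ∈ C → t ∉ C → (G.cut Finset.univ C).card = 2 → G.cut Finset.univ C ⊆ H := by
    intro C hs ht hC
    by_contra hn
    have h1 : (G.cut H C).card < 2 := by
      rw [← hC]
      refine Finset.card_lt_card ((cut_mono (Finset.subset_univ _) C).ssubset_of_ne fun h' => hn ?_)
      rw [← h']; exact Finset.filter_subset _ _
    obtain ⟨Z, hs, ht, hZ⟩ := hH C hs ht (by omega)
    have h2 := Finset.card_le_card hZ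
    rcases h.cut_subset_or hR (subset_refl _) hs ht (by omega) (Finset.subset_univ _)
      (Finset.subset_univ _) with h3 | h3
    · have := Finset.card_le_card h3; rw [h.deg_s] at this; omega
    · have := Finset.card_le_card h3; rw [h.deg_t] at this; omega
  exact ⟨key {s} (by simp) (by simp [h.ne.symm]) h.deg_s, by
    rw [← cut_compl]
    exact key {t}ᶜ (by simp [h.ne]) (by simp) (by rw [cut_compl]; exact h.deg_t)⟩

/-- A cut of `H` with at most two edges that separates `s` from `t` must consist of the edges at `s`
or those at `t`, and such a cut leaves all of `R` on one side. Cuts with `s` and `t` on the same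
side reduce to this case by moving one of them across. -/
theorem Terminals.edgeConnectedSubset (h : Terminals G s t R)
    (hR : G.EdgeConnectedSubset Finset.univ 3 R) {H : Finset G.Edge}
    (hH : G.RelFeasible [(s, t, 3)] H) : G.EdgeConnectedSubset H 3 R := by
  obtain ⟨hFs, hFt⟩ := h.forced_subset hR hH
  have hsR := h.notMem hR
  have htR := h.symm.notMem hR
  rw [relFeasible_iff] at hH
  have nbr : ∀ v ∈ R, (∃ e ∈ H, G.Joins e s v) ∨ (∃ e ∈ H, G.Joins e t v) := by
    intro v hv
    rcases (h.mem_iff v).1 hv with ⟨hne, e, he⟩ | ⟨hne, e, he⟩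
    · exact Or.inl ⟨e, hFs (he.mem_cut.2 (by simp [hne])), he⟩
    · exact Or.inr ⟨e, hFt (he.mem_cut.2 (by simp [hne])), he⟩
  have hst : ∀ e, ¬G.Joins e s t := fun e he =>
    htR ((h.mem_iff t).2 (Or.inl ⟨h.ne.symm, e, he⟩))
  -- an `st`-cut that splits `R` is large
  have key : ∀ X, s ∈ X → t ∉ X → (∃ u ∈ R, u ∈ X) → (∃ v ∈ R, v ∉ X) →
      2 < (G.cut H X).card := by
    rintro X hs ht ⟨u, hu, huX⟩ ⟨v, hv, hvX⟩
    by_contra! hX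
    obtain ⟨Z, hsZ, htZ, hZ⟩ := hH X hs ht hX
    have hZc := Finset.card_le_card hZ
    -- The cut `X` has at most two edges and contains two edges at `a`, so there is nothing else in
    -- it.
    have hside : ∀ a, (G.cut Finset.univ {a}).card = 2 → G.cut Finset.univ {a} ⊆ G.cut H X →
        G.cut H X = G.cut Finset.univ {a} := fun a ha hs =>
      (Finset.eq_of_subset_of_card_le hs (by omega)).symm
    rcases h.cut_subset_or hR (subset_refl _) hsZ htZ (by omega) (Finset.subset_univ _)
      (Finset.subset_univ _) with h1 | h1
    · have h2 := hside s h.deg_s (h1.trans hZ)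
      -- `u` is a neighbour of `t` or `s`
      rcases nbr u hu with ⟨e, he, hj⟩ | ⟨e, he, hj⟩
      · have : e ∈ G.cut H X := by
          rw [h2]; refine hj.mem_cut.2 ⟨Finset.mem_univ _, ?_⟩
          have : u ≠ s := fun h => hsR (h ▸ hu)
          simp [this]
        have := (hj.mem_cut.1 this).2
        tauto
      · have : e ∈ G.cut H X := hj.mem_cut.2 ⟨he, by tauto⟩
        rw [h2] at this
        have h3 := (hj.mem_cut.1 this).2
        have : u ≠ s := fun h => hsR (h ▸ hu)
        simp [this, h.ne.symm] at h3
    · have h2 := hside t h.deg_t (h1.trans hZ)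
      rcases nbr v hv with ⟨e, he, hj⟩ | ⟨e, he, hj⟩
      · have : e ∈ G.cut H X := hj.mem_cut.2 ⟨he, by tauto⟩
        rw [h2] at this
        have h3 := (hj.mem_cut.1 this).2
        have : v ≠ t := fun h => htR (h ▸ hv)
        simp [this, h.ne] at h3
      · have : e ∈ G.cut H X := by
          rw [h2]; refine hj.mem_cut.2 ⟨Finset.mem_univ _, ?_⟩
          have : v ≠ t := fun h => htR (h ▸ hv)
          simp [this]
        have := (hj.mem_cut.1 this).2
        tauto
  -- cuts with both `s` and `t` on one side
  have key2 : ∀ X, s ∈ X → t ∈ X → (∃ u ∈ R, u ∈ X) → (∃ v ∈ R, v ∉ X) →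
      2 < (G.cut H X).card := by
    rintro X hs ht ⟨u, hu, huX⟩ ⟨v, hv, hvX⟩
    have hdeg : ∀ a, (G.cut Finset.univ {a}).card = 2 → (G.cut H {a}).card ≤ 2 := fun a ha =>
      (Finset.card_le_card (cut_mono (Finset.subset_univ _) _)).trans ha.le
    have hus : u ≠ s := fun h => hsR (h ▸ hu)
    have hut : u ≠ t := fun h => htR (h ▸ hu)
    -- The outer terminal `v` is adjacent to `s` or `t`. Moving that vertex to its side does not
    -- enlarge the cut, as its degree is two, and then `s` and `t` are separated.
    rcases nbr v hv with ⟨e, he, hj⟩ | ⟨e, he, hj⟩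
    · refine lt_of_lt_of_le ?_ (card_cut_erase_le hs hvX he hj (hdeg s h.deg_s))
      rw [← cut_compl]
      exact key _ (by simp) (by simp [h.ne.symm, ht]) ⟨v, hv, by simp [hvX]⟩
        ⟨u, hu, by simp [huX, hus]⟩
    · refine lt_of_lt_of_le ?_ (card_cut_erase_le ht hvX he hj (hdeg t h.deg_t))
      exact key _ (by simp [h.ne, hs]) (by simp) ⟨u, hu, by simp [huX, hut]⟩
        ⟨v, hv, by simp [hvX]⟩
  rw [edgeConnectedSubset_iff]
  intro X u hu v hv huX hvX
  by_cases hs : s ∈ X <;> by_cases ht : t ∈ X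
  · exact key2 X hs ht ⟨u, hu, huX⟩ ⟨v, hv, hvX⟩
  · exact key X hs ht ⟨u, hu, huX⟩ ⟨v, hv, hvX⟩
  · have := key Xᶜ (by simp [hs]) (by simp [ht]) ⟨v, hv, by simp [hvX]⟩ ⟨u, hu, by simp [huX]⟩
    rwa [cut_compl] at this
  · have := key2 Xᶜ (by simp [hs]) (by simp [ht]) ⟨v, hv, by simp [hvX]⟩ ⟨u, hu, by simp [huX]⟩
    rwa [cut_compl] at this

end Terminals

end CostGraph

namespace CostGraph

variable {G : CostGraph}

/-! ### Weighted cuts -/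

open scoped Classical in
/-- The weight of an edge: `2` for the edges whose removal separates `s` from `t`. -/
noncomputable def wt (G : CostGraph) (s t : G.Vert) (e : G.Edge) : ℕ :=
  if G.Reach (Finset.univ \ {e}) s t then 1 else 2

/-- The weighted cut function, with two virtual edges each into `s` and out of `t`. -/
noncomputable def phi (G : CostGraph) (s t : G.Vert) (H : Finset G.Edge) (C : Finset G.Vert) : ℕ :=
  (if s ∈ C then 0 else 2) + (if t ∈ C then 2 else 0) + ∑ e ∈ H, G.wt s t e * G.cr C e

variable {s t : G.Vert}

theorem one_le_wt (e : G.Edge) : 1 ≤ G.wt s t e := by unfold wt; split_ifs <;> omega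

theorem wt_le_two (e : G.Edge) : G.wt s t e ≤ 2 := by unfold wt; split_ifs <;> omega

theorem sum_wt_cr (H : Finset G.Edge) (C : Finset G.Vert) :
    ∑ e ∈ H, G.wt s t e * G.cr C e = ∑ e ∈ G.cut H C, G.wt s t e := by
  rw [cut, Finset.sum_filter]
  exact Finset.sum_congr rfl fun e _ => by simp only [cr]; split_ifs <;> simp_all

theorem card_cut_le_sum (H : Finset G.Edge) (C : Finset G.Vert) :
    (G.cut H C).card ≤ ∑ e ∈ H, G.wt s t e * G.cr C e := by
  rw [sum_wt_cr, Finset.card_eq_sum_ones]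
  exact Finset.sum_le_sum fun e _ => one_le_wt e

theorem exists_mem_cut_of_reach {H : Finset G.Edge} (h : G.Reach H s t) {C : Finset G.Vert}
    (hs : s ∈ C) (ht : t ∉ C) : ∃ e ∈ H, e ∈ G.cut Finset.univ C := by
  by_contra! hn
  refine ht (h.mem_of_cut_eq_empty (Finset.eq_empty_iff_forall_notMem.2 fun e he => ?_) hs)
  exact hn e (mem_cut.1 he).1 (cut_mono (Finset.subset_univ _) _ he)

/-- Every `st`-cut has weight at least two. -/
theorem two_le_sum_wt (hr : G.Reach Finset.univ s t) {C : Finset G.Vert} (hs : s ∈ C)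
    (ht : t ∉ C) : 2 ≤ ∑ e ∈ G.cut Finset.univ C, G.wt s t e := by
  obtain ⟨e, -, he⟩ := exists_mem_cut_of_reach hr hs ht
  by_cases hb : G.Reach (Finset.univ \ {e}) s t
  · obtain ⟨f, hf, hfC⟩ := exists_mem_cut_of_reach hb hs ht
    have hne : f ≠ e := by simpa using hf
    calc 2 ≤ G.wt s t e + G.wt s t f := by
          have := one_le_wt (s := s) (t := t) e
          have := one_le_wt (s := s) (t := t) f
          omega
      _ = ∑ x ∈ {e, f}, G.wt s t x := (Finset.sum_pair hne.symm).symm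
      _ ≤ _ := Finset.sum_le_sum_of_subset (by
        intro x hx; rw [Finset.mem_insert, Finset.mem_singleton] at hx
        rcases hx with rfl | rfl <;> assumption)
  · calc 2 = G.wt s t e := by rw [wt, if_neg hb]
      _ ≤ _ := Finset.single_le_sum (f := fun e => G.wt s t e) (fun _ _ => Nat.zero_le _) he

/-- If `C` is not an `st`-set, the two virtual edges at `s` or at `t` cross it; otherwise one edge
of weight two or two edges do. -/
theorem two_le_phi (hr : G.Reach Finset.univ s t) (C : Finset G.Vert) :
    2 ≤ G.phi s t Finset.univ C := by
  unfold phi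
  by_cases hs : s ∈ C <;> by_cases ht : t ∈ C <;> simp only [hs, ht, if_true, if_false]
  · omega
  · have := two_le_sum_wt hr hs ht
    rw [sum_wt_cr]; omega
  · omega
  · omega

theorem cr_submodular (C D : Finset G.Vert) (e : G.Edge) :
    G.cr (C ∩ D) e + G.cr (C ∪ D) e ≤ G.cr C e + G.cr D e := by
  simp only [cr, Finset.mem_inter, Finset.mem_union]
  by_cases h1 : (G.ends e).1 ∈ C <;> by_cases h2 : (G.ends e).2 ∈ C <;>
    by_cases h3 : (G.ends e).1 ∈ D <;> by_cases h4 : (G.ends e).2 ∈ D <;> simp [h1, h2, h3, h4]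

theorem phi_submodular (H : Finset G.Edge) (C D : Finset G.Vert) :
    G.phi s t H (C ∩ D) + G.phi s t H (C ∪ D) ≤ G.phi s t H C + G.phi s t H D := by
  have h1 : ∑ e ∈ H, G.wt s t e * G.cr (C ∩ D) e + ∑ e ∈ H, G.wt s t e * G.cr (C ∪ D) e ≤
      ∑ e ∈ H, G.wt s t e * G.cr C e + ∑ e ∈ H, G.wt s t e * G.cr D e := by
    rw [← Finset.sum_add_distrib, ← Finset.sum_add_distrib]
    refine Finset.sum_le_sum fun e _ => ?_
    rw [← mul_add, ← mul_add]
    exact Nat.mul_le_mul_left _ (cr_submodular C D e)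
  have h2 : (if s ∈ C ∩ D then 0 else 2) + (if s ∈ C ∪ D then 0 else 2) =
      (if s ∈ C then 0 else 2) + (if s ∈ D then 0 else 2) := by
    by_cases h1 : s ∈ C <;> by_cases h2 : s ∈ D <;> simp [h1, h2]
  have h3 : (if t ∈ C ∩ D then 2 else 0) + (if t ∈ C ∪ D then 2 else 0) =
      (if t ∈ C then 2 else 0) + (if t ∈ D then 2 else 0) := by
    by_cases h1 : t ∈ C <;> by_cases h2 : t ∈ D <;> simp [h1, h2]
  unfold phi
  omega

/-- The sets whose weighted cut is minimum. -/
structure Tight (G : CostGraph) (s t : G.Vert) (C : Finset G.Vert) : Prop where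
  subset : C ⊆ G.comp Finset.univ s
  eq_two : G.phi s t Finset.univ C = 2

theorem self_mem_comp (H : Finset G.Edge) (s : G.Vert) : s ∈ G.comp H s := mem_comp.2 .refl

/-- The virtual edges make both extremes tight, `∅` here and the component of `s` in `tight_comp`.
The first and last layers then need no separate treatment. -/
theorem tight_empty : G.Tight s t ∅ := ⟨Finset.empty_subset _, by simp [phi, cr]⟩

theorem tight_comp (hr : G.Reach Finset.univ s t) : G.Tight s t (G.comp Finset.univ s) :=
  ⟨subset_rfl, by
    unfold phi
    rw [sum_wt_cr, comp_closed, if_pos (self_mem_comp _ _), if_pos (mem_comp.2 hr)]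
    rfl⟩

/-- Minimizers of a submodular function form a lattice. -/
theorem Tight.inter (hr : G.Reach Finset.univ s t) {C D : Finset G.Vert} (hC : G.Tight s t C)
    (hD : G.Tight s t D) : G.Tight s t (C ∩ D) := by
  refine ⟨Finset.inter_subset_left.trans hC.subset, ?_⟩
  have h1 := phi_submodular (s := s) (t := t) Finset.univ C D
  have h2 := two_le_phi hr (C ∩ D)
  have h3 := two_le_phi hr (C ∪ D)
  rw [hC.eq_two, hD.eq_two] at h1
  omega

theorem Tight.union (hr : G.Reach Finset.univ s t) {C D : Finset G.Vert} (hC : G.Tight s t C)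
    (hD : G.Tight s t D) : G.Tight s t (C ∪ D) := by
  refine ⟨Finset.union_subset hC.subset hD.subset, ?_⟩
  have h1 := phi_submodular (s := s) (t := t) Finset.univ C D
  have h2 := two_le_phi hr (C ∩ D)
  have h3 := two_le_phi hr (C ∪ D)
  rw [hC.eq_two, hD.eq_two] at h1
  omega

/-- The component of `s` is connected. -/
theorem exists_mem_cut {Y : Finset G.Vert} {u v : G.Vert} (hu : u ∈ G.comp Finset.univ s)
    (huY : u ∈ Y) (hv : v ∈ G.comp Finset.univ s) (hvY : v ∉ Y) :
    ∃ e, e ∈ G.cut Finset.univ Y := by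
  rw [mem_comp] at hu hv
  by_cases hs : s ∈ Y
  · obtain ⟨e, -, he⟩ := exists_mem_cut_of_reach hv hs hvY
    exact ⟨e, he⟩
  · obtain ⟨e, -, he⟩ := exists_mem_cut_of_reach hu (C := Yᶜ) (by simpa using hs) (by simpa using huY)
    exact ⟨e, by rwa [cut_compl] at he⟩

theorem one_le_sum_of_mem_cut {C : Finset G.Vert} {e : G.Edge} (h : e ∈ G.cut Finset.univ C) :
    1 ≤ ∑ e, G.wt s t e * G.cr C e := by
  rw [sum_wt_cr]
  exact (one_le_wt e).trans
    (Finset.single_le_sum (f := fun e => G.wt s t e) (fun _ _ => Nat.zero_le _) h)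

/-- Without `s` inside, the virtual edges already account for weight 2, yet a nonempty part of the
component that misses `s` is left by at least one more edge. -/
theorem Tight.s_mem {A : Finset G.Vert} (hA : G.Tight s t A) {u : G.Vert} (hu : u ∈ A) :
    s ∈ A := by
  by_contra hs
  obtain ⟨e, he⟩ := exists_mem_cut (hA.subset hu) hu (self_mem_comp _ s) hs
  have h1 := one_le_sum_of_mem_cut (s := s) (t := t) he
  have h2 := hA.eq_two
  unfold phi at h2
  rw [if_neg hs] at h2
  omega

theorem Tight.t_notMem (hr : G.Reach Finset.univ s t) {A : Finset G.Vert} (hA : G.Tight s t A)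
    {u : G.Vert} (hu : u ∈ G.comp Finset.univ s) (huA : u ∉ A) : t ∉ A := by
  intro ht
  obtain ⟨e, he⟩ := exists_mem_cut (mem_comp.2 hr) ht hu huA
  have h1 := one_le_sum_of_mem_cut (s := s) (t := t) he
  have h2 := hA.eq_two
  unfold phi at h2
  rw [if_pos ht] at h2
  omega

theorem mem_comp_of_joins {H : Finset G.Edge} {e : G.Edge} {u v : G.Vert} (h : G.Joins e u v)
    (he : e ∈ H) (hu : u ∈ G.comp H s) : v ∈ G.comp H s := by
  rw [mem_comp] at hu ⊢
  exact hu.tail ⟨e, he, h⟩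

theorem cut_inter_comp_subset (Z : Finset G.Vert) :
    G.cut Finset.univ (Z ∩ G.comp Finset.univ s) ⊆ G.cut Finset.univ Z := by
  intro f hf
  obtain ⟨u, hu, v, hv, hj⟩ := exists_joins_of_mem_cut hf
  rw [Finset.mem_inter] at hu hv
  have h1 := mem_comp_of_joins hj (Finset.mem_univ _) hu.2
  exact hj.mem_cut.2 ⟨Finset.mem_univ _, fun h2 => hv ⟨h2.1 hu.1, h1⟩⟩

/-- Tight sets are connected. -/
theorem Tight.exists_inside (hr : G.Reach Finset.univ s t) {A Z : Finset G.Vert}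
    (hA : G.Tight s t A) (hs : s ∈ Z) {u : G.Vert} (hu : u ∈ A) (huZ : u ∉ Z) :
    ∃ e ∈ G.cut Finset.univ Z, (G.ends e).1 ∈ A ∧ (G.ends e).2 ∈ A := by
  by_contra! hn
  have hsA := hA.s_mem hu
  -- With no edge between the two parts of `A` the cut splits. The part `A \ Z`, which misses `s`,
  -- takes away positive weight, so `phi` of `A ∩ Z` would drop below 2.
  have h1 : ∀ e, G.cr A e = G.cr (A ∩ Z) e + G.cr (A \ Z) e := by
    intro e
    have := hn e
    simp only [mem_cut, Finset.mem_univ, true_and] at this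
    simp only [cr, Finset.mem_inter, Finset.mem_sdiff]
    by_cases h1 : (G.ends e).1 ∈ A <;> by_cases h2 : (G.ends e).2 ∈ A <;>
      by_cases h3 : (G.ends e).1 ∈ Z <;> by_cases h4 : (G.ends e).2 ∈ Z <;>
      simp_all
  have h2 : ∑ e, G.wt s t e * G.cr A e = ∑ e, G.wt s t e * G.cr (A ∩ Z) e +
      ∑ e, G.wt s t e * G.cr (A \ Z) e := by
    rw [← Finset.sum_add_distrib]
    exact Finset.sum_congr rfl fun e _ => by rw [h1, mul_add]
  obtain ⟨e, he⟩ := exists_mem_cut (Y := A \ Z) (s := s) (hA.subset hu) (by simp [hu, huZ])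
    (self_mem_comp _ s) (by simp [hs])
  have h3 := one_le_sum_of_mem_cut (s := s) (t := t) he
  have h4 := hA.eq_two
  have h5 := two_le_phi hr (A ∩ Z)
  unfold phi at h4 h5
  rw [if_pos hsA] at h4
  rw [if_pos (by simp [hsA, hs] : s ∈ A ∩ Z)] at h5
  have h6 : (if t ∈ A ∩ Z then 2 else 0) ≤ (if t ∈ A then 2 else 0) := by
    by_cases h : t ∈ A <;> by_cases h' : t ∈ Z <;> simp [h, h']
  omega

/-- The complement of a tight set is connected. -/
theorem Tight.exists_outside (hr : G.Reach Finset.univ s t) {A Z : Finset G.Vert}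
    (hA : G.Tight s t A) (ht : t ∉ Z) {u : G.Vert} (hu : u ∈ G.comp Finset.univ s) (huA : u ∉ A)
    (huZ : u ∈ Z) : ∃ e ∈ G.cut Finset.univ Z, (G.ends e).1 ∉ A ∧ (G.ends e).2 ∉ A := by
  by_contra! hn
  have htA := hA.t_notMem hr hu huA
  -- Dual to the inner case: adding to `A` the part `Z \ A`, which misses `t`, would bring `phi`
  -- below 2.
  have h1 : ∀ e, G.cr A e = G.cr (A ∪ Z) e + G.cr (Z \ A) e := by
    intro e
    have := hn e
    simp only [mem_cut, Finset.mem_univ, true_and] at this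
    simp only [cr, Finset.mem_union, Finset.mem_sdiff]
    by_cases h1 : (G.ends e).1 ∈ A <;> by_cases h2 : (G.ends e).2 ∈ A <;>
      by_cases h3 : (G.ends e).1 ∈ Z <;> by_cases h4 : (G.ends e).2 ∈ Z <;>
      simp_all
  have h2 : ∑ e, G.wt s t e * G.cr A e = ∑ e, G.wt s t e * G.cr (A ∪ Z) e +
      ∑ e, G.wt s t e * G.cr (Z \ A) e := by
    rw [← Finset.sum_add_distrib]
    exact Finset.sum_congr rfl fun e _ => by rw [h1, mul_add]
  obtain ⟨e, he⟩ := exists_mem_cut (Y := Z \ A) (s := s) hu (by simp [huA, huZ])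
    (mem_comp.2 hr) (by simp [ht])
  have h3 := one_le_sum_of_mem_cut (s := s) (t := t) he
  have h4 := hA.eq_two
  have h5 := two_le_phi hr (A ∪ Z)
  unfold phi at h4 h5
  rw [if_neg htA] at h4
  rw [if_neg (by simp [htA, ht] : t ∉ A ∪ Z)] at h5
  have h6 : (if s ∈ A ∪ Z then 0 else 2) ≤ (if s ∈ A then 0 else 2) := by
    by_cases h : s ∈ A <;> by_cases h' : s ∈ Z <;> simp [h, h']
  omega

/-! ### Pieces between consecutive tight sets -/

/-- Consecutive tight sets. -/
structure Piece (G : CostGraph) (s t : G.Vert) (A B : Finset G.Vert) : Prop where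
  reach : G.Reach Finset.univ s t
  tightA : G.Tight s t A
  tightB : G.Tight s t B
  ssubset : A ⊂ B
  eq_or_eq : ∀ T, G.Tight s t T → A ⊆ T → T ⊆ B → T = A ∨ T = B

/-- The ends in `D` of an edge between `A` and `D`. -/
def endsIn (G : CostGraph) (A D : Finset G.Vert) (e : G.Edge) : List G.Vert :=
  (if (G.ends e).1 ∈ A ∧ (G.ends e).2 ∈ D then [(G.ends e).2] else []) ++
    (if (G.ends e).2 ∈ A ∧ (G.ends e).1 ∈ D then [(G.ends e).1] else [])

/-- The ends in `D` of the edges between `A` and `D`, and the vertex `x` if it is in `D`. -/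
def ports (G : CostGraph) (A D : Finset G.Vert) (x : G.Vert) : List G.Vert :=
  (if x ∈ D then [x] else []) ++ (List.finRange G.m).flatMap (G.endsIn A D)

/-- The ports with the weights of their edges. -/
noncomputable def portsW (G : CostGraph) (s t : G.Vert) (A D : Finset G.Vert) (x : G.Vert) :
    List (ℕ × G.Vert) :=
  -- The weight 2 stands for the two virtual edges at `x`, which is `s` or `t`.
  (if x ∈ D then [(2, x)] else []) ++
    (List.finRange G.m).flatMap fun e => (G.endsIn A D e).map fun v => (G.wt s t e, v)

theorem map_snd_portsW (A D : Finset G.Vert) (x : G.Vert) :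
    (G.portsW s t A D x).map Prod.snd = G.ports A D x := by
  simp only [portsW, ports, List.map_append, List.map_flatMap, List.map_map]
  congr 1
  · split_ifs <;> rfl
  · congr 1; ext e : 1; simp [Function.comp_def]

/-- First port. -/
def port₁ (G : CostGraph) (A D : Finset G.Vert) (x : G.Vert) : G.Vert := (G.ports A D x).headD x

/-- Last port. -/
def port₂ (G : CostGraph) (A D : Finset G.Vert) (x : G.Vert) : G.Vert := (G.ports A D x).getLastD x

theorem mem_endsIn {A D : Finset G.Vert} {e : G.Edge} {v : G.Vert} :
    v ∈ G.endsIn A D e ↔ v ∈ D ∧ ∃ u ∈ A, G.Joins e u v := by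
  simp only [endsIn, List.mem_append]
  constructor
  · rintro (h | h) <;> split_ifs at h with h' <;> simp at h <;> subst h
    · exact ⟨h'.2, _, h'.1, joins_ends e⟩
    · exact ⟨h'.2, _, h'.1, joins_comm.1 (joins_ends e)⟩
  · rintro ⟨hv, u, hu, hj | hj⟩
    · left; simp [hj, hv, hu]
    · right; simp [hj, hv, hu]

theorem mem_ports {A D : Finset G.Vert} {x v : G.Vert} :
    v ∈ G.ports A D x ↔ v ∈ D ∧ (v = x ∨ ∃ e, ∃ u ∈ A, G.Joins e u v) := by
  simp only [ports, List.mem_append, List.mem_flatMap, List.mem_finRange, true_and, mem_endsIn]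
  constructor
  · rintro (h | ⟨e, hv, u, hu, hj⟩)
    · split_ifs at h with h' <;> simp at h
      subst h; exact ⟨h', Or.inl rfl⟩
    · exact ⟨hv, Or.inr ⟨e, u, hu, hj⟩⟩
  · rintro ⟨hv, rfl | ⟨e, u, hu, hj⟩⟩
    · left; simp [hv]
    · exact Or.inr ⟨e, hv, u, hu, hj⟩

theorem sum_filter_portsW (A D : Finset G.Vert) (x : G.Vert) (p : G.Vert → Prop)
    [DecidablePred p] :
    (((G.portsW s t A D x).filter fun y => p y.2).map Prod.fst).sum =
      (if x ∈ D ∧ p x then 2 else 0) + ∑ e, G.wt s t e *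
        ((if (G.ends e).1 ∈ A ∧ (G.ends e).2 ∈ D ∧ p (G.ends e).2 then 1 else 0) +
          (if (G.ends e).2 ∈ A ∧ (G.ends e).1 ∈ D ∧ p (G.ends e).1 then 1 else 0)) := by
  have h1 : ∀ (l : List G.Edge) (f : G.Edge → List (ℕ × G.Vert)),
      (((l.flatMap f).filter fun y => p y.2).map Prod.fst).sum =
        (l.map fun e => (((f e).filter fun y => p y.2).map Prod.fst).sum).sum := by
    intro l f
    induction l with
    | nil => rfl
    | cons a l ih => simp [List.filter_append, ih]
  rw [portsW, List.filter_append, List.map_append, List.sum_append, h1]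
  congr 1
  · by_cases h : x ∈ D <;> by_cases h' : p x <;> simp [h, h']
  · rw [← List.ofFn_eq_map, List.sum_ofFn]
    refine Finset.sum_congr rfl fun e _ => ?_
    simp only [endsIn]
    by_cases h1 : (G.ends e).1 ∈ A ∧ (G.ends e).2 ∈ D <;>
      by_cases h2 : (G.ends e).2 ∈ A ∧ (G.ends e).1 ∈ D <;>
      by_cases h3 : p (G.ends e).1 <;> by_cases h4 : p (G.ends e).2 <;>
      simp [h1, h2, h3, h4, mul_two]

/-- A total weight of 1 or 2 leaves one port, or two ports of weight 1. First and last entry of the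
list then describe it completely; a single port of weight 2 is both first and last and counts twice.
-/
theorem two_ports {V : Type} (L : List (ℕ × V)) (hL : ∀ y ∈ L, 1 ≤ y.1) (x : V)
    (hsum : (L.map Prod.fst).sum = 1 ∨ (L.map Prod.fst).sum = 2) :
    (L.map Prod.snd).headD x ∈ L.map Prod.snd ∧ (L.map Prod.snd).getLastD x ∈ L.map Prod.snd ∧
    (∀ v ∈ L.map Prod.snd, v = (L.map Prod.snd).headD x ∨ v = (L.map Prod.snd).getLastD x) ∧
    ((L.map Prod.fst).sum = 1 → (L.map Prod.snd).headD x = (L.map Prod.snd).getLastD x) ∧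
    ∀ (p : V → Prop) [DecidablePred p], ((L.filter fun y => p y.2).map Prod.fst).sum =
      (if p ((L.map Prod.snd).headD x) then 1 else 0) +
        if (L.map Prod.fst).sum = 2 ∧ p ((L.map Prod.snd).getLastD x) then 1 else 0 := by
  match L with
  | [] => simp at hsum
  | [y] =>
    simp only [List.map_cons, List.map_nil, List.sum_cons, List.sum_nil, add_zero] at hsum
    simp
    intro p _
    by_cases h : p y.2 <;> rcases hsum with h' | h' <;> simp [h, h']
  | [y, z] =>
    simp at hsum hL
    have hy : y.1 = 1 := by omega
    have hz : z.1 = 1 := by omega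
    simp [hy, hz]
    intro p _
    by_cases h : p y.2 <;> by_cases h' : p z.2 <;> simp [h, h', hy, hz]
  | y :: z :: w :: L =>
    simp at hsum hL
    omega

/-- Some edge joins `A` to the complement of `B`. -/
def Shared (G : CostGraph) (A B : Finset G.Vert) : Prop := ∃ e, ∃ u ∈ A, ∃ v ∉ B, G.Joins e u v

/-- Number of edges of `H` inside `D` that cross `Y`. -/
def inner (G : CostGraph) (H : Finset G.Edge) (D Y : Finset G.Vert) : ℕ :=
  ∑ e ∈ H, if (G.ends e).1 ∈ D ∧ (G.ends e).2 ∈ D then G.cr Y e else 0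

namespace Piece

variable {A B : Finset G.Vert}

theorem s_mem (h : G.Piece s t A B) : s ∈ B := by
  obtain ⟨u, hu, -⟩ := Finset.exists_of_ssubset h.ssubset
  exact h.tightB.s_mem hu

theorem t_notMem (h : G.Piece s t A B) : t ∉ A := by
  obtain ⟨u, hu, hu'⟩ := Finset.exists_of_ssubset h.ssubset
  exact h.tightA.t_notMem h.reach (h.tightB.subset hu) hu'

/-- An inner edge of weight 2 would alone be an `st`-cut. Its side, united with `A` and intersected
with `B`, would be tight and would separate two vertices of the layer, which consecutive tight sets
exclude. -/
theorem wt_inner (h : G.Piece s t A B) {e : G.Edge} (h1 : (G.ends e).1 ∈ B \ A)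
    (h2 : (G.ends e).2 ∈ B \ A) : G.wt s t e = 1 := by
  unfold wt
  refine if_pos ?_
  by_contra hn
  obtain ⟨C, hs, ht, hC⟩ := not_reach_iff.1 hn
  rw [cut_sdiff] at hC
  have hC' := (cut_inter_comp_subset (s := s) C).trans hC
  have hs' : s ∈ C ∩ G.comp Finset.univ s := by simp [hs, self_mem_comp]
  have ht' : t ∉ C ∩ G.comp Finset.univ s := by simp [ht]
  have hT : G.Tight s t (C ∩ G.comp Finset.univ s) := by
    refine ⟨Finset.inter_subset_right, le_antisymm ?_ (two_le_phi h.reach _)⟩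
    unfold phi
    rw [if_pos hs', if_neg ht', sum_wt_cr]
    refine le_trans (by simpa using Finset.sum_le_sum_of_subset hC') ((Finset.sum_singleton _ _).trans_le (wt_le_two e))
  have hcr : e ∈ G.cut Finset.univ (C ∩ G.comp Finset.univ s) := by
    obtain ⟨f, -, hf⟩ := exists_mem_cut_of_reach h.reach hs' ht'
    rwa [← Finset.mem_singleton.1 (hC' hf)]
  obtain ⟨u, hu, v, hv, hj⟩ := exists_joins_of_mem_cut hcr
  obtain ⟨hu', hv'⟩ : u ∈ B \ A ∧ v ∈ B \ A := by
    rcases hj with hj | hj <;> rw [hj] at h1 h2 <;> exact ⟨by assumption, by assumption⟩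
  rw [Finset.mem_sdiff] at hu' hv'
  rcases h.eq_or_eq _ ((hT.union h.reach h.tightA).inter h.reach h.tightB)
    (Finset.subset_inter Finset.subset_union_right h.ssubset.subset) Finset.inter_subset_right with h3 | h3
  · refine hu'.2 (h3 ▸ ?_)
    rw [Finset.mem_inter, Finset.mem_union]; exact ⟨Or.inl hu, hu'.1⟩
  · have := h3 ▸ hv'.1
    rw [Finset.mem_inter, Finset.mem_union] at this
    tauto

end Piece

end CostGraph

/-! ### The weighted cut of a set between two consecutive tight sets -/

namespace CostGraph

variable {G : CostGraph} {s t : G.Vert}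

/-- Total weight of the ports with property `p`. -/
noncomputable def portSum (G : CostGraph) (s t : G.Vert) (A D : Finset G.Vert) (x : G.Vert) (p : G.Vert → Prop)
    [DecidablePred p] : ℕ := (((G.portsW s t A D x).filter fun y => p y.2).map Prod.fst).sum

theorem portSum_eq (A D : Finset G.Vert) (x : G.Vert) (p : G.Vert → Prop) [DecidablePred p] :
    G.portSum s t A D x p =
      (if x ∈ D ∧ p x then 2 else 0) + ∑ e, G.wt s t e *
        ((if (G.ends e).1 ∈ A ∧ (G.ends e).2 ∈ D ∧ p (G.ends e).2 then 1 else 0) +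
          (if (G.ends e).2 ∈ A ∧ (G.ends e).1 ∈ D ∧ p (G.ends e).1 then 1 else 0)) :=
  sum_filter_portsW A D x p

/-- Total weight of the edges between `A` and the complement of `B`. -/
noncomputable def sharedSum (G : CostGraph) (s t : G.Vert) (A B : Finset G.Vert) : ℕ :=
  ∑ e, G.wt s t e * ((if (G.ends e).1 ∈ A ∧ (G.ends e).2 ∉ B then 1 else 0) +
    (if (G.ends e).2 ∈ A ∧ (G.ends e).1 ∉ B then 1 else 0))

theorem one_le_weight_portsW (A D : Finset G.Vert) (x : G.Vert) :
    ∀ y ∈ G.portsW s t A D x, 1 ≤ y.1 := by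
  intro y hy
  simp only [portsW, List.mem_append, List.mem_flatMap, List.mem_map] at hy
  rcases hy with hy | ⟨e, -, v, -, rfl⟩
  · split_ifs at hy <;> simp at hy
    subst hy; simp
  · exact one_le_wt e

namespace Piece

variable {A B : Finset G.Vert}

/-- The edges that leave `A ∪ Y` are of four kinds: inside the layer, from `A` to the layer outside
`Y`, from `Y` to the complement of `B`, and from `A` straight to the complement of `B`. -/
theorem cr_union_eq (hAB : A ⊆ B) {Y : Finset G.Vert} (hY : Y ⊆ B \ A) (e : G.Edge) :
    G.cr (A ∪ Y) e = (if (G.ends e).1 ∈ B \ A ∧ (G.ends e).2 ∈ B \ A then G.cr Y e else 0) +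
      ((if (G.ends e).1 ∈ A ∧ (G.ends e).2 ∈ B \ A ∧ (G.ends e).2 ∉ Y then 1 else 0) +
        (if (G.ends e).2 ∈ A ∧ (G.ends e).1 ∈ B \ A ∧ (G.ends e).1 ∉ Y then 1 else 0)) +
      ((if (G.ends e).1 ∈ Bᶜ ∧ (G.ends e).2 ∈ B \ A ∧ (G.ends e).2 ∈ Y then 1 else 0) +
        (if (G.ends e).2 ∈ Bᶜ ∧ (G.ends e).1 ∈ B \ A ∧ (G.ends e).1 ∈ Y then 1 else 0)) +
      ((if (G.ends e).1 ∈ A ∧ (G.ends e).2 ∉ B then 1 else 0) +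
        (if (G.ends e).2 ∈ A ∧ (G.ends e).1 ∉ B then 1 else 0)) := by
  have key : ∀ v, (v ∈ A ∧ v ∈ B ∧ v ∉ Y) ∨ (v ∉ A ∧ v ∈ B ∧ v ∈ Y) ∨
      (v ∉ A ∧ v ∈ B ∧ v ∉ Y) ∨ (v ∉ A ∧ v ∉ B ∧ v ∉ Y) := by
    intro v
    have h1 := @hAB v
    have h2 := @hY v
    rw [Finset.mem_sdiff] at h2
    tauto
  simp only [cr, Finset.mem_union, Finset.mem_sdiff, Finset.mem_compl]
  rcases key (G.ends e).1 with h1 | h1 | h1 | h1 <;> rcases key (G.ends e).2 with h2 | h2 | h2 | h2 <;>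
    simp [h1, h2]

/-- All edges except the inner ones cross `A` or `B`, hence belong to `H`. Only the first summand
depends on the choice of `H`; inner edges have weight 1 and are merely counted. -/
theorem phi_union_eq (h : G.Piece s t A B) {H : Finset G.Edge} (hHA : G.cut Finset.univ A ⊆ H)
    (hHB : G.cut Finset.univ B ⊆ H) {Y : Finset G.Vert} (hY : Y ⊆ B \ A) :
    G.phi s t H (A ∪ Y) = G.inner H (B \ A) Y + G.portSum s t A (B \ A) s (· ∉ Y) +
      G.portSum s t Bᶜ (B \ A) t (· ∈ Y) + G.sharedSum s t A B := by
  have hsub : ∀ f : G.Edge → ℕ, (∀ e, e ∉ G.cut Finset.univ A → e ∉ G.cut Finset.univ B → f e = 0) →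
      ∑ e ∈ H, G.wt s t e * f e = ∑ e, G.wt s t e * f e := by
    intro f hf
    refine Finset.sum_subset (Finset.subset_univ _) fun e _ he => ?_
    rw [hf e (fun h => he (hHA h)) fun h => he (hHB h), mul_zero]
  have h0 : ∀ v, v ∈ A → v ∈ B := fun v hv => h.ssubset.subset hv
  unfold phi sharedSum inner
  rw [portSum_eq, portSum_eq]
  rw [← hsub, ← hsub, ← hsub]
  rotate_left
  · intro e h1 h2
    have h3 := h0 (G.ends e).1
    have h4 := h0 (G.ends e).2
    simp only [mem_cut, Finset.mem_univ, true_and, not_not] at h1 h2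
    rw [if_neg (by tauto), if_neg (by tauto)]
  · intro e h1 h2
    simp only [mem_cut, Finset.mem_univ, true_and, not_not] at h1 h2
    simp only [Finset.mem_sdiff, Finset.mem_compl]
    rw [if_neg (by tauto), if_neg (by tauto)]
  · intro e h1 h2
    simp only [mem_cut, Finset.mem_univ, true_and, not_not] at h1 h2
    simp only [Finset.mem_sdiff]
    rw [if_neg (by tauto), if_neg (by tauto)]
  have h1 : ∑ e ∈ H, G.wt s t e * G.cr (A ∪ Y) e = ∑ e ∈ H,
      (if (G.ends e).1 ∈ B \ A ∧ (G.ends e).2 ∈ B \ A then G.cr Y e else 0) +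
    ∑ e ∈ H, G.wt s t e * ((if (G.ends e).1 ∈ A ∧ (G.ends e).2 ∈ B \ A ∧ (G.ends e).2 ∉ Y then 1 else 0) +
        (if (G.ends e).2 ∈ A ∧ (G.ends e).1 ∈ B \ A ∧ (G.ends e).1 ∉ Y then 1 else 0)) +
    ∑ e ∈ H, G.wt s t e * ((if (G.ends e).1 ∈ Bᶜ ∧ (G.ends e).2 ∈ B \ A ∧ (G.ends e).2 ∈ Y then 1 else 0) +
        (if (G.ends e).2 ∈ Bᶜ ∧ (G.ends e).1 ∈ B \ A ∧ (G.ends e).1 ∈ Y then 1 else 0)) +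
    ∑ e ∈ H, G.wt s t e * ((if (G.ends e).1 ∈ A ∧ (G.ends e).2 ∉ B then 1 else 0) +
        (if (G.ends e).2 ∈ A ∧ (G.ends e).1 ∉ B then 1 else 0)) := by
    rw [← Finset.sum_add_distrib, ← Finset.sum_add_distrib, ← Finset.sum_add_distrib]
    refine Finset.sum_congr rfl fun e _ => ?_
    rw [cr_union_eq h.ssubset.subset hY, mul_add, mul_add, mul_add]
    congr 3
    split_ifs with h'
    · rw [h.wt_inner h'.1 h'.2, one_mul]
    · rfl
  have h2 : (if s ∈ A ∪ Y then 0 else 2) = if s ∈ B \ A ∧ s ∉ Y then 2 else 0 := by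
    have := h.s_mem
    simp only [Finset.mem_union, Finset.mem_sdiff]
    by_cases h1 : s ∈ A <;> by_cases h2 : s ∈ Y <;> simp [h1, h2, this]
  have h3 : (if t ∈ A ∪ Y then 2 else 0) = if t ∈ B \ A ∧ t ∈ Y then 2 else 0 := by
    have := h.t_notMem
    have := @hY t
    simp only [Finset.mem_union, Finset.mem_sdiff] at this ⊢
    by_cases h2 : t ∈ Y <;> simp_all
  rw [h1, h2, h3]
  omega

theorem portSum_congr {A D : Finset G.Vert} {x : G.Vert} {p q : G.Vert → Prop} [DecidablePred p]
    [DecidablePred q] (h : ∀ v ∈ D, p v ↔ q v) :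
    G.portSum s t A D x p = G.portSum s t A D x q := by
  unfold portSum
  congr 2
  refine List.filter_congr fun y hy => ?_
  have : y.2 ∈ G.ports A D x := by rw [← map_snd_portsW (s := s) (t := t)]; exact List.mem_map_of_mem hy
  simp [h y.2 (mem_ports.1 this).1]

theorem portSum_true (A D : Finset G.Vert) (x : G.Vert) :
    G.portSum s t A D x (fun _ => True) = ((G.portsW s t A D x).map Prod.fst).sum := by
  simp [portSum]

theorem portSum_false (A D : Finset G.Vert) (x : G.Vert) :
    G.portSum s t A D x (fun _ => False) = 0 := by
  simp [portSum]

theorem one_le_portSum {A D : Finset G.Vert} {x v : G.Vert} (h : v ∈ G.ports A D x) :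
    1 ≤ G.portSum s t A D x (fun _ => True) := by
  rw [portSum_true]
  rw [← map_snd_portsW (s := s) (t := t), List.mem_map] at h
  obtain ⟨y, hy, -⟩ := h
  exact (one_le_weight_portsW A D x y hy).trans (List.le_sum_of_mem (List.mem_map_of_mem hy))

/-- The case `Y = ∅` of `phi_union_eq`, where the set is `A` itself and `phi` equals 2. -/
theorem in_total (h : G.Piece s t A B) :
    G.portSum s t A (B \ A) s (fun _ => True) + G.sharedSum s t A B = 2 := by
  have h1 := h.phi_union_eq (H := Finset.univ) (Y := ∅) (Finset.subset_univ _)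
    (Finset.subset_univ _) (Finset.empty_subset _)
  rw [Finset.union_empty, h.tightA.eq_two] at h1
  rw [portSum_congr (q := fun _ => True) (by simp), portSum_congr (A := Bᶜ) (q := fun _ => False) (by simp),
    portSum_false] at h1
  have : G.inner Finset.univ (B \ A) ∅ = 0 := by simp [inner, cr]
  omega

/-- The case `Y = B \ A`, where the set is `B`. -/
theorem out_total (h : G.Piece s t A B) :
    G.portSum s t Bᶜ (B \ A) t (fun _ => True) + G.sharedSum s t A B = 2 := by
  have h1 := h.phi_union_eq (H := Finset.univ) (Y := B \ A) (Finset.subset_univ _)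
    (Finset.subset_univ _) subset_rfl
  rw [Finset.union_sdiff_of_subset h.ssubset.subset, h.tightB.eq_two] at h1
  rw [portSum_congr (q := fun _ => False) (by simp),
    portSum_congr (A := Bᶜ) (q := fun _ => True) (by simp), portSum_false] at h1
  have : G.inner Finset.univ (B \ A) (B \ A) = 0 := by
    refine Finset.sum_eq_zero fun e _ => ?_
    split_ifs with h'
    · exact if_pos (by simp only [h'.1, h'.2])
    · rfl
  omega

/-- Either `s` lies in the layer and is itself a port, or the connectedness of `B` gives an edge
from `A` into the layer. -/
theorem exists_in (h : G.Piece s t A B) : ∃ v, v ∈ G.ports A (B \ A) s := by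
  by_cases hs : s ∈ A
  · obtain ⟨u, hu, hu'⟩ := Finset.exists_of_ssubset h.ssubset
    obtain ⟨e, he, h1, h2⟩ := h.tightB.exists_inside h.reach hs hu hu'
    obtain ⟨u, hu, v, hv, hj⟩ := exists_joins_of_mem_cut he
    refine ⟨v, mem_ports.2 ⟨Finset.mem_sdiff.2 ⟨?_, hv⟩, Or.inr ⟨e, u, hu, hj⟩⟩⟩
    rcases hj with hj | hj <;> rw [hj] at h1 h2 <;> assumption
  · exact ⟨s, mem_ports.2 ⟨Finset.mem_sdiff.2 ⟨h.s_mem, hs⟩, Or.inl rfl⟩⟩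

theorem exists_out (h : G.Piece s t A B) : ∃ v, v ∈ G.ports Bᶜ (B \ A) t := by
  by_cases ht : t ∈ B
  · exact ⟨t, mem_ports.2 ⟨Finset.mem_sdiff.2 ⟨ht, h.t_notMem⟩, Or.inl rfl⟩⟩
  · obtain ⟨u, hu, hu'⟩ := Finset.exists_of_ssubset h.ssubset
    obtain ⟨e, he, h1, h2⟩ := h.tightA.exists_outside h.reach ht (h.tightB.subset hu) hu' hu
    obtain ⟨u, hu, v, hv, hj⟩ := exists_joins_of_mem_cut he
    refine ⟨u, mem_ports.2 ⟨Finset.mem_sdiff.2 ⟨hu, ?_⟩, Or.inr ⟨e, v, by simpa using hv,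
      joins_comm.1 hj⟩⟩⟩
    rcases hj with hj | hj <;> rw [hj] at h1 h2 <;> assumption

/-- The ports on the source side have weight at least 1 out of a total of 2, so at most weight 1 can
bypass the layer. -/
theorem shared_iff (h : G.Piece s t A B) : G.Shared A B ↔ G.sharedSum s t A B = 1 := by
  obtain ⟨v, hv⟩ := h.exists_in
  have h1 := one_le_portSum (s := s) (t := t) hv
  have h2 := h.in_total
  constructor
  · rintro ⟨e, u, hu, v, hv, hj⟩
    have : 1 ≤ G.sharedSum s t A B := by
      unfold sharedSum
      refine le_trans ?_ (Finset.single_le_sum (fun _ _ => Nat.zero_le _) (Finset.mem_univ e))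
      refine one_le_mul (one_le_wt e) ?_
      rcases hj with hj | hj <;> simp [hj, hu, hv]
    omega
  · intro h3
    by_contra hn
    have : G.sharedSum s t A B = 0 := by
      refine Finset.sum_eq_zero fun e _ => ?_
      have h4 : ¬((G.ends e).1 ∈ A ∧ (G.ends e).2 ∉ B) := fun h =>
        hn ⟨e, _, h.1, _, h.2, joins_ends e⟩
      have h5 : ¬((G.ends e).2 ∈ A ∧ (G.ends e).1 ∉ B) := fun h =>
        hn ⟨e, _, h.1, _, h.2, joins_comm.1 (joins_ends e)⟩
      rw [if_neg h4, if_neg h5, add_zero, mul_zero]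
    omega

theorem ports_spec {A D : Finset G.Vert} {x : G.Vert}
    (h1 : G.portSum s t A D x (fun _ => True) = 1 ∨ G.portSum s t A D x (fun _ => True) = 2) :
    G.port₁ A D x ∈ G.ports A D x ∧ G.port₂ A D x ∈ G.ports A D x ∧
    (∀ v ∈ G.ports A D x, v = G.port₁ A D x ∨ v = G.port₂ A D x) ∧
    (G.portSum s t A D x (fun _ => True) = 1 → G.port₁ A D x = G.port₂ A D x) ∧
    ∀ (p : G.Vert → Prop) [DecidablePred p], G.portSum s t A D x p =
      (if p (G.port₁ A D x) then 1 else 0) +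
        if G.portSum s t A D x (fun _ => True) = 2 ∧ p (G.port₂ A D x) then 1 else 0 := by
  rw [portSum_true] at h1 ⊢
  have := two_ports _ (one_le_weight_portsW A D x) x h1
  rw [map_snd_portsW] at this
  exact this

theorem in_spec (h : G.Piece s t A B) :
    G.portSum s t A (B \ A) s (fun _ => True) = 1 ∨ G.portSum s t A (B \ A) s (fun _ => True) = 2 := by
  obtain ⟨v, hv⟩ := h.exists_in
  have h1 := one_le_portSum (s := s) (t := t) hv
  have h2 := h.in_total
  omega

theorem out_spec (h : G.Piece s t A B) :
    G.portSum s t Bᶜ (B \ A) t (fun _ => True) = 1 ∨ G.portSum s t Bᶜ (B \ A) t (fun _ => True) = 2 := by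
  obtain ⟨v, hv⟩ := h.exists_out
  have h1 := one_le_portSum (s := s) (t := t) hv
  have h2 := h.out_total
  omega

/-- The weighted cut of a set between `A` and `B`, in terms of the ports. -/
theorem phi_union (h : G.Piece s t A B) {H : Finset G.Edge} (hHA : G.cut Finset.univ A ⊆ H)
    (hHB : G.cut Finset.univ B ⊆ H) {Y : Finset G.Vert} (hY : Y ⊆ B \ A) :
    (G.Shared A B ∧ G.port₁ A (B \ A) s = G.port₂ A (B \ A) s ∧
      G.port₁ Bᶜ (B \ A) t = G.port₂ Bᶜ (B \ A) t ∧
      G.phi s t H (A ∪ Y) = G.inner H (B \ A) Y + (if G.port₁ A (B \ A) s ∈ Y then 0 else 1) +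
        (if G.port₁ Bᶜ (B \ A) t ∈ Y then 1 else 0) + 1) ∨
    (¬G.Shared A B ∧
      G.phi s t H (A ∪ Y) = G.inner H (B \ A) Y + (if G.port₁ A (B \ A) s ∈ Y then 0 else 1) +
        (if G.port₂ A (B \ A) s ∈ Y then 0 else 1) + (if G.port₁ Bᶜ (B \ A) t ∈ Y then 1 else 0) +
        (if G.port₂ Bᶜ (B \ A) t ∈ Y then 1 else 0)) := by
  have h1 := h.phi_union_eq hHA hHB hY
  obtain ⟨-, -, -, i1, i2⟩ := ports_spec h.in_spec
  obtain ⟨-, -, -, o1, o2⟩ := ports_spec h.out_spec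
  have h2 := h.in_total
  have h3 := h.out_total
  rw [i2, o2] at h1
  by_cases hS : G.Shared A B
  · left
    have h4 := h.shared_iff.1 hS
    have h5 : G.portSum s t A (B \ A) s (fun _ => True) = 1 := by omega
    have h6 : G.portSum s t Bᶜ (B \ A) t (fun _ => True) = 1 := by omega
    refine ⟨hS, i1 h5, o1 h6, ?_⟩
    rw [h5, h6, h4] at h1
    simpa using h1
  · right
    have h4 := mt h.shared_iff.2 hS
    have h5 : G.portSum s t A (B \ A) s (fun _ => True) = 2 := by have := h.in_spec; omega
    have h6 : G.portSum s t Bᶜ (B \ A) t (fun _ => True) = 2 := by omega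
    refine ⟨hS, ?_⟩
    rw [h5, h6, show G.sharedSum s t A B = 0 by omega] at h1
    simpa [add_assoc] using h1

end Piece

end CostGraph

/-! ### Links between the ports, and the local form of feasibility -/

namespace CostGraph

variable {G : CostGraph} {s t : G.Vert}

/-- `1` if `Y` separates `u` from `v`, otherwise `0`. -/
def sep (Y : Finset G.Vert) (u v : G.Vert) : ℕ := if (u ∈ Y ↔ v ∈ Y) then 0 else 1

/-- The ports of a piece. -/
def pieceTerminals (G : CostGraph) (s t : G.Vert) (A B : Finset G.Vert) : Finset G.Vert :=
  {G.port₁ A (B \ A) s, G.port₂ A (B \ A) s, G.port₁ Bᶜ (B \ A) t, G.port₂ Bᶜ (B \ A) t}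

open scoped Classical in
/-- Minimum number of edges that cross `Y` or one of the links between the ports. -/
noncomputable def linked (G : CostGraph) (s t : G.Vert) (H : Finset G.Edge) (A B Y : Finset G.Vert) : ℕ :=
  G.inner H (B \ A) Y + sep Y (G.port₁ A (B \ A) s) (G.port₂ A (B \ A) s) +
    sep Y (G.port₁ Bᶜ (B \ A) t) (G.port₂ Bᶜ (B \ A) t) +
    if G.Shared A B then sep Y (G.port₁ A (B \ A) s) (G.port₁ Bᶜ (B \ A) t) else 0

/-- The ports of a piece are three-edge-connected in `H`, together with the links. -/
def Solves (G : CostGraph) (s t : G.Vert) (H : Finset G.Edge) (A B : Finset G.Vert) : Prop :=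
  ∀ Y ⊆ B \ A, (∃ u ∈ G.pieceTerminals s t A B, u ∈ Y) → (∃ v ∈ G.pieceTerminals s t A B, v ∉ Y) →
    3 ≤ G.linked s t H A B Y

theorem union_inter_eq {V : Type} [DecidableEq V] {A B C : Finset V} (h : A ⊆ B) :
    (C ∪ A) ∩ B = A ∪ (C ∩ (B \ A)) := by
  ext v
  have : v ∈ A → v ∈ B := fun h' => h h'
  simp only [Finset.mem_inter, Finset.mem_union, Finset.mem_sdiff]
  tauto

/-- Each crossing link is paid for: a link between two ports of the same side by the one on the
costly side of `Y`, and the link of a shared edge by the constant 1 of that edge. -/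
theorem links_le {x f : ℕ} {S a₁ a₂ b₁ b₂ : Prop} [Decidable S] [Decidable a₁]
    [Decidable a₂] [Decidable b₁] [Decidable b₂]
    (p : (S ∧ (a₁ ↔ a₂) ∧ (b₁ ↔ b₂) ∧ f = x + (if a₁ then 0 else 1) + (if b₁ then 1 else 0) + 1) ∨
      (¬S ∧ f = x + (if a₁ then 0 else 1) + (if a₂ then 0 else 1) + (if b₁ then 1 else 0) +
        (if b₂ then 1 else 0))) :
    x + (if (a₁ ↔ a₂) then 0 else 1) + (if (b₁ ↔ b₂) then 0 else 1) +
      (if S then (if (a₁ ↔ b₁) then 0 else 1) else 0) ≤ f := by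
  by_cases c1 : a₁ <;> by_cases c2 : a₂ <;> by_cases c3 : b₁ <;> by_cases c4 : b₂ <;>
    by_cases c5 : S <;> simp [c1, c2, c3, c4, c5] at p ⊢ <;> omega

/-- With all ports in `Y` the ports towards `t` and a possible shared edge give 2; with none in `Y`
the ports towards `s` do. -/
theorem two_le_of_not_split {x f : ℕ} {S a₁ a₂ b₁ b₂ : Prop} [Decidable S] [Decidable a₁]
    [Decidable a₂] [Decidable b₁] [Decidable b₂]
    (p : (S ∧ (a₁ ↔ a₂) ∧ (b₁ ↔ b₂) ∧ f = x + (if a₁ then 0 else 1) + (if b₁ then 1 else 0) + 1) ∨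
      (¬S ∧ f = x + (if a₁ then 0 else 1) + (if a₂ then 0 else 1) + (if b₁ then 1 else 0) +
        (if b₂ then 1 else 0)))
    (h : ¬((a₁ ∨ a₂ ∨ b₁ ∨ b₂) ∧ (¬a₁ ∨ ¬a₂ ∨ ¬b₁ ∨ ¬b₂))) : 2 ≤ f := by
  by_cases c1 : a₁ <;> by_cases c2 : a₂ <;> by_cases c3 : b₁ <;> by_cases c4 : b₂ <;>
    by_cases c5 : S <;> simp [c1, c2, c3, c4, c5] at p h ⊢ <;> omega

/-- The finite core of `exists_small_cut`. The link count does not distinguish `Y` from its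
complement in the layer, while `phi` does; `f` and `g` are the two values, and one of the sides has
the orientation from source ports to target ports. -/
theorem exists_small_side {x f g : ℕ} {S a₁ a₂ b₁ b₂ : Prop} [Decidable S] [Decidable a₁]
    [Decidable a₂] [Decidable b₁] [Decidable b₂] {a₁' a₂' b₁' b₂' : Prop} [Decidable a₁']
    [Decidable a₂'] [Decidable b₁'] [Decidable b₂'] (ha₁ : a₁' ↔ ¬a₁) (ha₂ : a₂' ↔ ¬a₂)
    (hb₁ : b₁' ↔ ¬b₁) (hb₂ : b₂' ↔ ¬b₂)
    (p : (S ∧ (a₁ ↔ a₂) ∧ (b₁ ↔ b₂) ∧ f = x + (if a₁ then 0 else 1) + (if b₁ then 1 else 0) + 1) ∨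
      (¬S ∧ f = x + (if a₁ then 0 else 1) + (if a₂ then 0 else 1) + (if b₁ then 1 else 0) +
        (if b₂ then 1 else 0)))
    (q : (S ∧ g = x + (if a₁' then 0 else 1) + (if b₁' then 1 else 0) + 1) ∨
      (¬S ∧ g = x + (if a₁' then 0 else 1) + (if a₂' then 0 else 1) + (if b₁' then 1 else 0) +
        (if b₂' then 1 else 0)))
    (hlt : x + (if (a₁ ↔ a₂) then 0 else 1) + (if (b₁ ↔ b₂) then 0 else 1) +
      (if S then (if (a₁ ↔ b₁) then 0 else 1) else 0) < 3)
    (h₁ : a₁ ∨ a₂ ∨ b₁ ∨ b₂) (h₂ : ¬a₁ ∨ ¬a₂ ∨ ¬b₁ ∨ ¬b₂) :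
    (f ≤ 2 ∧ (a₁ ∨ a₂) ∧ (¬b₁ ∨ ¬b₂)) ∨ (g ≤ 2 ∧ (¬a₁ ∨ ¬a₂) ∧ (b₁ ∨ b₂)) := by
  by_cases c1 : a₁ <;> by_cases c2 : a₂ <;> by_cases c3 : b₁ <;> by_cases c4 : b₂ <;>
    by_cases c5 : S <;> simp [ha₁, ha₂, hb₁, hb₂, c1, c2, c3, c4, c5] at p q hlt h₁ h₂ ⊢ <;> omega

namespace Piece

variable {A B : Finset G.Vert}

theorem port_mem (h : G.Piece s t A B) {v : G.Vert} (hv : v ∈ G.pieceTerminals s t A B) :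
    v ∈ B \ A := by
  obtain ⟨i1, i2, -⟩ := ports_spec h.in_spec
  obtain ⟨o1, o2, -⟩ := ports_spec h.out_spec
  simp only [pieceTerminals, Finset.mem_insert, Finset.mem_singleton] at hv
  rcases hv with rfl | rfl | rfl | rfl
  · exact (mem_ports.1 i1).1
  · exact (mem_ports.1 i2).1
  · exact (mem_ports.1 o1).1
  · exact (mem_ports.1 o2).1

theorem in_mem (h : G.Piece s t A B) {v : G.Vert} (hv : v ∈ G.ports A (B \ A) s) :
    v ∈ G.pieceTerminals s t A B := by
  obtain ⟨-, -, i, -⟩ := ports_spec h.in_spec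
  simp only [pieceTerminals, Finset.mem_insert, Finset.mem_singleton]
  rcases i v hv with h | h <;> simp [h]

theorem out_mem (h : G.Piece s t A B) {v : G.Vert} (hv : v ∈ G.ports Bᶜ (B \ A) t) :
    v ∈ G.pieceTerminals s t A B := by
  obtain ⟨-, -, i, -⟩ := ports_spec h.out_spec
  simp only [pieceTerminals, Finset.mem_insert, Finset.mem_singleton]
  rcases i v hv with h | h <;> simp [h]

theorem linked_le_phi (h : G.Piece s t A B) {H : Finset G.Edge} (hHA : G.cut Finset.univ A ⊆ H)
    (hHB : G.cut Finset.univ B ⊆ H) {Y : Finset G.Vert} (hY : Y ⊆ B \ A) :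
    G.linked s t H A B Y ≤ G.phi s t H (A ∪ Y) := by
  unfold linked sep
  classical
  refine links_le (S := G.Shared A B) <| (h.phi_union hHA hHB hY).imp ?_ _root_.id
  rintro ⟨q1, q2, q3, q4⟩
  exact ⟨q1, by rw [q2], by rw [q3], q4⟩

theorem two_le_phi_union (h : G.Piece s t A B) {H : Finset G.Edge} (hHA : G.cut Finset.univ A ⊆ H)
    (hHB : G.cut Finset.univ B ⊆ H) (hS : G.Solves s t H A B) {Y : Finset G.Vert}
    (hY : Y ⊆ B \ A) : 2 ≤ G.phi s t H (A ∪ Y) := by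
  by_cases hsp : (∃ u ∈ G.pieceTerminals s t A B, u ∈ Y) ∧ ∃ v ∈ G.pieceTerminals s t A B, v ∉ Y
  · have := h.linked_le_phi hHA hHB hY
    have := hS Y hY hsp.1 hsp.2
    omega
  · simp only [pieceTerminals, Finset.mem_insert, Finset.mem_singleton, exists_eq_or_imp,
      exists_eq_left] at hsp
    classical
    refine two_le_of_not_split (S := G.Shared A B) ((h.phi_union hHA hHB hY).imp ?_ _root_.id) hsp
    rintro ⟨q1, q2, q3, q4⟩
    exact ⟨q1, by rw [q2], by rw [q3], q4⟩

/-- A set of ports that is split by few edges gives a small cut. -/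
theorem exists_small_cut (h : G.Piece s t A B) {H : Finset G.Edge} (hHA : G.cut Finset.univ A ⊆ H)
    (hHB : G.cut Finset.univ B ⊆ H) {Y : Finset G.Vert} (hY : Y ⊆ B \ A) {u v : G.Vert}
    (hu : u ∈ G.pieceTerminals s t A B) (huY : u ∈ Y) (hv : v ∈ G.pieceTerminals s t A B)
    (hvY : v ∉ Y) (hlt : G.linked s t H A B Y < 3) :
    ∃ Y, Y ⊆ B \ A ∧ G.phi s t H (A ∪ Y) ≤ 2 ∧
      (∃ a ∈ G.ports A (B \ A) s, a ∈ Y) ∧ ∃ b ∈ G.ports Bᶜ (B \ A) t, b ∉ Y := by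
  have hY' : (B \ A) \ Y ⊆ B \ A := Finset.sdiff_subset
  have hin : G.inner H (B \ A) ((B \ A) \ Y) = G.inner H (B \ A) Y := by
    refine Finset.sum_congr rfl fun e _ => ?_
    split_ifs with he
    · simp only [cr, Finset.mem_sdiff (s := B \ A), he.1, he.2, true_and, not_iff_not]
    · rfl
  obtain ⟨i1, i2, -⟩ := ports_spec h.in_spec
  obtain ⟨o1, o2, -⟩ := ports_spec h.out_spec
  have mi1 := (mem_ports.1 i1).1
  have mi2 := (mem_ports.1 i2).1
  have mo1 := (mem_ports.1 o1).1
  have mo2 := (mem_ports.1 o2).1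
  have p1 := h.phi_union hHA hHB hY
  have p2 := h.phi_union hHA hHB hY'
  rw [hin] at p2
  have hmem : ∀ v ∈ B \ A, (v ∈ (B \ A) \ Y ↔ v ∉ Y) := fun v hv =>
    ⟨fun h => (Finset.mem_sdiff.1 h).2, fun h => Finset.mem_sdiff.2 ⟨hv, h⟩⟩
  have e1 : ∀ {Y : Finset G.Vert}, G.port₁ A (B \ A) s ∈ Y → ∃ a ∈ G.ports A (B \ A) s, a ∈ Y := fun h => ⟨_, i1, h⟩
  have e2 : ∀ {Y : Finset G.Vert}, G.port₂ A (B \ A) s ∈ Y → ∃ a ∈ G.ports A (B \ A) s, a ∈ Y := fun h => ⟨_, i2, h⟩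
  have f1 : ∀ {Y : Finset G.Vert}, G.port₁ Bᶜ (B \ A) t ∉ Y → ∃ b ∈ G.ports Bᶜ (B \ A) t, b ∉ Y := fun h => ⟨_, o1, h⟩
  have f2 : ∀ {Y : Finset G.Vert}, G.port₂ Bᶜ (B \ A) t ∉ Y → ∃ b ∈ G.ports Bᶜ (B \ A) t, b ∉ Y := fun h => ⟨_, o2, h⟩
  have g1 := hmem _ mi1
  have g2 := hmem _ mi2
  have g3 := hmem _ mo1
  have g4 := hmem _ mo2
  simp only [pieceTerminals, Finset.mem_insert, Finset.mem_singleton] at hu hv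
  suffices hs : (G.phi s t H (A ∪ Y) ≤ 2 ∧ (G.port₁ A (B \ A) s ∈ Y ∨ G.port₂ A (B \ A) s ∈ Y) ∧
      (G.port₁ Bᶜ (B \ A) t ∉ Y ∨ G.port₂ Bᶜ (B \ A) t ∉ Y)) ∨
      (G.phi s t H (A ∪ ((B \ A) \ Y)) ≤ 2 ∧
        (G.port₁ A (B \ A) s ∉ Y ∨ G.port₂ A (B \ A) s ∉ Y) ∧
        (G.port₁ Bᶜ (B \ A) t ∈ Y ∨ G.port₂ Bᶜ (B \ A) t ∈ Y)) by
    rcases hs with ⟨h1, h2, h3⟩ | ⟨h1, h2, h3⟩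
    · exact ⟨Y, hY, h1, h2.elim e1 e2, h3.elim f1 f2⟩
    · refine ⟨_, hY', h1, ?_, ?_⟩
      · rcases h2 with h2 | h2
        · exact e1 (g1.2 h2)
        · exact e2 (g2.2 h2)
      · rcases h3 with h3 | h3
        · exact f1 (fun h => g3.1 h h3)
        · exact f2 (fun h => g4.1 h h3)
  clear hin hmem e1 e2 f1 f2
  have huv : (G.port₁ A (B \ A) s ∈ Y ∨ G.port₂ A (B \ A) s ∈ Y ∨ G.port₁ Bᶜ (B \ A) t ∈ Y ∨
      G.port₂ Bᶜ (B \ A) t ∈ Y) ∧ (G.port₁ A (B \ A) s ∉ Y ∨ G.port₂ A (B \ A) s ∉ Y ∨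
      G.port₁ Bᶜ (B \ A) t ∉ Y ∨ G.port₂ Bᶜ (B \ A) t ∉ Y) := by
    constructor
    · rcases hu with rfl | rfl | rfl | rfl <;> simp [huY]
    · rcases hv with rfl | rfl | rfl | rfl <;> simp [hvY]
  unfold linked sep at hlt
  classical
  refine exists_small_side g1 g2 g3 g4 (S := G.Shared A B) (p1.imp ?_ ?_) (p2.imp ?_ ?_) hlt huv.1 huv.2
  · rintro ⟨q1, q2, q3, q4⟩
    exact ⟨q1, by rw [q2], by rw [q3], q4⟩
  · exact fun h => h
  · rintro ⟨q1, q2, q3, q4⟩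
    exact ⟨q1, q4⟩
  · exact fun h => h

/-- The pieces of a feasible solution. -/
theorem solves_of_relFeasible (h : G.Piece s t A B) {H : Finset G.Edge} (hHA : G.cut Finset.univ A ⊆ H)
    (hHB : G.cut Finset.univ B ⊆ H) (hH : G.RelFeasible [(s, t, 3)] H) : G.Solves s t H A B := by
  intro Y hY ⟨u, hu, huY⟩ ⟨v, hv, hvY⟩
  by_contra! hlt
  -- one of `Y` and its complement in `D` gives a small cut
  obtain ⟨Y, hY, hphi, ⟨a, ha, haY⟩, b, hb, hbY⟩ := h.exists_small_cut hHA hHB hY hu huY hv hvY hlt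
  have hDa := (mem_ports.1 ha).1
  have hDb := (mem_ports.1 hb).1
  rw [Finset.mem_sdiff] at hDa hDb
  have hsum := hphi
  unfold phi at hsum
  have hs : s ∈ A ∪ Y := by
    rcases (mem_ports.1 ha).2 with rfl | ⟨e, u, hu, hj⟩
    · exact Finset.mem_union_right _ haY
    · exact Finset.mem_union_left _ (h.tightA.s_mem hu)
  have ht : t ∉ A ∪ Y := by
    intro ht
    rcases Finset.mem_union.1 ht with h' | h'
    · exact h.t_notMem h'
    · have htB := (Finset.mem_sdiff.1 (hY h')).1
      rcases (mem_ports.1 hb).2 with rfl | ⟨e, u, hu, hj⟩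
      · exact hbY h'
      · have hu' : u ∉ B := by simpa using hu
        exact h.tightB.t_notMem h.reach (mem_comp_of_joins (joins_comm.1 hj) (Finset.mem_univ _)
          (h.tightB.subset hDb.1)) hu' htB
  rw [if_pos hs, if_neg ht] at hsum
  -- The small cut contains a full cut with side `Z`, whose part in the component of `s` is tight.
  -- As `A` and `B` are consecutive, uncrossing leaves only `(Z ∪ A) ∩ B = A` or `= B`.
  obtain ⟨Z, hsZ, htZ, hZ⟩ := relFeasible_iff.1 hH (A ∪ Y) hs ht
    ((card_cut_le_sum (s := s) (t := t) _ _).trans (by omega))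
  have hcl := (cut_inter_comp_subset (s := s) Z).trans hZ
  have hZs : s ∈ Z ∩ G.comp Finset.univ s := by simp [hsZ, self_mem_comp]
  have hZt : t ∉ Z ∩ G.comp Finset.univ s := by simp [htZ]
  have hT : G.Tight s t (Z ∩ G.comp Finset.univ s) := by
    refine ⟨Finset.inter_subset_right, le_antisymm ?_ (two_le_phi h.reach _)⟩
    unfold phi
    rw [if_pos hZs, if_neg hZt, sum_wt_cr]
    have := Finset.sum_le_sum_of_subset (f := fun e => G.wt s t e) hcl
    rw [sum_wt_cr] at hsum
    omega
  generalize Z ∩ G.comp Finset.univ s = Z at hcl hZs hZt hT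
  have hcr : ∀ {e u v}, G.Joins e u v → (u ∈ A ∪ Y ↔ v ∈ A ∪ Y) → (u ∈ Z ↔ v ∈ Z) := by
    intro e u v hj huv
    by_contra hn
    exact (hj.mem_cut.1 (hcl (hj.mem_cut.2 ⟨Finset.mem_univ _, hn⟩))).2 huv
  rcases h.eq_or_eq _ ((hT.union h.reach h.tightA).inter h.reach h.tightB)
    (Finset.subset_inter Finset.subset_union_right h.ssubset.subset) Finset.inter_subset_right with h3 | h3
  -- Here the port `a ∈ Y` lies outside `Z`, and so does its neighbour in `A`, since their edge does
  -- not cross `A ∪ Y`. Now `Z` splits `A`, and as `A` is connected, some edge inside `A` crosses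
  -- `Z` but not `A ∪ Y`.
  · have haZ : a ∉ Z := by
      intro haZ
      refine hDa.2 (h3 ▸ ?_)
      rw [Finset.mem_inter, Finset.mem_union]; exact ⟨Or.inl haZ, hDa.1⟩
    rcases (mem_ports.1 ha).2 with rfl | ⟨e, u, hu, hj⟩
    · exact haZ hZs
    · have huZ : u ∉ Z := by
        rw [hcr hj]
        · exact haZ
        · simp [hu, haY]
      obtain ⟨f, hf, hf1, hf2⟩ := h.tightA.exists_inside h.reach hZs hu huZ
      have := (mem_cut.1 (hcl hf)).2
      simp [hf1, hf2] at this
  -- The mirror image: `Z` reaches a vertex beyond `B` through the port `b`, and the connected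
  -- complement of `B` has an edge that crosses `Z` but not `A ∪ Y`.
  · have hbZ : b ∈ Z := by
      have := h3 ▸ hDb.1
      rw [Finset.mem_inter, Finset.mem_union] at this
      exact this.1.resolve_right hDb.2
    rcases (mem_ports.1 hb).2 with rfl | ⟨e, u, hu, hj⟩
    · exact hZt hbZ
    · have hu' : u ∉ B := by simpa using hu
      have huAY : ∀ v, v ∉ B → v ∉ A ∪ Y := by
        intro v hv
        rw [Finset.mem_union]
        rintro (h' | h')
        · exact hv (h.ssubset.subset h')
        · exact hv (Finset.mem_sdiff.1 (hY h')).1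
      have huZ : u ∈ Z := by
        rw [hcr hj]
        · exact hbZ
        · have : b ∉ A ∪ Y := by simp [hDb.2, hbY]
          exact iff_of_false (huAY u hu') this
      obtain ⟨f, hf, hf1, hf2⟩ := h.tightB.exists_outside h.reach hZt
        (mem_comp_of_joins (joins_comm.1 hj) (Finset.mem_univ _) (h.tightB.subset hDb.1)) hu' huZ
      exact (mem_cut.1 (hcl hf)).2 (iff_of_false (huAY _ hf1) (huAY _ hf2))

end Piece

/-- Feasible solutions contain the edges of tight cuts. -/
theorem Tight.cut_subset (hr : G.Reach Finset.univ s t) {A : Finset G.Vert} (hA : G.Tight s t A)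
    {H : Finset G.Edge} (hH : G.RelFeasible [(s, t, 3)] H) : G.cut Finset.univ A ⊆ H := by
  intro e he
  by_contra heH
  obtain ⟨u, hu, v, hv, hj⟩ := exists_joins_of_mem_cut he
  have hs := hA.s_mem hu
  have ht := hA.t_notMem hr (mem_comp_of_joins hj (Finset.mem_univ _) (hA.subset hu)) hv
  have h1 := hA.eq_two
  unfold phi at h1
  rw [if_pos hs, if_neg ht, sum_wt_cr] at h1
  -- Without `e` the cut has weight at most 1, too little to contain a full `st`-cut.
  have h2 : G.cut H A ⊆ (G.cut Finset.univ A).erase e := fun f hf =>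
    Finset.mem_erase.2 ⟨fun h => heH (h ▸ (mem_cut.1 hf).1), cut_mono (Finset.subset_univ _) _ hf⟩
  have h3 := Finset.add_sum_erase _ (fun e => G.wt s t e) he
  have h4 := one_le_wt (s := s) (t := t) e
  obtain ⟨Z, hsZ, htZ, hZ⟩ := relFeasible_iff.1 hH A hs ht (by
    have h5 := card_cut_le_sum (s := s) (t := t) Finset.univ A
    rw [sum_wt_cr] at h5
    have := Finset.card_le_card (cut_mono (G := G) (Finset.subset_univ H) A)
    omega)
  have h5 := two_le_sum_wt hr hsZ htZ
  have h6 := Finset.sum_le_sum_of_subset (f := fun e => G.wt s t e) (hZ.trans h2)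
  omega

/-! ### Chains of tight sets: from local to global feasibility -/

/-- A chain of tight sets without gaps. -/
structure Chain (G : CostGraph) (s t : G.Vert) (A : ℕ → Finset G.Vert) (k : ℕ) : Prop where
  reach : G.Reach Finset.univ s t
  zero : A 0 = ∅
  last : A k = G.comp Finset.univ s
  step : ∀ j, A j = A (j + 1) ∨ G.Piece s t (A j) (A (j + 1))

namespace Chain

variable {A : ℕ → Finset G.Vert} {k : ℕ}

theorem monotone (h : G.Chain s t A k) : Monotone A :=
  monotone_nat_of_le_succ fun j => by
    rcases h.step j with h1 | h1
    · exact h1.le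
    · exact h1.ssubset.subset

theorem tight (h : G.Chain s t A k) (j : ℕ) : G.Tight s t (A j) := by
  induction j with
  | zero => rw [h.zero]; exact tight_empty
  | succ j ih =>
    rcases h.step j with h1 | h1
    · rwa [← h1]
    · exact h1.tightB

theorem exists_layer (h : G.Chain s t A k) {v : G.Vert} (hv : v ∈ G.comp Finset.univ s) :
    ∃ j < k, v ∈ A (j + 1) \ A j := by
  classical
  have h1 : ∃ j, v ∈ A j := ⟨k, h.last ▸ hv⟩
  have h2 := Nat.find_spec h1
  have h3 : Nat.find h1 ≠ 0 := by
    intro h0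
    rw [h0, h.zero] at h2
    simp at h2
  obtain ⟨j, hj⟩ := Nat.exists_eq_succ_of_ne_zero h3
  refine ⟨j, ?_, Finset.mem_sdiff.2 ⟨by rwa [hj] at h2, Nat.find_min h1 (by omega)⟩⟩
  have := Nat.find_min' h1 (h.last ▸ hv)
  omega

theorem piece (h : G.Chain s t A k) {j : ℕ} {v : G.Vert} (hv : v ∈ A (j + 1) \ A j) :
    G.Piece s t (A j) (A (j + 1)) := by
  rcases h.step j with h1 | h1
  · rw [h1, Finset.sdiff_self] at hv; simp at hv
  · exact h1

variable {H : Finset G.Edge}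

theorem phi_eq (h : G.Chain s t A k) (hH : ∀ j, G.cut Finset.univ (A j) ⊆ H) (j : ℕ) :
    G.phi s t H (A j) = 2 := by
  rw [← (h.tight j).eq_two]
  unfold phi
  rw [sum_wt_cr, sum_wt_cr]
  congr 2
  exact (cut_mono (Finset.subset_univ _) _).antisymm (cut_univ_subset (hH j))

/-- A set with `phi < 2` can be enlarged by one member of the chain after another: each layer
contributes at least 2 on the intersection side, so by submodularity the union stays below 2. In the
end it contains `t` and the virtual edges refute it. -/
theorem two_le_phi (h : G.Chain s t A k) (hH : ∀ j, G.cut Finset.univ (A j) ⊆ H)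
    (hS : ∀ j, G.Piece s t (A j) (A (j + 1)) → G.Solves s t H (A j) (A (j + 1))) (C : Finset G.Vert) :
    2 ≤ G.phi s t H C := by
  by_contra! hC
  have key : ∀ j, ∃ C, A j ⊆ C ∧ G.phi s t H C < 2 := by
    intro j
    induction j with
    | zero => exact ⟨C, by rw [h.zero]; exact Finset.empty_subset _, hC⟩
    | succ j ih =>
      obtain ⟨C, hjC, hC⟩ := ih
      rcases h.step j with h1 | h1
      · exact ⟨C, h1 ▸ hjC, hC⟩
      · refine ⟨C ∪ A (j + 1), Finset.subset_union_right, ?_⟩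
        have h2 := phi_submodular (s := s) (t := t) H C (A (j + 1))
        rw [h.phi_eq hH] at h2
        have h3 := union_inter_eq (C := C) (h.monotone (by omega : j ≤ j + 1))
        rw [Finset.union_eq_left.2 hjC] at h3
        have h4 := h1.two_le_phi_union (hH j) (hH (j + 1)) (hS j h1) (Y := C ∩ (A (j + 1) \ A j))
          Finset.inter_subset_right
        rw [← h3] at h4
        omega
  obtain ⟨C, hkC, hC⟩ := key k
  unfold phi at hC
  rw [if_pos (hkC (h.last ▸ mem_comp.2 h.reach) : t ∈ C)] at hC
  omega

/-- Let `C` be an `st`-set whose cut in `H` is small and contains no full cut. Uncrossing with the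
chain shows that `C` splits the ports of no layer. Rounding `C` to whole layers according to their
ports gives a full cut inside that of `C` after all. -/
theorem relFeasible (h : G.Chain s t A k) (hH : ∀ j, G.cut Finset.univ (A j) ⊆ H)
    (hS : ∀ j, G.Piece s t (A j) (A (j + 1)) → G.Solves s t H (A j) (A (j + 1))) :
    G.RelFeasible [(s, t, 3)] H := by
  rw [relFeasible_iff]
  intro C hs ht hC
  by_contra hno
  -- An edge of weight 2 in the cut would by itself contain a full cut.
  have hwt : ∀ e ∈ G.cut H C, G.wt s t e = 1 := by
    intro e he
    unfold wt
    refine if_pos ?_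
    by_contra hn
    obtain ⟨Z, hsZ, htZ, hZ⟩ := not_reach_iff.1 hn
    rw [cut_sdiff] at hZ
    exact hno ⟨Z, hsZ, htZ, hZ.trans (Finset.singleton_subset_iff.2 he)⟩
  have hphi : G.phi s t H C ≤ 2 := by
    unfold phi
    rw [if_pos hs, if_neg ht, sum_wt_cr, Finset.sum_congr rfl hwt]
    simpa using hC
  have hns : ∀ j, ∀ u ∈ G.pieceTerminals s t (A j) (A (j + 1)),
      ∀ v ∈ G.pieceTerminals s t (A j) (A (j + 1)), G.Piece s t (A j) (A (j + 1)) →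
      u ∈ C → v ∈ C := by
    intro j u hu v hv h1 huC
    by_contra hvC
    -- Two uncrossings bring `C` down to the layer with `phi` at most 2, whereas `Solves` demands 3
    -- of a set that splits the ports.
    have h2 := phi_submodular (s := s) (t := t) H C (A j)
    have h3 := phi_submodular (s := s) (t := t) H (C ∪ A j) (A (j + 1))
    have h4 := h.two_le_phi hH hS (C ∩ A j)
    have h5 := h.two_le_phi hH hS ((C ∪ A j) ∪ A (j + 1))
    rw [h.phi_eq hH] at h2 h3
    have h6 := union_inter_eq (C := C) (h.monotone (by omega : j ≤ j + 1))
    have h7 := h1.linked_le_phi (hH j) (hH (j + 1)) (Y := C ∩ (A (j + 1) \ A j))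
      Finset.inter_subset_right
    have h8 := hS j h1 (C ∩ (A (j + 1) \ A j)) Finset.inter_subset_right
      ⟨u, hu, Finset.mem_inter.2 ⟨huC, h1.port_mem hu⟩⟩ ⟨v, hv, fun h => hvC (Finset.mem_inter.1 h).1⟩
    rw [h6] at h3
    omega
  let p : ℕ → G.Vert := fun j => G.port₁ (A j) (A (j + 1) \ A j) s
  have hp : ∀ j, p j ∈ G.pieceTerminals s t (A j) (A (j + 1)) := fun j => by
    simp [pieceTerminals, p]
  have hpC : ∀ {j v}, G.Piece s t (A j) (A (j + 1)) → v ∈ G.pieceTerminals s t (A j) (A (j + 1)) →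
      (v ∈ C ↔ p j ∈ C) := fun {j v} h1 hv =>
    ⟨hns j v hv _ (hp j) h1, hns j _ (hp j) v hv h1⟩
  classical
  -- The rounded set: all layers whose ports are in `C`, each represented by its first port.
  let X : Finset G.Vert := Finset.univ.filter fun v => ∃ j, v ∈ A (j + 1) \ A j ∧ p j ∈ C
  have huniq : ∀ {i j v}, v ∈ A (i + 1) \ A i → v ∈ A (j + 1) \ A j → i = j := by
    intro i j v hi hj
    rw [Finset.mem_sdiff] at hi hj
    by_contra hne
    rcases lt_or_gt_of_ne hne with hlt | hlt
    · exact hj.2 (h.monotone (by omega : i + 1 ≤ j) hi.1)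
    · exact hi.2 (h.monotone (by omega : j + 1 ≤ i) hj.1)
  have hX : ∀ {j v}, v ∈ A (j + 1) \ A j → (v ∈ X ↔ p j ∈ C) := by
    intro j v hv
    simp only [X, Finset.mem_filter, Finset.mem_univ, true_and]
    constructor
    · rintro ⟨i, hi, hpi⟩; rwa [← huniq hi hv]
    · exact fun h => ⟨j, hv, h⟩
  refine hno ⟨X, ?_, ?_, ?_⟩
  · obtain ⟨j, -, hj⟩ := h.exists_layer (self_mem_comp _ s)
    have h1 := h.piece hj
    rw [hX hj, ← hpC h1 (h1.in_mem (mem_ports.2 ⟨hj, Or.inl rfl⟩))]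
    exact hs
  · obtain ⟨j, -, hj⟩ := h.exists_layer (mem_comp.2 h.reach)
    have h1 := h.piece hj
    rw [hX hj, ← hpC h1 (h1.out_mem (mem_ports.2 ⟨hj, Or.inl rfl⟩))]
    exact ht
  · intro e he
    obtain ⟨u, hu, v, hv, hj⟩ := exists_joins_of_mem_cut he
    obtain ⟨i, hui, hpi⟩ : ∃ j, u ∈ A (j + 1) \ A j ∧ p j ∈ C := by
      simpa [X] using hu
    have h1 := h.piece hui
    have hucomp := (h.tight (i + 1)).subset (Finset.mem_sdiff.1 hui).1
    obtain ⟨l, -, hvl⟩ := h.exists_layer (mem_comp_of_joins hj (Finset.mem_univ _) hucomp)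
    have h2 := h.piece hvl
    have hpl : p l ∉ C := (hX hvl).not.1 hv
    have hil : i ≠ l := fun h => hpl (h ▸ hpi)
    have hui' := Finset.mem_sdiff.1 hui
    have hvl' := Finset.mem_sdiff.1 hvl
    -- An edge between different layers ends in ports, which lie in `C` exactly if their layer lies
    -- in `X`; and it crosses a member of the chain, so it is in `H`.
    rcases lt_or_gt_of_ne hil with hlt | hlt
    · have hui2 : u ∈ A l := h.monotone (by omega : i + 1 ≤ l) hui'.1
      have hvi2 : v ∉ A (i + 1) := fun h' => hvl'.2 (h.monotone (by omega : i + 1 ≤ l) h')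
      have huC : u ∈ C := (hpC h1 (h1.out_mem (mem_ports.2 ⟨hui, Or.inr ⟨e, v, by simpa using hvi2,
        joins_comm.1 hj⟩⟩))).2 hpi
      have hvC : v ∉ C := fun h' => hpl ((hpC h2 (h2.in_mem (mem_ports.2 ⟨hvl, Or.inr ⟨e, u, hui2,
        hj⟩⟩))).1 h')
      exact hj.mem_cut.2 ⟨hH (i + 1) (hj.mem_cut.2 ⟨Finset.mem_univ _, by tauto⟩), by tauto⟩
    · have hvi2 : v ∈ A i := h.monotone (by omega : l + 1 ≤ i) hvl'.1
      have hul2 : u ∉ A (l + 1) := fun h' => hui'.2 (h.monotone (by omega : l + 1 ≤ i) h')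
      have huC : u ∈ C := (hpC h1 (h1.in_mem (mem_ports.2 ⟨hui, Or.inr ⟨e, v, hvi2,
        joins_comm.1 hj⟩⟩))).2 hpi
      have hvC : v ∉ C := fun h' => hpl ((hpC h2 (h2.out_mem (mem_ports.2 ⟨hvl, Or.inr ⟨e, u,
        by simpa using hul2, hj⟩⟩))).1 h')
      exact hj.mem_cut.2 ⟨hH (l + 1) (hj.mem_cut.2 ⟨Finset.mem_univ _, by tauto⟩), by tauto⟩

end Chain

end CostGraph

/-! ### The gadget of a piece -/

namespace CostGraph

variable {G : CostGraph} {s t : G.Vert}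

namespace gadget

/-- Edges of `G` in the gadget: only those inside `B ∖ A` are kept. -/
def realEnds (G : CostGraph) (A B : Finset G.Vert) (e : Fin G.m) : Fin (G.n + 2) × Fin (G.n + 2) :=
  if (G.ends e).1 ∈ B \ A ∧ (G.ends e).2 ∈ B \ A then
    ((G.ends e).1.castAdd 2, (G.ends e).2.castAdd 2)
  -- A loop crosses no cut. Keeping it preserves the edge numbers, so a solution of the gadget is
  -- read back by index.
  else ((G.ends e).1.castAdd 2, (G.ends e).1.castAdd 2)

open scoped Classical in
/-- The links to and between the ports. -/
noncomputable def linkEnds (G : CostGraph) (s t : G.Vert) (A B : Finset G.Vert) :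
    Fin 5 → Fin (G.n + 2) × Fin (G.n + 2) :=
  ![(Fin.natAdd G.n 0, (G.port₁ A (B \ A) s).castAdd 2),
    (Fin.natAdd G.n 0, (G.port₂ A (B \ A) s).castAdd 2),
    (Fin.natAdd G.n 1, (G.port₁ Bᶜ (B \ A) t).castAdd 2),
    (Fin.natAdd G.n 1, (G.port₂ Bᶜ (B \ A) t).castAdd 2),
    -- The link that replaces a shared edge; without one it becomes a loop.
    ((G.port₁ A (B \ A) s).castAdd 2,
      (if G.Shared A B then G.port₁ Bᶜ (B \ A) t else G.port₁ A (B \ A) s).castAdd 2)]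

/-- The edges that tie the vertices outside the piece to a port. -/
def pendEnds (G : CostGraph) (s : G.Vert) (A B : Finset G.Vert) (v : Fin G.n) :
    Fin (G.n + 2) × Fin (G.n + 2) :=
  (v.castAdd 2, (if v ∈ B \ A then v else G.port₁ A (B \ A) s).castAdd 2)

end gadget

/-- The instance of a piece: the edges inside `B ∖ A`, with two new vertices that are joined to the
ports. The vertices outside the piece are tied to a port. -/
noncomputable def gadget (G : CostGraph) (s t : G.Vert) (A B : Finset G.Vert) : CostGraph where
  n := G.n + 2
  m := G.m + (5 + (G.n + (G.n + G.n)))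
  ends := Fin.append (gadget.realEnds G A B) (Fin.append (gadget.linkEnds G s t A B)
    -- Three parallel copies, so that no cut with two edges separates a vertex outside the piece
    -- from its port.
    (Fin.append (gadget.pendEnds G s A B)
      (Fin.append (gadget.pendEnds G s A B) (gadget.pendEnds G s A B))))
  cost := Fin.append G.cost fun _ => 0

namespace gadget

variable {A B : Finset G.Vert}

/-- A vertex of `G`. -/
def old (s t : G.Vert) (A B : Finset G.Vert) (v : G.Vert) : (G.gadget s t A B).Vert :=
  Fin.castAdd 2 v

/-- The new source. -/
def src (s t : G.Vert) (A B : Finset G.Vert) : (G.gadget s t A B).Vert := Fin.natAdd G.n (0 : Fin 2)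

/-- The new sink. -/
def snk (s t : G.Vert) (A B : Finset G.Vert) : (G.gadget s t A B).Vert := Fin.natAdd G.n (1 : Fin 2)

/-- An edge of `G`. -/
def real (s t : G.Vert) (A B : Finset G.Vert) (e : G.Edge) : (G.gadget s t A B).Edge :=
  Fin.castAdd (5 + (G.n + (G.n + G.n))) e

/-- A link to or between the ports. -/
def link (s t : G.Vert) (A B : Finset G.Vert) (i : Fin 5) : (G.gadget s t A B).Edge :=
  Fin.natAdd G.m (Fin.castAdd (G.n + (G.n + G.n)) i)

/-- An edge that ties a vertex outside the piece to a port, first copy. -/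
def pend₁ (s t : G.Vert) (A B : Finset G.Vert) (v : G.Vert) : (G.gadget s t A B).Edge :=
  Fin.natAdd G.m (Fin.natAdd 5 (Fin.castAdd (G.n + G.n) v))

/-- An edge that ties a vertex outside the piece to a port, second copy. -/
def pend₂ (s t : G.Vert) (A B : Finset G.Vert) (v : G.Vert) : (G.gadget s t A B).Edge :=
  Fin.natAdd G.m (Fin.natAdd 5 (Fin.natAdd G.n (Fin.castAdd G.n v)))

/-- An edge that ties a vertex outside the piece to a port, third copy. -/
def pend₃ (s t : G.Vert) (A B : Finset G.Vert) (v : G.Vert) : (G.gadget s t A B).Edge :=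
  Fin.natAdd G.m (Fin.natAdd 5 (Fin.natAdd G.n (Fin.natAdd G.n v)))

theorem vert_cases {p : (G.gadget s t A B).Vert → Prop} (h₁ : ∀ v, p (old s t A B v))
    (h₂ : p (src s t A B)) (h₃ : p (snk s t A B)) (v) : p v :=
  Fin.addCases (m := G.n) (n := 2) (motive := p) h₁ (fun i => by
    match i with
    | 0 => exact h₂
    | 1 => exact h₃) v

theorem edge_cases {p : (G.gadget s t A B).Edge → Prop} (h₁ : ∀ e, p (real s t A B e))
    (h₂ : ∀ i, p (link s t A B i)) (h₃ : ∀ v, p (pend₁ s t A B v)) (h₄ : ∀ v, p (pend₂ s t A B v))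
    (h₅ : ∀ v, p (pend₃ s t A B v)) (e) : p e :=
  Fin.addCases (m := G.m) (motive := p) h₁ (fun i =>
    Fin.addCases (m := 5) (motive := fun i => p (Fin.natAdd G.m i)) h₂ (fun i =>
      Fin.addCases (m := G.n) (motive := fun i => p (Fin.natAdd G.m (Fin.natAdd 5 i))) h₃ (fun i =>
        Fin.addCases (m := G.n)
          (motive := fun i => p (Fin.natAdd G.m (Fin.natAdd 5 (Fin.natAdd G.n i)))) h₄ h₅ i) i) i) e

theorem sum_edges {M : Type} [AddCommMonoid M] (f : (G.gadget s t A B).Edge → M) :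
    ∑ e, f e = ∑ e, f (real s t A B e) + (∑ i, f (link s t A B i) +
      (∑ v, f (pend₁ s t A B v) + (∑ v, f (pend₂ s t A B v) + ∑ v, f (pend₃ s t A B v)))) := by
  refine (Fin.sum_univ_add (a := G.m) (b := 5 + (G.n + (G.n + G.n))) f).trans ?_
  rw [Fin.sum_univ_add, Fin.sum_univ_add, Fin.sum_univ_add]
  rfl

theorem old_injective : Function.Injective (old s t A B) := Fin.castAdd_injective _ _

theorem old_ne_src (v : G.Vert) : old s t A B v ≠ src s t A B := by
  intro h
  have : (v : ℕ) = G.n + 0 := congrArg (fun x : Fin (G.n + 2) => (x : ℕ)) h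
  omega

theorem old_ne_snk (v : G.Vert) : old s t A B v ≠ snk s t A B := by
  intro h
  have : (v : ℕ) = G.n + 1 := congrArg (fun x : Fin (G.n + 2) => (x : ℕ)) h
  omega

theorem src_ne_snk : src s t A B ≠ snk s t A B := by
  intro h
  have : G.n + 0 = G.n + 1 := congrArg (fun x : Fin (G.n + 2) => (x : ℕ)) h
  omega

theorem ends_real (e : G.Edge) : (G.gadget s t A B).ends (real s t A B e) =
    if (G.ends e).1 ∈ B \ A ∧ (G.ends e).2 ∈ B \ A then
      (old s t A B (G.ends e).1, old s t A B (G.ends e).2)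
    else (old s t A B (G.ends e).1, old s t A B (G.ends e).1) :=
  Fin.append_left (realEnds G A B) _ e

open scoped Classical in
theorem ends_link (i : Fin 5) : (G.gadget s t A B).ends (link s t A B i) =
    (![(src s t A B, old s t A B (G.port₁ A (B \ A) s)),
      (src s t A B, old s t A B (G.port₂ A (B \ A) s)),
      (snk s t A B, old s t A B (G.port₁ Bᶜ (B \ A) t)),
      (snk s t A B, old s t A B (G.port₂ Bᶜ (B \ A) t)),
      (old s t A B (G.port₁ A (B \ A) s),
        old s t A B (if G.Shared A B then G.port₁ Bᶜ (B \ A) t else G.port₁ A (B \ A) s))] :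
      Fin 5 → (G.gadget s t A B).Vert × (G.gadget s t A B).Vert) i :=
  (Fin.append_right (realEnds G A B) _ _).trans (Fin.append_left (linkEnds G s t A B) _ i)

theorem ends_pend₁ (v : G.Vert) : (G.gadget s t A B).ends (pend₁ s t A B v) =
    (old s t A B v, old s t A B (if v ∈ B \ A then v else G.port₁ A (B \ A) s)) :=
  (Fin.append_right (realEnds G A B) _ _).trans ((Fin.append_right (linkEnds G s t A B) _ _).trans
    (Fin.append_left (pendEnds G s A B) _ v))

theorem ends_pend₂ (v : G.Vert) : (G.gadget s t A B).ends (pend₂ s t A B v) =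
    (old s t A B v, old s t A B (if v ∈ B \ A then v else G.port₁ A (B \ A) s)) :=
  (Fin.append_right (realEnds G A B) _ _).trans ((Fin.append_right (linkEnds G s t A B) _ _).trans
    ((Fin.append_right (pendEnds G s A B) _ _).trans (Fin.append_left (pendEnds G s A B) _ v)))

theorem ends_pend₃ (v : G.Vert) : (G.gadget s t A B).ends (pend₃ s t A B v) =
    (old s t A B v, old s t A B (if v ∈ B \ A then v else G.port₁ A (B \ A) s)) :=
  (Fin.append_right (realEnds G A B) _ _).trans ((Fin.append_right (linkEnds G s t A B) _ _).trans
    ((Fin.append_right (pendEnds G s A B) _ _).trans (Fin.append_right (pendEnds G s A B) _ v)))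

theorem cost_real (e : G.Edge) : (G.gadget s t A B).cost (real s t A B e) = G.cost e :=
  Fin.append_left G.cost (fun _ : Fin (5 + (G.n + (G.n + G.n))) => 0) e

theorem cost_link (i : Fin 5) : (G.gadget s t A B).cost (link s t A B i) = 0 :=
  Fin.append_right G.cost (fun _ => 0) _

theorem cost_pend₁ (v : G.Vert) : (G.gadget s t A B).cost (pend₁ s t A B v) = 0 :=
  Fin.append_right G.cost (fun _ => 0) _

theorem cost_pend₂ (v : G.Vert) : (G.gadget s t A B).cost (pend₂ s t A B v) = 0 :=
  Fin.append_right G.cost (fun _ => 0) _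

theorem cost_pend₃ (v : G.Vert) : (G.gadget s t A B).cost (pend₃ s t A B v) = 0 :=
  Fin.append_right G.cost (fun _ => 0) _

/-- Vertices of the piece on the side `X`. -/
noncomputable def trace (X : Finset (G.gadget s t A B).Vert) : Finset G.Vert :=
  (B \ A).filter fun v => old s t A B v ∈ X

/-- Edges of `G` in a set of edges of the gadget. -/
noncomputable def realPart (S : Finset (G.gadget s t A B).Edge) : Finset G.Edge :=
  Finset.univ.filter fun e => real s t A B e ∈ S

theorem mem_trace {X : Finset (G.gadget s t A B).Vert} {v : G.Vert} :
    v ∈ trace X ↔ v ∈ B \ A ∧ old s t A B v ∈ X := by simp [trace]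

theorem mem_realPart {S : Finset (G.gadget s t A B).Edge} {e : G.Edge} :
    e ∈ realPart S ↔ real s t A B e ∈ S := by simp [realPart]

theorem _root_.sum_ite_mem_univ {ι M : Type} [Fintype ι] [DecidableEq ι] [AddCommMonoid M]
    (s : Finset ι) (f : ι → M) : (∑ i, if i ∈ s then f i else 0) = ∑ i ∈ s, f i := by
  rw [← Finset.sum_filter, Finset.filter_mem_eq_inter, Finset.univ_inter]

theorem cr_real (X : Finset (G.gadget s t A B).Vert) (e : G.Edge) :
    (G.gadget s t A B).cr X (real s t A B e) =
      if (G.ends e).1 ∈ B \ A ∧ (G.ends e).2 ∈ B \ A then G.cr (trace X) e else 0 := by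
  rw [cr, ends_real]
  by_cases h : (G.ends e).1 ∈ B \ A ∧ (G.ends e).2 ∈ B \ A
  · rw [if_pos h, if_pos h, cr]
    simp only [mem_trace, h.1, h.2, true_and]
  · rw [if_neg h, if_neg h, if_pos Iff.rfl]

theorem card_cut_eq (S : Finset (G.gadget s t A B).Edge) (X : Finset (G.gadget s t A B).Vert) :
    ((G.gadget s t A B).cut S X).card = G.inner (realPart S) (B \ A) (trace X) +
      ((∑ i, if link s t A B i ∈ S then (G.gadget s t A B).cr X (link s t A B i) else 0) +
      ((∑ v, if pend₁ s t A B v ∈ S then (G.gadget s t A B).cr X (pend₁ s t A B v) else 0) +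
      ((∑ v, if pend₂ s t A B v ∈ S then (G.gadget s t A B).cr X (pend₂ s t A B v) else 0) +
      (∑ v, if pend₃ s t A B v ∈ S then (G.gadget s t A B).cr X (pend₃ s t A B v) else 0)))) := by
  rw [card_cut, ← sum_ite_mem_univ, sum_edges]
  congr 1
  rw [inner, realPart, Finset.sum_filter]
  refine Finset.sum_congr rfl fun e _ => ?_
  by_cases he : real s t A B e ∈ S
  · rw [if_pos he, if_pos he, cr_real]
  · rw [if_neg he, if_neg he]

/-- The links to the ports that cross `X`. -/
theorem sum_links (X : Finset (G.gadget s t A B).Vert) [Decidable (G.Shared A B)] :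
    ∑ i, (G.gadget s t A B).cr X (link s t A B i) =
      sep X (src s t A B) (old s t A B (G.port₁ A (B \ A) s)) +
      sep X (src s t A B) (old s t A B (G.port₂ A (B \ A) s)) +
      sep X (snk s t A B) (old s t A B (G.port₁ Bᶜ (B \ A) t)) +
      sep X (snk s t A B) (old s t A B (G.port₂ Bᶜ (B \ A) t)) +
      if G.Shared A B then
        sep X (old s t A B (G.port₁ A (B \ A) s)) (old s t A B (G.port₁ Bᶜ (B \ A) t)) else 0 := by
  simp only [Fin.sum_univ_five, cr, ends_link, sep]
  by_cases h : G.Shared A B <;> simp [h]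

/-- The terminals of the gadget. -/
noncomputable def terminals (G : CostGraph) (s t : G.Vert) (A B : Finset G.Vert) :
    Finset (G.gadget s t A B).Vert :=
  {old s t A B (G.port₁ A (B \ A) s), old s t A B (G.port₂ A (B \ A) s),
    old s t A B (G.port₁ Bᶜ (B \ A) t), old s t A B (G.port₂ Bᶜ (B \ A) t)}

theorem mem_terminals {v : (G.gadget s t A B).Vert} :
    v ∈ terminals G s t A B ↔ ∃ u ∈ G.pieceTerminals s t A B, v = old s t A B u := by
  simp [terminals, pieceTerminals]

/-- The solution of the gadget that belongs to a set of edges of `G`. -/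
noncomputable def lift (s t : G.Vert) (A B : Finset G.Vert) (H : Finset G.Edge) :
    Finset (G.gadget s t A B).Edge :=
  Finset.univ \ (Finset.univ.filter fun e =>
    ¬(e ∈ H ∧ (G.ends e).1 ∈ B \ A ∧ (G.ends e).2 ∈ B \ A)).image (real s t A B)

theorem real_injective : Function.Injective (real s t A B) := Fin.castAdd_injective _ _

theorem real_ne {e : G.Edge} {f : (G.gadget s t A B).Edge} (h : G.m ≤ f.val) :
    real s t A B e ≠ f := by
  intro h'
  have : (e : ℕ) = f.val := congrArg Fin.val h'
  have := e.isLt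
  omega

theorem real_mem_lift {H : Finset G.Edge} {e : G.Edge} : real s t A B e ∈ lift s t A B H ↔
    e ∈ H ∧ (G.ends e).1 ∈ B \ A ∧ (G.ends e).2 ∈ B \ A := by
  simp only [lift, Finset.mem_sdiff, Finset.mem_univ, true_and, Finset.mem_image,
    Finset.mem_filter, real_injective.eq_iff, exists_eq_right, not_not]

theorem mem_lift_of_le {H : Finset G.Edge} {f : (G.gadget s t A B).Edge} (h : G.m ≤ f.val) :
    f ∈ lift s t A B H := by
  simp only [lift, Finset.mem_sdiff, Finset.mem_univ, true_and, Finset.mem_image, not_exists, not_and]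
  exact fun e _ => real_ne h

theorem link_mem_lift {H : Finset G.Edge} (i : Fin 5) : link s t A B i ∈ lift s t A B H :=
  mem_lift_of_le (Nat.le_add_right _ _)

/-- All edges that are not edges of the original graph are free, and the lift drops the ones turned
into loops. -/
theorem totalCost_lift (H : Finset G.Edge) : (G.gadget s t A B).totalCost (lift s t A B H) =
    G.totalCost (H.filter fun e => (G.ends e).1 ∈ B \ A ∧ (G.ends e).2 ∈ B \ A) := by
  rw [totalCost, ← sum_ite_mem_univ, sum_edges]
  simp only [cost_link, cost_pend₁, cost_pend₂, cost_pend₃, ite_self, Finset.sum_const_zero,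
    add_zero, cost_real, real_mem_lift]
  conv_rhs => rw [totalCost, ← sum_ite_mem_univ]
  refine Finset.sum_congr rfl fun e _ => ?_
  simp only [Finset.mem_filter]

theorem totalCost_realPart_le (S : Finset (G.gadget s t A B).Edge) :
    G.totalCost (realPart S) ≤ (G.gadget s t A B).totalCost S := by
  rw [totalCost, totalCost, ← sum_ite_mem_univ (s := S), sum_edges, realPart,
    Finset.sum_filter]
  simp only [cost_real]
  exact le_add_of_nonneg_right zero_le

theorem inner_lift (H : Finset G.Edge) (Y : Finset G.Vert) :
    G.inner (realPart (lift s t A B H)) (B \ A) Y = G.inner H (B \ A) Y := by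
  rw [inner, inner, ← Finset.sum_filter, ← Finset.sum_filter]
  refine Finset.sum_congr ?_ fun _ _ => rfl
  ext e
  simp only [Finset.mem_filter, mem_realPart, real_mem_lift]
  tauto

/-- Feasible solutions of the gadget solve the piece. -/
theorem solves (h : G.Piece s t A B) {S : Finset (G.gadget s t A B).Edge}
    (hS : (G.gadget s t A B).EdgeConnectedSubset S 3 (terminals G s t A B)) :
    G.Solves s t (realPart S) A B := by
  classical
  intro Y hY ⟨u, hu, huY⟩ ⟨v, hv, hvY⟩
  have ha₁ : G.port₁ A (B \ A) s ∈ B \ A := h.port_mem (by simp [pieceTerminals])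
  -- Extend `Y` so that as few new edges as possible cross: each new vertex joins the side of its
  -- first port, and the vertices outside the piece join the port they are tied to. Then only the
  -- links counted in `linked` can cross.
  let X : Finset (G.gadget s t A B).Vert :=
    (Y ∪ if G.port₁ A (B \ A) s ∈ Y then (B \ A)ᶜ else ∅).image (old s t A B) ∪
      ((if G.port₁ A (B \ A) s ∈ Y then {src s t A B} else ∅) ∪
        if G.port₁ Bᶜ (B \ A) t ∈ Y then {snk s t A B} else ∅)
  have hold : ∀ v, old s t A B v ∈ X ↔ v ∈ Y ∨ (v ∉ B \ A ∧ G.port₁ A (B \ A) s ∈ Y) := by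
    intro v
    simp only [X, Finset.mem_union, Finset.mem_image, old_injective.eq_iff, exists_eq_right]
    split_ifs <;> simp_all [old_ne_src, old_ne_snk]
  have hold' : ∀ v ∈ B \ A, (old s t A B v ∈ X ↔ v ∈ Y) := fun v hv => by rw [hold]; simp [hv]
  have hsrc : src s t A B ∈ X ↔ G.port₁ A (B \ A) s ∈ Y := by
    simp only [X, Finset.mem_union, Finset.mem_image]
    split_ifs <;> simp_all [old_ne_src, src_ne_snk]
  have hsnk : snk s t A B ∈ X ↔ G.port₁ Bᶜ (B \ A) t ∈ Y := by
    simp only [X, Finset.mem_union, Finset.mem_image]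
    split_ifs <;> simp_all [old_ne_snk, src_ne_snk.symm]
  have htr : trace X = Y := by
    ext v
    rw [mem_trace]
    constructor
    · exact fun h => (hold' v h.1).1 h.2
    · exact fun h => ⟨hY h, (hold' v (hY h)).2 h⟩
  have h1 := edgeConnectedSubset_iff.1 hS X _ (mem_terminals.2 ⟨u, hu, rfl⟩) _
    (mem_terminals.2 ⟨v, hv, rfl⟩) ((hold' u (hY huY)).2 huY)
    (fun h' => hvY ((hold' v (h.port_mem hv)).1 h'))
  have hpend : ∀ v, sep X (old s t A B v) (old s t A B (if v ∈ B \ A then v else G.port₁ A (B \ A) s)) = 0 := by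
    intro v
    by_cases hv : v ∈ B \ A
    · simp [sep, hv]
    · have hvY : v ∉ Y := fun h => hv (hY h)
      rw [if_neg hv]
      simp only [sep, hold' _ ha₁, hold, hv, hvY, not_false_eq_true, true_and, false_or,
        if_true]
  have hp₁ : ∀ v, (G.gadget s t A B).cr X (pend₁ s t A B v) = 0 := fun v => by
    rw [cr, ends_pend₁]; exact hpend v
  have hp₂ : ∀ v, (G.gadget s t A B).cr X (pend₂ s t A B v) = 0 := fun v => by
    rw [cr, ends_pend₂]; exact hpend v
  have hp₃ : ∀ v, (G.gadget s t A B).cr X (pend₃ s t A B v) = 0 := fun v => by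
    rw [cr, ends_pend₃]; exact hpend v
  rw [card_cut_eq, htr] at h1
  simp only [hp₁, hp₂, hp₃, ite_self, Finset.sum_const_zero, add_zero] at h1
  have h2 : (∑ i, if link s t A B i ∈ S then (G.gadget s t A B).cr X (link s t A B i) else 0) ≤
      ∑ i, (G.gadget s t A B).cr X (link s t A B i) :=
    Finset.sum_le_sum fun i _ => by split_ifs <;> omega
  rw [sum_links] at h2
  have ha₂ : G.port₂ A (B \ A) s ∈ B \ A := h.port_mem (by simp [pieceTerminals])
  have hb₁ : G.port₁ Bᶜ (B \ A) t ∈ B \ A := h.port_mem (by simp [pieceTerminals])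
  have hb₂ : G.port₂ Bᶜ (B \ A) t ∈ B \ A := h.port_mem (by simp [pieceTerminals])
  simp only [sep, hsrc, hsnk, hold' _ ha₁, hold' _ ha₂, hold' _ hb₁, hold' _ hb₂, iff_self,
    if_true] at h2
  unfold linked sep
  omega

/-- Solutions of the piece are feasible for the gadget. -/
theorem edgeConnectedSubset_lift (h : G.Piece s t A B) {H : Finset G.Edge}
    (hS : G.Solves s t H A B) :
    (G.gadget s t A B).EdgeConnectedSubset (lift s t A B H) 3 (terminals G s t A B) := by
  classical
  rw [edgeConnectedSubset_iff]
  intro X u hu v hv huX hvX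
  obtain ⟨u, hu', rfl⟩ := mem_terminals.1 hu
  obtain ⟨v, hv', rfl⟩ := mem_terminals.1 hv
  have hold : ∀ v ∈ B \ A, (old s t A B v ∈ X ↔ v ∈ trace X) := fun v hv => by
    rw [mem_trace]; simp only [hv, true_and]
  have h1 := hS (trace X) (Finset.filter_subset _ _) ⟨u, hu', (hold u (h.port_mem hu')).1 huX⟩
    ⟨v, hv', fun h' => hvX ((hold v (h.port_mem hv')).2 h')⟩
  rw [card_cut_eq, inner_lift]
  simp only [link_mem_lift, if_true]
  rw [sum_links]
  have ha₁ : G.port₁ A (B \ A) s ∈ B \ A := h.port_mem (by simp [pieceTerminals])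
  have ha₂ : G.port₂ A (B \ A) s ∈ B \ A := h.port_mem (by simp [pieceTerminals])
  have hb₁ : G.port₁ Bᶜ (B \ A) t ∈ B \ A := h.port_mem (by simp [pieceTerminals])
  have hb₂ : G.port₂ Bᶜ (B \ A) t ∈ B \ A := h.port_mem (by simp [pieceTerminals])
  -- Wherever the new vertices lie, the paths through them cross `X` at least as often as the links
  -- that they stand for.
  have htri : ∀ x y z, sep X y z ≤ sep X x y + sep X x z := by
    intro x y z
    unfold sep
    by_cases h1 : x ∈ X <;> by_cases h2 : y ∈ X <;> by_cases h3 : z ∈ X <;> simp [h1, h2, h3]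
  have h2 := htri (src s t A B) (old s t A B (G.port₁ A (B \ A) s)) (old s t A B (G.port₂ A (B \ A) s))
  have h3 := htri (snk s t A B) (old s t A B (G.port₁ Bᶜ (B \ A) t)) (old s t A B (G.port₂ Bᶜ (B \ A) t))
  have hsep : ∀ x ∈ B \ A, ∀ y ∈ B \ A, sep (trace X) x y = sep X (old s t A B x) (old s t A B y) :=
    fun x hx y hy => by simp only [sep, hold x hx, hold y hy]
  unfold linked at h1
  rw [hsep _ ha₁ _ ha₂, hsep _ hb₁ _ hb₂, hsep _ ha₁ _ hb₁] at h1
  omega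

end gadget

end CostGraph

/-! ### The gadget is a special instance -/

namespace CostGraph

variable {G : CostGraph} {s t : G.Vert} {A B : Finset G.Vert}

namespace gadget

theorem card_cut_univ (X : Finset (G.gadget s t A B).Vert) :
    ((G.gadget s t A B).cut Finset.univ X).card = G.inner Finset.univ (B \ A) (trace X) +
      (∑ i, (G.gadget s t A B).cr X (link s t A B i) +
      3 * ∑ v, sep X (old s t A B v)
        (old s t A B (if v ∈ B \ A then v else G.port₁ A (B \ A) s))) := by
  rw [card_cut_eq]
  have h1 : ∀ v, (G.gadget s t A B).cr X (pend₁ s t A B v) = sep X (old s t A B v)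
      (old s t A B (if v ∈ B \ A then v else G.port₁ A (B \ A) s)) := fun v => by
    rw [cr, ends_pend₁]; rfl
  have h2 : ∀ v, (G.gadget s t A B).cr X (pend₂ s t A B v) = sep X (old s t A B v)
      (old s t A B (if v ∈ B \ A then v else G.port₁ A (B \ A) s)) := fun v => by
    rw [cr, ends_pend₂]; rfl
  have h3 : ∀ v, (G.gadget s t A B).cr X (pend₃ s t A B v) = sep X (old s t A B v)
      (old s t A B (if v ∈ B \ A then v else G.port₁ A (B \ A) s)) := fun v => by
    rw [cr, ends_pend₃]; rfl
  have h4 : G.inner (realPart (Finset.univ : Finset (G.gadget s t A B).Edge)) (B \ A) (trace X) =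
      G.inner Finset.univ (B \ A) (trace X) := by
    rw [realPart]
    simp only [Finset.mem_univ, Finset.filter_true]
  simp only [Finset.mem_univ, if_true, h1, h2, h3, h4]
  omega

theorem inner_empty (H : Finset G.Edge) (D : Finset G.Vert) : G.inner H D ∅ = 0 := by
  simp [inner, cr]

theorem trace_eq_empty {X : Finset (G.gadget s t A B).Vert} (h : ∀ v, old s t A B v ∉ X) :
    trace X = ∅ := by
  ext v
  simp [mem_trace, h]

theorem card_cut_src : ((G.gadget s t A B).cut Finset.univ {src s t A B}).card = 2 := by
  classical
  have h : ∀ v, old s t A B v ∉ ({src s t A B} : Finset _) := fun v => by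
    rw [Finset.mem_singleton]; exact old_ne_src v
  have h' : snk s t A B ∉ ({src s t A B} : Finset _) := by
    rw [Finset.mem_singleton]; exact src_ne_snk.symm
  rw [card_cut_univ, trace_eq_empty h, inner_empty, sum_links]
  simp [sep, h, h']

theorem card_cut_snk : ((G.gadget s t A B).cut Finset.univ {snk s t A B}).card = 2 := by
  classical
  have h : ∀ v, old s t A B v ∉ ({snk s t A B} : Finset _) := fun v => by
    rw [Finset.mem_singleton]; exact old_ne_snk v
  rw [card_cut_univ, trace_eq_empty h, inner_empty, sum_links]
  simp [sep, old_ne_snk, src_ne_snk]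

theorem ends_snd (e : (G.gadget s t A B).Edge) :
    ∃ w, ((G.gadget s t A B).ends e).2 = old s t A B w := by
  induction e using edge_cases with
  | h₁ e => rw [ends_real]; split_ifs <;> exact ⟨_, rfl⟩
  | h₂ i => rw [ends_link]; fin_cases i <;> exact ⟨_, rfl⟩
  | h₃ v => rw [ends_pend₁]; exact ⟨_, rfl⟩
  | h₄ v => rw [ends_pend₂]; exact ⟨_, rfl⟩
  | h₅ v => rw [ends_pend₃]; exact ⟨_, rfl⟩

theorem ends_fst (e : (G.gadget s t A B).Edge) :
    (∃ w, ((G.gadget s t A B).ends e).1 = old s t A B w) ∨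
    ((G.gadget s t A B).cost e = 0 ∧
      ((G.gadget s t A B).ends e = (src s t A B, old s t A B (G.port₁ A (B \ A) s)) ∨
      (G.gadget s t A B).ends e = (src s t A B, old s t A B (G.port₂ A (B \ A) s)) ∨
      (G.gadget s t A B).ends e = (snk s t A B, old s t A B (G.port₁ Bᶜ (B \ A) t)) ∨
      (G.gadget s t A B).ends e = (snk s t A B, old s t A B (G.port₂ Bᶜ (B \ A) t)))) := by
  induction e using edge_cases with
  | h₁ e => left; rw [ends_real]; split_ifs <;> exact ⟨_, rfl⟩
  | h₂ i =>
    rw [ends_link, cost_link]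
    fin_cases i
    · exact Or.inr ⟨rfl, Or.inl rfl⟩
    · exact Or.inr ⟨rfl, Or.inr (Or.inl rfl)⟩
    · exact Or.inr ⟨rfl, Or.inr (Or.inr (Or.inl rfl))⟩
    · exact Or.inr ⟨rfl, Or.inr (Or.inr (Or.inr rfl))⟩
    · exact Or.inl ⟨_, rfl⟩
  | h₃ v => left; rw [ends_pend₁]; exact ⟨_, rfl⟩
  | h₄ v => left; rw [ends_pend₂]; exact ⟨_, rfl⟩
  | h₅ v => left; rw [ends_pend₃]; exact ⟨_, rfl⟩

theorem joins_src {v : (G.gadget s t A B).Vert} :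
    (∃ e, (G.gadget s t A B).Joins e (src s t A B) v) ↔
      v = old s t A B (G.port₁ A (B \ A) s) ∨ v = old s t A B (G.port₂ A (B \ A) s) := by
  classical
  constructor
  · rintro ⟨e, he | he⟩
    · rcases ends_fst e with ⟨w, hw⟩ | ⟨-, h | h | h | h⟩
      · rw [he] at hw; exact absurd hw.symm (old_ne_src w)
      · rw [h] at he; exact Or.inl (congrArg Prod.snd he).symm
      · rw [h] at he; exact Or.inr (congrArg Prod.snd he).symm
      · rw [h] at he; exact absurd (congrArg Prod.fst he).symm src_ne_snk
      · rw [h] at he; exact absurd (congrArg Prod.fst he).symm src_ne_snk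
    · obtain ⟨w, hw⟩ := ends_snd e
      rw [he] at hw; exact absurd hw.symm (old_ne_src w)
  · rintro (rfl | rfl)
    · exact ⟨link s t A B 0, Or.inl (ends_link 0)⟩
    · exact ⟨link s t A B 1, Or.inl (ends_link 1)⟩

theorem joins_snk {v : (G.gadget s t A B).Vert} :
    (∃ e, (G.gadget s t A B).Joins e (snk s t A B) v) ↔
      v = old s t A B (G.port₁ Bᶜ (B \ A) t) ∨ v = old s t A B (G.port₂ Bᶜ (B \ A) t) := by
  classical
  constructor
  · rintro ⟨e, he | he⟩
    · rcases ends_fst e with ⟨w, hw⟩ | ⟨-, h | h | h | h⟩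
      · rw [he] at hw; exact absurd hw.symm (old_ne_snk w)
      · rw [h] at he; exact absurd (congrArg Prod.fst he) src_ne_snk
      · rw [h] at he; exact absurd (congrArg Prod.fst he) src_ne_snk
      · rw [h] at he; exact Or.inl (congrArg Prod.snd he).symm
      · rw [h] at he; exact Or.inr (congrArg Prod.snd he).symm
    · obtain ⟨w, hw⟩ := ends_snd e
      rw [he] at hw; exact absurd hw.symm (old_ne_snk w)
  · rintro (rfl | rfl)
    · exact ⟨link s t A B 2, Or.inl (ends_link 2)⟩
    · exact ⟨link s t A B 3, Or.inl (ends_link 3)⟩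

/-- The only small cuts of the gadget are those of the new vertices. -/
theorem eq_of_card_cut_eq_two (h : G.Piece s t A B) {X : Finset (G.gadget s t A B).Vert}
    (hs : src s t A B ∈ X) (ht : snk s t A B ∉ X)
    (h2 : ((G.gadget s t A B).cut Finset.univ X).card = 2) :
    X = {src s t A B} ∨ X = Finset.univ \ {snk s t A B} := by
  classical
  rw [card_cut_univ, sum_links] at h2
  have ha₁ : G.port₁ A (B \ A) s ∈ B \ A := h.port_mem (by simp [pieceTerminals])
  have ha₂ : G.port₂ A (B \ A) s ∈ B \ A := h.port_mem (by simp [pieceTerminals])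
  have hb₁ : G.port₁ Bᶜ (B \ A) t ∈ B \ A := h.port_mem (by simp [pieceTerminals])
  have hb₂ : G.port₂ Bᶜ (B \ A) t ∈ B \ A := h.port_mem (by simp [pieceTerminals])
  have hpend : ∀ v ∉ B \ A, (old s t A B v ∈ X ↔ old s t A B (G.port₁ A (B \ A) s) ∈ X) := by
    intro v hv
    -- The tying edges come in threes, so a cut with two edges contains none of them.
    have h0 : ∑ v, sep X (old s t A B v)
        (old s t A B (if v ∈ B \ A then v else G.port₁ A (B \ A) s)) = 0 := by omega
    have h1 := Finset.sum_eq_zero_iff.1 h0 v (Finset.mem_univ v)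
    rw [if_neg hv] at h1
    unfold sep at h1
    by_contra hne
    rw [if_neg hne] at h1
    omega
  have hold : ∀ v ∈ B \ A, (old s t A B v ∈ X ↔ v ∈ trace X) := fun v hv => by
    rw [mem_trace]; simp only [hv, true_and]
  have hY : trace X ⊆ B \ A := Finset.filter_subset _ _
  -- With the new source inside and the new sink outside, the links count exactly the ports on the
  -- costly sides. In the shared case first and last port agree, and the edge between the ports adds
  -- at most what the weight 2 allows.
  have hphi : G.phi s t Finset.univ (A ∪ trace X) ≤ 2 := by
    simp only [sep, hs, ht, hold _ ha₁, hold _ ha₂, hold _ hb₁, hold _ hb₂, true_iff,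
      false_iff] at h2
    rcases h.phi_union (Finset.subset_univ _) (Finset.subset_univ _) hY with
      ⟨hS, hp, hq, hf⟩ | ⟨hS, hf⟩
    · rw [hf]
      rw [← hp, ← hq, if_pos hS] at h2
      by_cases c1 : G.port₁ A (B \ A) s ∈ trace X <;> by_cases c2 : G.port₁ Bᶜ (B \ A) t ∈ trace X <;>
        simp only [c1, c2, if_true, if_false, iff_true, iff_false, not_true, not_false_eq_true] at h2 ⊢ <;>
        omega
    · rw [hf]
      rw [if_neg hS] at h2
      simp only [ite_not] at h2
      omega
  have hT : G.Tight s t (A ∪ trace X) :=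
    ⟨Finset.union_subset h.tightA.subset ((hY.trans Finset.sdiff_subset).trans h.tightB.subset),
      le_antisymm hphi (two_le_phi h.reach _)⟩
  rcases h.eq_or_eq _ hT Finset.subset_union_left
    (Finset.union_subset h.ssubset.subset (hY.trans Finset.sdiff_subset)) with hA | hB
  · left
    have hnot : ∀ v ∈ B \ A, old s t A B v ∉ X := fun v hv hvX => by
      have : v ∈ A := hA ▸ Finset.mem_union_right A ((hold v hv).1 hvX)
      exact (Finset.mem_sdiff.1 hv).2 this
    ext v
    rw [Finset.mem_singleton]
    induction v using vert_cases with
    | h₁ v =>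
      refine iff_of_false ?_ (old_ne_src v)
      by_cases hv : v ∈ B \ A
      · exact hnot v hv
      · rw [hpend v hv]; exact hnot _ ha₁
    | h₂ => exact iff_of_true hs rfl
    | h₃ => exact iff_of_false ht src_ne_snk.symm
  · right
    have hall : ∀ v ∈ B \ A, old s t A B v ∈ X := fun v hv => by
      have h1 : v ∈ A ∪ trace X := by rw [hB]; exact (Finset.mem_sdiff.1 hv).1
      rcases Finset.mem_union.1 h1 with h1 | h1
      · exact absurd h1 (Finset.mem_sdiff.1 hv).2
      · exact (hold v hv).2 h1
    ext v
    simp only [Finset.mem_sdiff, Finset.mem_univ, true_and, Finset.mem_singleton]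
    induction v using vert_cases with
    | h₁ v =>
      refine iff_of_true ?_ (old_ne_snk v)
      by_cases hv : v ∈ B \ A
      · exact hall v hv
      · rw [hpend v hv]; exact hall _ ha₁
    | h₂ => exact iff_of_true hs src_ne_snk
    | h₃ => exact iff_of_false ht (not_not.2 rfl)

/-- The gadget as an instance of 3-Subset 3-EC. -/
noncomputable def inst (G : CostGraph) (s t : G.Vert) (A B : Finset G.Vert) : SubsetInstance where
  J := G.gadget s t A B
  R := terminals G s t A B
  card_le := Finset.card_le_four

theorem mem_terminals_iff {v : (G.gadget s t A B).Vert} : v ∈ terminals G s t A B ↔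
    (v ≠ src s t A B ∧ ∃ e, (G.gadget s t A B).Joins e (src s t A B) v) ∨
      (v ≠ snk s t A B ∧ ∃ e, (G.gadget s t A B).Joins e (snk s t A B) v) := by
  rw [joins_src, joins_snk]
  simp only [terminals, Finset.mem_insert, Finset.mem_singleton]
  constructor
  · rintro (rfl | rfl | rfl | rfl)
    · exact Or.inl ⟨old_ne_src _, Or.inl rfl⟩
    · exact Or.inl ⟨old_ne_src _, Or.inr rfl⟩
    · exact Or.inr ⟨old_ne_snk _, Or.inl rfl⟩
    · exact Or.inr ⟨old_ne_snk _, Or.inr rfl⟩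
  · rintro (⟨-, h | h⟩ | ⟨-, h | h⟩) <;> simp [h]

theorem cost_of_mem_cut {e : (G.gadget s t A B).Edge}
    (he : e ∈ (G.gadget s t A B).cut Finset.univ {src s t A B} ∪
      (G.gadget s t A B).cut Finset.univ {snk s t A B}) : (G.gadget s t A B).cost e = 0 := by
  rcases ends_fst e with ⟨w, hw⟩ | ⟨h, -⟩
  · obtain ⟨w', hw'⟩ := ends_snd e
    simp [mem_cut, hw, hw', old_ne_src, old_ne_snk] at he
  · exact h

theorem special (h : G.Piece s t A B) : (inst G s t A B).Special :=
  ⟨src s t A B, snk s t A B, src_ne_snk,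
    ⟨card_cut_src, card_cut_snk, fun _ => mem_terminals_iff⟩,
    fun _ hs ht h2 => eq_of_card_cut_eq_two h hs ht h2, fun _ he => cost_of_mem_cut he⟩

end gadget

end CostGraph

/-! ### Approximation ratios in terms of polynomial-time functions -/

namespace MinProblem

variable (P : MinProblem)

/-- The instances that have a feasible solution. -/
def FeasInst : Type := {I : P.Inst // ∃ S : P.Sol I, P.Feasible I S}

instance : Enc P.FeasInst := ⟨fun I => P.encInst I.1⟩

variable {P} {ρ : ℝ}

/-- Restricting to feasible instances makes the algorithm a total function. It returns a solution as
an object; the program only ever sees its encoding. -/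
theorem AdmitsRatio.exists_polyTime (h : P.AdmitsRatio ρ) :
    ∃ S : ∀ I : P.FeasInst, P.Sol I.1, PolyTime (fun I : P.FeasInst => P.encSol I.1 (S I)) ∧
      ∀ I, P.Feasible I.1 (S I) ∧
        ∀ S', P.Feasible I.1 S' → (P.cost I.1 (S I) : ℝ) ≤ ρ * (P.cost I.1 S' : ℝ) := by
  obtain ⟨c, p, h⟩ := h
  choose S hS hF using fun I : P.FeasInst => h I.1 I.2
  refine ⟨S, ⟨.seq c (.clear c.bound), fun I => p.eval (esize I) + (3 * c.bound + 1),
    (PolyBound.size.eval p).add (.const _), fun I => ?_⟩, hF⟩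
  obtain ⟨τ, k, h1, h2, h3⟩ := hS I
  refine ⟨k + (3 * c.bound + 1), Nat.add_le_add_right h3 _, ?_⟩
  have := Prog.exec_clear_start h1
  rwa [h2] at this

theorem AdmitsRatio.of_polyTime {S : ∀ I : P.FeasInst, P.Sol I.1}
    (hS : PolyTime (fun I : P.FeasInst => P.encSol I.1 (S I)))
    (h : ∀ I, P.Feasible I.1 (S I) ∧
      ∀ S', P.Feasible I.1 S' → (P.cost I.1 (S I) : ℝ) ≤ ρ * (P.cost I.1 S' : ℝ)) :
    P.AdmitsRatio ρ := by
  obtain ⟨c, T, ⟨p, hp⟩, hc⟩ := hS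
  refine ⟨c, p, fun I hI => ⟨S ⟨I, hI⟩, ?_, h ⟨I, hI⟩⟩⟩
  obtain ⟨k, hk, h1⟩ := hc ⟨I, hI⟩
  exact ⟨_, k, h1, rfl, hk.trans (hp ⟨I, hI⟩)⟩

end MinProblem

/-! ### Finite sets and graphs as plain lists -/

/-- The membership bits of a set. -/
def bits {k : ℕ} (S : Finset (Fin k)) : List Bool := List.ofFn fun i => decide (i ∈ S)

theorem enc_bits {k : ℕ} (S : Finset (Fin k)) : Enc.enc (bits S) = Data.ofFinset S := by
  simp only [Enc.enc, bits, Data.ofFinset, List.map_ofFn]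
  rfl

/-- A set of vertices as a list of numbers. -/
noncomputable def toL {n : ℕ} (S : Finset (Fin n)) : List ℕ := by
  classical exact (List.range n).filter fun v => ∃ h : v < n, ⟨v, h⟩ ∈ S

section ToL

variable {n : ℕ} {S T : Finset (Fin n)}

theorem mem_toL {v : ℕ} : v ∈ toL S ↔ ∃ h : v < n, ⟨v, h⟩ ∈ S := by
  simp only [toL, List.mem_filter, List.mem_range, decide_eq_true_eq]
  exact ⟨fun h => h.2, fun h => ⟨h.1, h⟩⟩

theorem val_mem_toL {v : Fin n} : (v : ℕ) ∈ toL S ↔ v ∈ S := by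
  rw [mem_toL]
  exact ⟨fun h => h.2, fun h => ⟨v.isLt, h⟩⟩

theorem toL_subset : (∀ v ∈ toL S, v ∈ toL T) ↔ S ⊆ T :=
  ⟨fun h v hv => val_mem_toL.1 (h v (val_mem_toL.2 hv)), fun h v hv => by
    obtain ⟨h1, h2⟩ := mem_toL.1 hv
    exact mem_toL.2 ⟨h1, h h2⟩⟩

theorem toL_injective : Function.Injective (toL : Finset (Fin n) → List ℕ) := fun _ _ h =>
  (toL_subset.1 fun _ hv => h ▸ hv).antisymm (toL_subset.1 fun _ hv => h ▸ hv)

theorem filter_range_eq_toL {p : ℕ → Bool} (h : ∀ v : Fin n, p v = true ↔ v ∈ S) :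
    (List.range n).filter p = toL S := by
  rw [toL]
  refine List.filter_congr fun v hv => ?_
  rw [Bool.eq_iff_iff, decide_eq_true_eq]
  have hv' := List.mem_range.1 hv
  rw [h ⟨v, hv'⟩]
  exact ⟨fun h => ⟨hv', h⟩, fun h => h.2⟩

end ToL

namespace CostGraph

/-- A graph without dependent types. -/
abbrev Raw : Type := ℕ × List (ℕ × ℕ × ℚ≥0)

/-- The number of vertices and the list of edges. -/
def raw (G : CostGraph) : Raw :=
  (G.n, List.ofFn fun e : G.Edge => (((G.ends e).1 : ℕ), ((G.ends e).2 : ℕ), G.cost e))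

theorem enc_raw (G : CostGraph) : Enc.enc G.raw = G.enc := by
  simp only [Enc.enc, raw, CostGraph.enc, List.map_ofFn]
  rfl

theorem mem_raw {G : CostGraph} {x : ℕ × ℕ × ℚ≥0} : x ∈ G.raw.2 ↔
    ∃ e, (((G.ends e).1 : ℕ), ((G.ends e).2 : ℕ), G.cost e) = x := by
  simp [raw, List.mem_ofFn']

theorem length_raw {G : CostGraph} : G.raw.2.length = G.m := by simp [raw]

theorem getD_raw {G : CostGraph} {d : ℕ × ℕ × ℚ≥0} (e : G.Edge) :
    G.raw.2.getD e d = (((G.ends e).1 : ℕ), ((G.ends e).2 : ℕ), G.cost e) := by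
  have : (e : ℕ) < G.raw.2.length := by rw [length_raw]; exact e.isLt
  rw [List.getD_eq_getElem _ _ this]
  simp [raw]

end CostGraph

instance : Enc SDInstance := ⟨(SDRSND 3).encInst⟩

/-- Increasing iterations become stationary. -/
theorem Finset.iterate_stationary {V : Type} [Fintype V] {F : Finset V → Finset V}
    {S : Finset V} (hF : ∀ k, F^[k] S ⊆ F (F^[k] S)) :
    F (F^[Fintype.card V] S) = F^[Fintype.card V] S := by
  -- Until it stops, each round adds an element, so the number of rounds cannot exceed the number of
  -- elements.
  have key : ∀ k, F (F^[k] S) = F^[k] S ∨ k + 1 ≤ (F (F^[k] S)).card := by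
    intro k
    induction k with
    | zero =>
      by_cases h : F S = S
      · exact Or.inl h
      · exact Or.inr (Nat.lt_of_le_of_lt (Nat.zero_le _)
          (Finset.card_lt_card ((hF 0).ssubset_of_ne (Ne.symm h))))
    | succ k ih =>
      rw [Function.iterate_succ_apply']
      rcases ih with ih | ih
      · left; rw [ih, ih]
      · by_cases h : F (F (F^[k] S)) = F (F^[k] S)
        · exact Or.inl h
        · have h' := (hF (k + 1)).ssubset_of_ne
          rw [Function.iterate_succ_apply'] at h'
          exact Or.inr (Nat.lt_of_le_of_lt ih (Finset.card_lt_card (h' (Ne.symm h))))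
  refine (key _).resolve_right fun h => ?_
  have := h.trans (Finset.card_le_univ _)
  omega

namespace PolyTime

variable {α β : Type} [Enc α] [Enc β]

/-- Functions that do not change the encoding. -/
theorem of_enc {f : α → β} (h : ∀ a, Enc.enc (f a) = Enc.enc a) : PolyTime f :=
  id.congr_enc h

end PolyTime

theorem esize_filter_le {β : Type} [Enc β] (p : β → Bool) (l : List β) :
    esize (l.filter p) ≤ esize l := by
  induction l with
  | nil => simp
  | cons b l ih =>
    rw [esize_cons, List.filter_cons]
    split_ifs
    · rw [esize_cons]; omega
    · omega

/-! ### Algorithms on graphs without dependent types -/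

/-- One round of exploration. -/
def rawStep (n : ℕ) (es : List (ℕ × ℕ × ℚ≥0)) (L : List ℕ) : List ℕ :=
  (List.range n).filter fun v => decide (v ∈ L) || es.any fun e =>
    (decide (e.1 ∈ L) && decide (e.2.1 = v)) || (decide (e.2.1 ∈ L) && decide (e.1 = v))

/-- The vertices that can be reached from `s`. -/
def rawComp (n : ℕ) (es : List (ℕ × ℕ × ℚ≥0)) (s : ℕ) : List ℕ :=
  (rawStep n es)^[n] ((List.range n).filter fun v => decide (v = s))

namespace PolyTime

variable {α : Type} [Enc α]

theorem rawStep {n : α → ℕ} {es : α → List (ℕ × ℕ × ℚ≥0)} {L : α → List ℕ} (hn : PolyTime n)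
    (hes : PolyTime es) (hL : PolyTime L) : PolyTime fun a => _root_.rawStep (n a) (es a) (L a) := by
  refine filter (f := fun a v => decide (v ∈ L a) || (es a).any fun e =>
    (decide (e.1 ∈ L a) && decide (e.2.1 = v)) || (decide (e.2.1 ∈ L a) && decide (e.1 = v)))
    (range hn) (bor (mem id.snd (hL.comp id.fst)) ?_)
  refine any (l := fun z : α × ℕ => es z.1) (f := fun z e =>
    (decide (e.1 ∈ L z.1) && decide (e.2.1 = z.2)) || (decide (e.2.1 ∈ L z.1) && decide (e.1 = z.2)))
    (hes.comp id.fst) ?_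
  exact bor (band (mem id.snd.fst (hL.comp id.fst.fst)) (decide_eq id.snd.snd.fst id.fst.snd))
    (band (mem id.snd.snd.fst (hL.comp id.fst.fst)) (decide_eq id.snd.fst id.fst.snd))

theorem rawComp {n : α → ℕ} {es : α → List (ℕ × ℕ × ℚ≥0)} {s : α → ℕ} (hn : PolyTime n)
    (hes : PolyTime es) (hs : PolyTime s) : PolyTime fun a => _root_.rawComp (n a) (es a) (s a) := by
  refine iterate (f := fun a => _root_.rawStep (n a) (es a)) hn
    (filter (f := fun a v => decide (v = s a)) (range hn) (decide_eq id.snd (hs.comp id.fst)))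
    (rawStep (hn.comp id.fst) (hes.comp id.fst) id.snd) (range hn).size_bound fun a k _ => ?_
  cases k with
  | zero => exact esize_filter_le _ _
  | succ k =>
    rw [Function.iterate_succ_apply']
    exact esize_filter_le _ _

end PolyTime

namespace CostGraph

variable {G : CostGraph}

/-- The list algorithm mirrors an increasing iteration on vertex sets. After as many rounds as there
are vertices it is stationary, hence closed under adjacency. -/
theorem rawComp_eq {es : List (ℕ × ℕ × ℚ≥0)} {H : Finset G.Edge}
    (h : ∀ x, x ∈ es ↔ ∃ e ∈ H, (((G.ends e).1 : ℕ), ((G.ends e).2 : ℕ), G.cost e) = x)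
    (s : G.Vert) : rawComp G.n es s = toL (G.comp H s) := by
  classical
  let F : Finset G.Vert → Finset G.Vert := fun S =>
    S ∪ Finset.univ.filter fun v => ∃ e ∈ H, ∃ u ∈ S, G.Joins e u v
  have h1 : ∀ S : Finset G.Vert, rawStep G.n es (toL S) = toL (F S) := by
    intro S
    refine filter_range_eq_toL fun v => ?_
    simp only [Bool.or_eq_true, decide_eq_true_eq, List.any_eq_true, Bool.and_eq_true, F,
      Finset.mem_union, Finset.mem_filter, Finset.mem_univ, true_and, val_mem_toL]
    refine or_congr Iff.rfl ?_
    constructor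
    · rintro ⟨x, hx, hx'⟩
      obtain ⟨e, he, rfl⟩ := (h x).1 hx
      simp only [val_mem_toL, Fin.val_inj] at hx'
      rcases hx' with ⟨h1, h2⟩ | ⟨h1, h2⟩
      · exact ⟨e, he, _, h1, h2 ▸ joins_ends e⟩
      · exact ⟨e, he, _, h1, h2 ▸ joins_comm.1 (joins_ends e)⟩
    · rintro ⟨e, he, u, hu, hj⟩
      refine ⟨_, (h _).2 ⟨e, he, rfl⟩, ?_⟩
      simp only [val_mem_toL, Fin.val_inj]
      rcases hj with hj | hj <;> rw [hj]
      · exact Or.inl ⟨hu, rfl⟩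
      · exact Or.inr ⟨hu, rfl⟩
  have h2 : ∀ k, (rawStep G.n es)^[k] ((List.range G.n).filter fun v => decide (v = (s : ℕ))) =
      toL (F^[k] {s}) := by
    intro k
    induction k with
    | zero => exact filter_range_eq_toL fun v => by simp [Fin.ext_iff]
    | succ k ih => rw [Function.iterate_succ_apply', Function.iterate_succ_apply', ih, h1]
  rw [rawComp, h2]
  congr 1
  have h3 := Finset.iterate_stationary (F := F) (S := {s}) fun k => Finset.subset_union_left
  rw [Fintype.card_fin] at h3
  have h4 : ∀ k, s ∈ F^[k] {s} ∧ F^[k] {s} ⊆ G.comp H s := by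
    intro k
    induction k with
    | zero => exact ⟨Finset.mem_singleton_self s, by
        simp only [Function.iterate_zero, _root_.id, Finset.singleton_subset_iff]
        exact self_mem_comp H s⟩
    | succ k ih =>
      rw [Function.iterate_succ_apply']
      refine ⟨Finset.mem_union_left _ ih.1, Finset.union_subset ih.2 fun v hv => ?_⟩
      obtain ⟨e, he, u, hu, hj⟩ := (Finset.mem_filter.1 hv).2
      exact mem_comp_of_joins hj he (ih.2 hu)
  refine (h4 _).2.antisymm fun v hv => ?_
  refine (mem_comp.1 hv).mem_of_cut_eq_empty ?_ (h4 G.n).1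
  by_contra hne
  obtain ⟨e, he⟩ := Finset.nonempty_iff_ne_empty.2 hne
  obtain ⟨u, hu, v, hv, hj⟩ := exists_joins_of_mem_cut he
  refine hv ?_
  rw [← h3]
  exact Finset.mem_union_right _ (Finset.mem_filter.2
    ⟨Finset.mem_univ _, e, (mem_cut.1 he).1, u, hu, hj⟩)

end CostGraph

/-! ### Listing the tight sets and choosing a maximal chain -/

open scoped Classical in
/-- A set of the list that is minimal above `cur`, starting the search from `b`. -/
noncomputable def minAbove {V : Type} (CL : List (Finset V)) (cur b : Finset V) : Finset V :=
  CL.foldl (fun best c => if cur ⊂ c ∧ c ⊂ best then c else best) b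

/-- The candidate only shrinks during the scan. A list member strictly between `cur` and the result
would thus have been below the candidate when it was met, and would have replaced it. -/
theorem minAbove_spec {V : Type} (CL : List (Finset V)) (cur b : Finset V) :
    minAbove CL cur b ⊆ b ∧ (cur ⊂ b → cur ⊂ minAbove CL cur b) ∧
      (minAbove CL cur b = b ∨ minAbove CL cur b ∈ CL) ∧
      (∀ c ∈ CL, cur ⊂ c → ¬c ⊂ minAbove CL cur b) ∧
      (¬cur ⊂ b → minAbove CL cur b = b) := by
  induction CL generalizing b with
  | nil => simp [minAbove]
  | cons c CL ih =>
    have h1 : minAbove (c :: CL) cur b =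
        minAbove CL cur (open scoped Classical in if cur ⊂ c ∧ c ⊂ b then c else b) := rfl
    by_cases h : cur ⊂ c ∧ c ⊂ b
    · rw [h1, if_pos h]
      obtain ⟨i1, i2, i3, i4, i5⟩ := ih c
      refine ⟨i1.trans h.2.subset, fun _ => i2 h.1, ?_, ?_, fun h' => absurd (h.1.trans h.2) h'⟩
      · rcases i3 with i3 | i3
        · right; rw [i3]; exact List.mem_cons_self
        · exact Or.inr (List.mem_cons_of_mem _ i3)
      · intro d hd hcd
        rcases List.mem_cons.1 hd with rfl | hd
        · exact fun h' => (h'.trans_subset i1).ne rfl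
        · exact i4 d hd hcd
    · rw [h1, if_neg h]
      obtain ⟨i1, i2, i3, i4, i5⟩ := ih b
      refine ⟨i1, i2, i3.imp_right (List.mem_cons_of_mem _), ?_, i5⟩
      intro d hd hcd
      rcases List.mem_cons.1 hd with rfl | hd
      · exact fun h' => h ⟨hcd, h'.trans_subset i1⟩
      · exact i4 d hd hcd

namespace CostGraph

variable (G : CostGraph) (s t : G.Vert)

/-- The vertices that can be reached from `s` without the edges `i` and `j`. -/
noncomputable def compWithout (i j : ℕ) : Finset G.Vert :=
  G.comp (Finset.univ.filter fun e : G.Edge => (e : ℕ) ≠ i ∧ (e : ℕ) ≠ j) s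

/-- Removing the edges `i` and `j` separates `t` from `s`, and no smaller set does. -/
def MinSep (i j : ℕ) : Prop :=
  t ∉ G.compWithout s i j ∧ (i = j ∨ (t ∈ G.compWithout s i i ∧ t ∈ G.compWithout s j j))

open scoped Classical in
/-- The sides of the minimal separations by at most two edges. -/
noncomputable def seps : List (Finset G.Vert) :=
  (((List.range G.m).product (List.range G.m)).filter fun p => G.MinSep s t p.1 p.2).map fun p =>
    G.compWithout s p.1 p.2

/-- A minimal separation side above a given one. -/
noncomputable def nextSep (C : Finset G.Vert) : Finset G.Vert :=
  minAbove (G.seps s t) C (G.comp Finset.univ s)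

/-- A chain of separation sides. -/
noncomputable def sepChain (j : ℕ) : Finset G.Vert := (G.nextSep s t)^[j] ∅

variable {G s t}

theorem filter_val_ne (e : G.Edge) :
    (Finset.univ.filter fun f : G.Edge => (f : ℕ) ≠ e ∧ (f : ℕ) ≠ e) = Finset.univ \ {e} := by
  ext f; simp [Fin.ext_iff]

theorem wt_eq_one_iff {e : G.Edge} : G.wt s t e = 1 ↔ t ∈ G.compWithout s e e := by
  rw [compWithout, filter_val_ne, mem_comp, wt]
  split_ifs with h <;> simp [h]

theorem mem_seps {C : Finset G.Vert} :
    C ∈ G.seps s t ↔ ∃ e f : G.Edge, G.MinSep s t e f ∧ G.compWithout s e f = C := by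
  simp only [seps, List.mem_map, List.mem_filter, Prod.exists, List.pair_mem_product,
    List.mem_range, decide_eq_true_eq]
  constructor
  · rintro ⟨i, j, ⟨⟨hi, hj⟩, h⟩, h'⟩
    exact ⟨⟨i, hi⟩, ⟨j, hj⟩, h, h'⟩
  · rintro ⟨e, f, h, h'⟩
    exact ⟨e, f, ⟨⟨e.isLt, f.isLt⟩, h⟩, h'⟩

/-- The edges that leave the side are among `e` and `f`. If these are equal, the weight is at most 2
anyway; if not, minimality says that each alone does not separate, so both have weight 1. -/
theorem tight_of_mem_seps (hr : G.Reach Finset.univ s t) {C : Finset G.Vert}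
    (h : C ∈ G.seps s t) : G.Tight s t C := by
  obtain ⟨e, f, ⟨h1, h2⟩, rfl⟩ := mem_seps.1 h
  refine ⟨fun v hv => mem_comp.2 (Relation.ReflTransGen.mono ?_ _ _ (mem_comp.1 hv)),
    le_antisymm ?_ (two_le_phi hr _)⟩
  · rintro u v ⟨e, -, he⟩
    exact ⟨e, Finset.mem_univ e, he⟩
  · have hs : s ∈ G.compWithout s e f := self_mem_comp _ s
    rw [phi, if_pos hs, if_neg h1, zero_add, zero_add]
    have h3 : ∀ g, g ∉ ({e, f} : Finset G.Edge) → G.cr (G.compWithout s e f) g = 0 := by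
      intro g hg
      rw [cr, if_pos]
      by_contra hne
      have : g ∈ G.cut (Finset.univ.filter fun g : G.Edge => (g : ℕ) ≠ e ∧ (g : ℕ) ≠ f)
          (G.compWithout s e f) := by
        simp only [Finset.mem_insert, Finset.mem_singleton, not_or] at hg
        refine mem_cut.2 ⟨Finset.mem_filter.2 ⟨Finset.mem_univ g, ?_, ?_⟩, hne⟩
        · exact fun h => hg.1 (Fin.ext h)
        · exact fun h => hg.2 (Fin.ext h)
      rw [compWithout, comp_closed] at this
      simp at this
    have h4 : ∀ g, G.cr (G.compWithout s e f) g ≤ 1 := fun g => by rw [cr]; split_ifs <;> omega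
    rw [← Finset.sum_subset (Finset.subset_univ ({e, f} : Finset G.Edge))
      fun g _ hg => by rw [h3 g hg, mul_zero]]
    refine (Finset.sum_le_sum fun g _ => Nat.mul_le_mul_left _ (h4 g)).trans ?_
    simp only [mul_one]
    rcases eq_or_ne e f with rfl | hne
    · rw [Finset.pair_eq_singleton, Finset.sum_singleton]
      exact wt_le_two e
    · rw [Finset.sum_pair hne]
      have h5 := h2.resolve_left fun h => hne (Fin.ext h)
      rw [wt_eq_one_iff.2 h5.1, wt_eq_one_iff.2 h5.2]

/-- A cut of weight 2 consists of one edge or of two edges of weight 1. As a tight set is connected,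
it is exactly what `s` reaches without them. -/
theorem Tight.mem_seps (hr : G.Reach Finset.univ s t) {C : Finset G.Vert} (h : G.Tight s t C)
    (h0 : C ≠ ∅) (hV : C ≠ G.comp Finset.univ s) : C ∈ G.seps s t := by
  obtain ⟨u, hu⟩ := Finset.nonempty_iff_ne_empty.2 h0
  have hs := h.s_mem hu
  obtain ⟨v, hv, hv'⟩ := Finset.exists_of_ssubset (h.subset.ssubset_of_ne hV)
  have ht := h.t_notMem hr hv hv'
  have h2 := h.eq_two
  rw [phi, if_pos hs, if_neg ht, zero_add, zero_add, sum_wt_cr] at h2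
  -- the edges that leave `C`
  have key : ∀ e f : G.Edge, G.cut Finset.univ C = {e, f} → G.compWithout s e f = C := by
    intro e f hef
    have h3 : G.cut (Finset.univ.filter fun g : G.Edge => (g : ℕ) ≠ e ∧ (g : ℕ) ≠ f) C = ∅ := by
      refine Finset.eq_empty_of_forall_notMem fun g hg => ?_
      obtain ⟨hg1, hg2⟩ := mem_cut.1 hg
      have : g ∈ G.cut Finset.univ C := mem_cut.2 ⟨Finset.mem_univ g, hg2⟩
      rw [hef, Finset.mem_insert, Finset.mem_singleton] at this
      have hg3 := (Finset.mem_filter.1 hg1).2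
      rcases this with rfl | rfl
      · exact hg3.1 rfl
      · exact hg3.2 rfl
    refine Finset.Subset.antisymm (fun w hw => (mem_comp.1 hw).mem_of_cut_eq_empty h3 hs) ?_
    intro w hw
    by_contra hw'
    obtain ⟨g, hg, hg1, hg2⟩ := h.exists_inside hr (Z := G.compWithout s e f)
      (self_mem_comp _ s) hw hw'
    have h4 : g ∉ G.cut Finset.univ C := fun h => (mem_cut.1 h).2 (iff_of_true hg1 hg2)
    have h5 : g ∈ G.cut (Finset.univ.filter fun g : G.Edge => (g : ℕ) ≠ e ∧ (g : ℕ) ≠ f)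
        (G.compWithout s e f) := by
      rw [hef, Finset.mem_insert, Finset.mem_singleton, not_or] at h4
      exact mem_cut.2 ⟨Finset.mem_filter.2 ⟨Finset.mem_univ g, fun h => h4.1 (Fin.ext h),
        fun h => h4.2 (Fin.ext h)⟩, (mem_cut.1 hg).2⟩
    rw [compWithout, comp_closed] at h5
    simp at h5
  have hcard : (G.cut Finset.univ C).card ≤ 2 := by
    rw [← h2, Finset.card_eq_sum_ones]
    exact Finset.sum_le_sum fun e _ => one_le_wt e
  have hne : (G.cut Finset.univ C).card ≠ 0 := by
    intro h0
    rw [Finset.card_eq_zero] at h0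
    rw [h0] at h2
    simp at h2
  rw [CostGraph.mem_seps]
  rcases (by omega : (G.cut Finset.univ C).card = 1 ∨ (G.cut Finset.univ C).card = 2) with hc | hc
  · obtain ⟨e, he⟩ := Finset.card_eq_one.1 hc
    have := key e e (by rw [he, Finset.pair_eq_singleton])
    exact ⟨e, e, ⟨by rw [this]; exact ht, Or.inl rfl⟩, this⟩
  · obtain ⟨e, f, hef, he⟩ := Finset.card_eq_two.1 hc
    have := key e f he
    rw [he, Finset.sum_pair hef] at h2
    have h3 := one_le_wt (s := s) (t := t) e
    have h4 := one_le_wt (s := s) (t := t) f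
    exact ⟨e, f, ⟨by rw [this]; exact ht,
      Or.inr ⟨wt_eq_one_iff.1 (by omega), wt_eq_one_iff.1 (by omega)⟩⟩, this⟩

theorem sepChain_succ (j : ℕ) : G.sepChain s t (j + 1) = G.nextSep s t (G.sepChain s t j) :=
  Function.iterate_succ_apply' _ _ _

theorem tight_sepChain (hr : G.Reach Finset.univ s t) (j : ℕ) : G.Tight s t (G.sepChain s t j) := by
  cases j with
  | zero => exact tight_empty
  | succ j =>
    rw [sepChain_succ, nextSep]
    rcases (minAbove_spec (G.seps s t) (G.sepChain s t j) (G.comp Finset.univ s)).2.2.1 with h | h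
    · rw [h]; exact tight_comp hr
    · exact tight_of_mem_seps hr h

/-- `seps` contains every tight set except possibly the two extremes, so a minimal member above the
present set leaves no tight set in between. -/
theorem sepChain_step (hr : G.Reach Finset.univ s t) (j : ℕ) :
    (G.sepChain s t j = G.comp Finset.univ s ∧ G.sepChain s t (j + 1) = G.comp Finset.univ s) ∨
      G.Piece s t (G.sepChain s t j) (G.sepChain s t (j + 1)) := by
  have hA := tight_sepChain hr j
  have hB := tight_sepChain hr (j + 1)
  obtain ⟨h1, h2, h3, h4, h5⟩ :=
    minAbove_spec (G.seps s t) (G.sepChain s t j) (G.comp Finset.univ s)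
  rw [← nextSep, ← sepChain_succ] at h1 h2 h3 h4 h5
  by_cases hV : G.sepChain s t j = G.comp Finset.univ s
  · exact Or.inl ⟨hV, h5 (by rw [hV]; exact fun h => h.ne rfl)⟩
  · right
    have hss := h2 (hA.subset.ssubset_of_ne hV)
    refine ⟨hr, hA, hB, hss, fun T hT hAT hTB => ?_⟩
    by_contra! hne
    have hAT' := hAT.ssubset_of_ne hne.1.symm
    have hTB' := hTB.ssubset_of_ne hne.2
    refine h4 T (hT.mem_seps hr ?_ ?_) hAT' hTB'
    · rintro rfl
      exact Finset.not_ssubset_empty _ hAT'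
    · rintro rfl
      exact (hTB'.trans_subset h1).ne rfl

/-- Strict growth can last for at most `G.n` steps, and it ends only at the whole component. -/
theorem chain_sepChain (hr : G.Reach Finset.univ s t) :
    G.Chain s t (G.sepChain s t) G.n where
  reach := hr
  zero := rfl
  last := by
    have h := Finset.iterate_stationary (F := G.nextSep s t) (S := ∅) fun k => by
      have := sepChain_step hr k
      rw [sepChain_succ] at this
      rcases this with h | h
      · exact (h.1.trans h.2.symm).le
      · exact h.ssubset.subset
    rw [Fintype.card_fin] at h
    rcases sepChain_step hr G.n with h' | h'
    · exact h'.1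
    · refine absurd ?_ h'.ssubset.ne
      rw [sepChain_succ]
      exact h.symm
  step j := (sepChain_step hr j).imp_left fun h => h.1.trans h.2.symm

end CostGraph

/-! ### The chain on plain lists -/

/-- A graph with a source and a target, without dependent types. -/
abbrev RawSD : Type := CostGraph.Raw × ℕ × ℕ

namespace RawSD

/-- The vertices that can be reached from the source. -/
def comp (I : RawSD) : List ℕ := rawComp I.1.1 I.1.2 I.2.1

/-- The vertices that can be reached from the source without the edges `i` and `j`. -/
def compWithout (I : RawSD) (i j : ℕ) : List ℕ :=
  rawComp I.1.1 (((List.range I.1.2.length).filter fun k => !(decide (k = i)) && !(decide (k = j))).map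
    fun k => I.1.2.getD k (0, 0, 0)) I.2.1

/-- Test for `CostGraph.MinSep`. -/
def minSep (I : RawSD) (i j : ℕ) : Bool :=
  !(decide (I.2.2 ∈ I.compWithout i j)) && (decide (i = j) ||
    (decide (I.2.2 ∈ I.compWithout i i) && decide (I.2.2 ∈ I.compWithout j j)))

/-- The list `CostGraph.seps`. -/
def seps (I : RawSD) : List (List ℕ) :=
  (((List.range I.1.2.length).product (List.range I.1.2.length)).filter
    fun p => I.minSep p.1 p.2).map fun p => I.compWithout p.1 p.2

/-- Test for strict inclusion. -/
def ssub (L M : List ℕ) : Bool :=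
  (L.all fun v => decide (v ∈ M)) && !(M.all fun v => decide (v ∈ L))

/-- The set `CostGraph.nextSep`. -/
def next (I : RawSD) (C : List ℕ) : List ℕ :=
  I.seps.foldl (fun best c => if ssub C c && ssub c best then c else best) I.comp

/-- The set `CostGraph.sepChain`. -/
def chain (I : RawSD) (j : ℕ) : List ℕ := I.next^[j] []

theorem foldl_mem (C b : List ℕ) (l : List (List ℕ)) :
    l.foldl (fun best c => if ssub C c && ssub c best then c else best) b ∈ b :: l := by
  induction l generalizing b with
  | nil => simp
  | cons c l ih =>
    have := ih (if ssub C c && ssub c b then c else b)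
    rw [List.foldl_cons]
    rcases List.mem_cons.1 this with h | h
    · rw [h]; split_ifs <;> simp
    · exact List.mem_cons_of_mem _ (List.mem_cons_of_mem _ h)

/-- The result is one of the candidates, so its size does not depend on `C`. Hence iterating does
not blow up. -/
theorem esize_next_le (I : RawSD) (C : List ℕ) :
    esize (I.next C) ≤ 1 + esize I.comp + esize I.seps := by
  have := esize_le_of_mem (foldl_mem C I.comp I.seps)
  rw [esize_cons] at this
  exact this.le

theorem esize_chain_le (I : RawSD) (j : ℕ) :
    esize (I.chain j) ≤ 1 + esize I.comp + esize I.seps := by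
  cases j with
  | zero =>
    change esize ([] : List ℕ) ≤ _
    rw [esize_nil]; omega
  | succ j =>
    rw [chain, Function.iterate_succ_apply']
    exact I.esize_next_le _

end RawSD

namespace PolyTime

variable {α : Type} [Enc α] {f : α → RawSD}

theorem sdComp (hf : PolyTime f) : PolyTime fun a => (f a).comp :=
  rawComp hf.fst.fst hf.fst.snd hf.snd.fst

theorem sdCompWithout {i j : α → ℕ} (hf : PolyTime f) (hi : PolyTime i) (hj : PolyTime j) :
    PolyTime fun a => (f a).compWithout (i a) (j a) := by
  refine rawComp hf.fst.fst ?_ hf.snd.fst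
  refine map (f := fun a k => (f a).1.2.getD k (0, 0, 0)) (filter
    (f := fun a k => !(decide (k = i a)) && !(decide (k = j a))) (range (length hf.fst.snd)) ?_) ?_
  · exact band (bnot (decide_eq id.snd (hi.comp id.fst))) (bnot (decide_eq id.snd (hj.comp id.fst)))
  · exact getD (hf.fst.snd.comp id.fst) id.snd (const _)

theorem sdMinSep {i j : α → ℕ} (hf : PolyTime f) (hi : PolyTime i) (hj : PolyTime j) :
    PolyTime fun a => (f a).minSep (i a) (j a) :=
  band (bnot (mem hf.snd.snd (sdCompWithout hf hi hj))) (bor (decide_eq hi hj)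
    (band (mem hf.snd.snd (sdCompWithout hf hi hi)) (mem hf.snd.snd (sdCompWithout hf hj hj))))

theorem product {β γ : Type} [Enc β] [Enc γ] {l : α → List β} {m : α → List γ} (hl : PolyTime l)
    (hm : PolyTime m) : PolyTime fun a => (l a).product (m a) :=
  flatMap (f := fun a b => (m a).map (Prod.mk b)) hl
    (map (f := fun z c => (z.2, c)) (hm.comp id.fst) (id.fst.snd.pair id.snd))

theorem sdSeps (hf : PolyTime f) : PolyTime fun a => (f a).seps := by
  refine map (f := fun a (p : ℕ × ℕ) => (f a).compWithout p.1 p.2)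
    (filter (f := fun a (p : ℕ × ℕ) => (f a).minSep p.1 p.2) (product ?_ ?_) ?_) ?_
  · exact range (length hf.fst.snd)
  · exact range (length hf.fst.snd)
  · exact sdMinSep (hf.comp id.fst) id.snd.fst id.snd.snd
  · exact sdCompWithout (hf.comp id.fst) id.snd.fst id.snd.snd

theorem ssub {L M : α → List ℕ} (hL : PolyTime L) (hM : PolyTime M) :
    PolyTime fun a => RawSD.ssub (L a) (M a) :=
  band (all (f := fun a v => decide (v ∈ M a)) hL (mem id.snd (hM.comp id.fst)))
    (bnot (all (f := fun a v => decide (v ∈ L a)) hM (mem id.snd (hL.comp id.fst))))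

theorem sdNext {C : α → List ℕ} (hf : PolyTime f) (hC : PolyTime C) :
    PolyTime fun a => (f a).next (C a) := by
  have h1 := sdComp hf
  have h2 := sdSeps hf
  refine foldl (F := fun a best c => if RawSD.ssub (C a) c && RawSD.ssub c best then c else best)
    h2 h1 (cond (band (ssub (hC.comp id.fst) id.snd.fst) (ssub id.snd.fst id.snd.snd)) id.snd.fst
      id.snd.snd) (((PolyBound.const 1).add h1.size_bound).add h2.size_bound) fun a l₁ l₂ h => ?_
  have h3 := esize_le_of_mem (RawSD.foldl_mem (C a) (f a).comp l₁)
  have h4 := esize_append l₁ l₂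
  have h5 := one_le_esize l₂
  rw [esize_cons] at h3
  rw [← h] at h4
  omega

theorem sdChain {j : α → ℕ} (hf : PolyTime f) (hj : PolyTime j) :
    PolyTime fun a => (f a).chain (j a) :=
  iterate (f := fun a => (f a).next) hj (const []) (sdNext (hf.comp id.fst) id.snd)
    (((PolyBound.const 1).add (sdComp hf).size_bound).add (sdSeps hf).size_bound)
    fun a k _ => (f a).esize_chain_le k

end PolyTime

namespace CostGraph

variable {G : CostGraph} {s t : G.Vert}

/-- A graph with source and target. -/
def rawSD (G : CostGraph) (s t : G.Vert) : RawSD := (G.raw, s, t)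

theorem rawSD_comp : (G.rawSD s t).comp = toL (G.comp Finset.univ s) :=
  rawComp_eq (fun x => by simp only [Finset.mem_univ, true_and]; exact mem_raw) s

theorem rawSD_compWithout (i j : ℕ) :
    (G.rawSD s t).compWithout i j = toL (G.compWithout s i j) := by
  refine rawComp_eq (fun x => ?_) s
  simp only [List.mem_map, List.mem_filter, List.mem_range, Bool.and_eq_true, Bool.not_eq_true',
    decide_eq_false_iff_not, Finset.mem_filter, Finset.mem_univ, true_and, rawSD, length_raw]
  constructor
  · rintro ⟨k, ⟨hk, h⟩, h'⟩
    exact ⟨⟨k, hk⟩, h, by rw [← h', ← getD_raw]⟩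
  · rintro ⟨e, h, h'⟩
    exact ⟨e, ⟨e.isLt, h⟩, by rw [getD_raw, h']⟩

theorem rawSD_minSep (i j : ℕ) : (G.rawSD s t).minSep i j = true ↔ G.MinSep s t i j := by
  simp only [RawSD.minSep, rawSD_compWithout, MinSep, Bool.and_eq_true, Bool.not_eq_true',
    Bool.or_eq_true, decide_eq_false_iff_not, decide_eq_true_eq]
  simp only [rawSD, val_mem_toL]

theorem rawSD_seps : (G.rawSD s t).seps = (G.seps s t).map toL := by
  simp only [RawSD.seps, seps, List.map_map]
  have h1 : (G.rawSD s t).1.2.length = G.m := length_raw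
  have h2 : (fun p : ℕ × ℕ => (G.rawSD s t).compWithout p.1 p.2) =
      toL ∘ fun p : ℕ × ℕ => G.compWithout s p.1 p.2 := funext fun p => rawSD_compWithout _ _
  rw [h1, h2]
  congr 1
  refine List.filter_congr fun p _ => ?_
  rw [Bool.eq_iff_iff, rawSD_minSep]
  simp only [decide_eq_true_eq]

theorem ssub_toL {n : ℕ} {S T : Finset (Fin n)} :
    RawSD.ssub (toL S) (toL T) = true ↔ S ⊂ T := by
  simp only [RawSD.ssub, Bool.and_eq_true, Bool.not_eq_true', ← Bool.not_eq_true,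
    List.all_eq_true, decide_eq_true_eq, toL_subset]
  rfl

theorem rawSD_next (C : Finset G.Vert) :
    (G.rawSD s t).next (toL C) = toL (G.nextSep s t C) := by
  rw [RawSD.next, rawSD_seps, rawSD_comp, List.foldl_map, nextSep, minAbove]
  refine List.foldl_hom toL fun best c => ?_
  by_cases h : C ⊂ c ∧ c ⊂ best
  · rw [if_pos h, if_pos]
    rw [Bool.and_eq_true, ssub_toL, ssub_toL]; exact h
  · rw [if_neg h, if_neg]
    rw [Bool.and_eq_true, ssub_toL, ssub_toL]; exact h

theorem rawSD_chain (j : ℕ) : (G.rawSD s t).chain j = toL (G.sepChain s t j) := by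
  induction j with
  | zero =>
    change ([] : List ℕ) = toL ∅
    simp [toL]
  | succ j ih =>
    rw [sepChain_succ, ← rawSD_next, ← ih]
    exact Function.iterate_succ_apply' _ _ _

end CostGraph

/-! ### The gadget on plain lists -/

/-- Numbers below `n` in `B` but not in `A`. -/
def rawDiff (n : ℕ) (B A : List ℕ) : List ℕ :=
  (List.range n).filter fun v => decide (v ∈ B) && !(decide (v ∈ A))

/-- The list `CostGraph.ports`. -/
def rawPorts (es : List (ℕ × ℕ × ℚ≥0)) (A D : List ℕ) (x : ℕ) : List ℕ :=
  (if decide (x ∈ D) then [x] else []) ++ es.flatMap fun e =>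
    (if decide (e.1 ∈ A) && decide (e.2.1 ∈ D) then [e.2.1] else []) ++
      (if decide (e.2.1 ∈ A) && decide (e.1 ∈ D) then [e.1] else [])

/-- Test for `CostGraph.Shared`. -/
def rawShared (es : List (ℕ × ℕ × ℚ≥0)) (A B : List ℕ) : Bool :=
  es.any fun e => (decide (e.1 ∈ A) && !(decide (e.2.1 ∈ B))) ||
    (decide (e.2.1 ∈ A) && !(decide (e.1 ∈ B)))

/-- The edges that tie the vertices outside `D` to `a`. -/
def rawPend (n : ℕ) (D : List ℕ) (a : ℕ) : List (ℕ × ℕ × ℚ≥0) :=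
  (List.range n).map fun v => (v, if decide (v ∈ D) then v else a, 0)

/-- The edges between vertices of `D`. -/
def rawReal (es : List (ℕ × ℕ × ℚ≥0)) (D : List ℕ) : List (ℕ × ℕ × ℚ≥0) :=
  es.map fun e => if decide (e.1 ∈ D) && decide (e.2.1 ∈ D) then e else (e.1, e.1, e.2.2)

/-- The links to the ports. -/
def rawLinks (n a₁ a₂ b₁ b₂ : ℕ) (sh : Bool) : List (ℕ × ℕ × ℚ≥0) :=
  [(n, a₁, 0), (n, a₂, 0), (n + 1, b₁, 0), (n + 1, b₂, 0), (a₁, if sh then b₁ else a₁, 0)]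

/-- The instance `CostGraph.gadget.inst`, from its ports. -/
def rawGadget (n : ℕ) (es : List (ℕ × ℕ × ℚ≥0)) (D : List ℕ) (a₁ a₂ b₁ b₂ : ℕ) (sh : Bool) :
    CostGraph.Raw × List Bool :=
  ((n + 2, rawReal es D ++ (rawLinks n a₁ a₂ b₁ b₂ sh ++
    (rawPend n D a₁ ++ (rawPend n D a₁ ++ rawPend n D a₁)))),
    (List.range (n + 2)).map fun v =>
      decide (v = a₁) || (decide (v = a₂) || (decide (v = b₁) || decide (v = b₂))))

namespace RawSD

/-- Numbers of the vertices outside `B`. -/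
def out (I : RawSD) (B : List ℕ) : List ℕ := rawDiff I.1.1 (List.range I.1.1) B

/-- The ports on the side of the source. -/
def ins (I : RawSD) (A B : List ℕ) : List ℕ := rawPorts I.1.2 A (rawDiff I.1.1 B A) I.2.1

/-- The ports on the side of the target. -/
def outs (I : RawSD) (A B : List ℕ) : List ℕ := rawPorts I.1.2 (I.out B) (rawDiff I.1.1 B A) I.2.2

/-- The instance `CostGraph.gadget.inst`. -/
def gadget (I : RawSD) (A B : List ℕ) : CostGraph.Raw × List Bool :=
  rawGadget I.1.1 I.1.2 (rawDiff I.1.1 B A) ((I.ins A B).headD I.2.1) ((I.ins A B).getLastD I.2.1)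
    ((I.outs A B).headD I.2.2) ((I.outs A B).getLastD I.2.2) (rawShared I.1.2 A B)

end RawSD

namespace PolyTime

variable {α : Type} [Enc α]

theorem rawDiff {n : α → ℕ} {B A : α → List ℕ} (hn : PolyTime n) (hB : PolyTime B)
    (hA : PolyTime A) : PolyTime fun a => _root_.rawDiff (n a) (B a) (A a) :=
  filter (f := fun a v => decide (v ∈ B a) && !(decide (v ∈ A a))) (range hn)
    (band (mem id.snd (hB.comp id.fst)) (bnot (mem id.snd (hA.comp id.fst))))

theorem rawPorts {es : α → List (ℕ × ℕ × ℚ≥0)} {A D : α → List ℕ} {x : α → ℕ} (hes : PolyTime es)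
    (hA : PolyTime A) (hD : PolyTime D) (hx : PolyTime x) :
    PolyTime fun a => _root_.rawPorts (es a) (A a) (D a) (x a) := by
  refine append (cond (mem hx hD) (cons hx (const [])) (const []))
    (flatMap (f := fun a e =>
      (if decide (e.1 ∈ A a) && decide (e.2.1 ∈ D a) then [e.2.1] else []) ++
      (if decide (e.2.1 ∈ A a) && decide (e.1 ∈ D a) then [e.1] else [])) hes (append ?_ ?_))
  · exact cond (band (mem id.snd.fst (hA.comp id.fst)) (mem id.snd.snd.fst (hD.comp id.fst)))
      (cons id.snd.snd.fst (const [])) (const [])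
  · exact cond (band (mem id.snd.snd.fst (hA.comp id.fst)) (mem id.snd.fst (hD.comp id.fst)))
      (cons id.snd.fst (const [])) (const [])

theorem rawShared {es : α → List (ℕ × ℕ × ℚ≥0)} {A B : α → List ℕ} (hes : PolyTime es)
    (hA : PolyTime A) (hB : PolyTime B) : PolyTime fun a => _root_.rawShared (es a) (A a) (B a) := by
  refine any (f := fun a e => (decide (e.1 ∈ A a) && !(decide (e.2.1 ∈ B a))) ||
    (decide (e.2.1 ∈ A a) && !(decide (e.1 ∈ B a)))) hes ?_
  exact bor (band (mem id.snd.fst (hA.comp id.fst)) (bnot (mem id.snd.snd.fst (hB.comp id.fst))))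
    (band (mem id.snd.snd.fst (hA.comp id.fst)) (bnot (mem id.snd.fst (hB.comp id.fst))))

theorem rawPend {n : α → ℕ} {D : α → List ℕ} {x : α → ℕ} (hn : PolyTime n) (hD : PolyTime D)
    (hx : PolyTime x) : PolyTime fun a => _root_.rawPend (n a) (D a) (x a) :=
  map (f := fun a v => (v, if decide (v ∈ D a) then v else x a, (0 : ℚ≥0))) (range hn)
    (id.snd.pair ((cond (mem id.snd (hD.comp id.fst)) id.snd (hx.comp id.fst)).pair (const 0)))

theorem rawReal {es : α → List (ℕ × ℕ × ℚ≥0)} {D : α → List ℕ} (hes : PolyTime es)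
    (hD : PolyTime D) : PolyTime fun a => _root_.rawReal (es a) (D a) := by
  refine map (f := fun a e => if decide (e.1 ∈ D a) && decide (e.2.1 ∈ D a) then e else (e.1, e.1, e.2.2))
    hes ?_
  exact cond (band (mem id.snd.fst (hD.comp id.fst)) (mem id.snd.snd.fst (hD.comp id.fst)))
    id.snd (id.snd.fst.pair (id.snd.fst.pair id.snd.snd.snd))

theorem rawLinks {n a₁ a₂ b₁ b₂ : α → ℕ} {sh : α → Bool} (hn : PolyTime n) (ha₁ : PolyTime a₁)
    (ha₂ : PolyTime a₂) (hb₁ : PolyTime b₁) (hb₂ : PolyTime b₂) (hsh : PolyTime sh) :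
    PolyTime fun a => _root_.rawLinks (n a) (a₁ a) (a₂ a) (b₁ a) (b₂ a) (sh a) :=
  cons (hn.pair (ha₁.pair (const 0))) (cons (hn.pair (ha₂.pair (const 0)))
    (cons (hn.succ.pair (hb₁.pair (const 0))) (cons (hn.succ.pair (hb₂.pair (const 0)))
      (cons (ha₁.pair ((cond hsh hb₁ ha₁).pair (const 0))) (const [])))))

theorem rawGadget {n a₁ a₂ b₁ b₂ : α → ℕ} {sh : α → Bool} {es : α → List (ℕ × ℕ × ℚ≥0)}
    {D : α → List ℕ} (hn : PolyTime n) (hes : PolyTime es) (hD : PolyTime D) (ha₁ : PolyTime a₁)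
    (ha₂ : PolyTime a₂) (hb₁ : PolyTime b₁) (hb₂ : PolyTime b₂) (hsh : PolyTime sh) :
    PolyTime fun a =>
      _root_.rawGadget (n a) (es a) (D a) (a₁ a) (a₂ a) (b₁ a) (b₂ a) (sh a) := by
  have hp := rawPend hn hD ha₁
  refine (hn.succ.succ.pair (append (rawReal hes hD) (append (rawLinks hn ha₁ ha₂ hb₁ hb₂ hsh)
    (append hp (append hp hp))))).pair (map (f := fun a v => decide (v = a₁ a) ||
      (decide (v = a₂ a) || (decide (v = b₁ a) || decide (v = b₂ a)))) (range hn.succ.succ) ?_)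
  exact bor (decide_eq id.snd (ha₁.comp id.fst)) (bor (decide_eq id.snd (ha₂.comp id.fst))
    (bor (decide_eq id.snd (hb₁.comp id.fst)) (decide_eq id.snd (hb₂.comp id.fst))))

theorem sdGadget {f : α → RawSD} {A B : α → List ℕ} (hf : PolyTime f) (hA : PolyTime A)
    (hB : PolyTime B) : PolyTime fun a => (f a).gadget (A a) (B a) := by
  have hD := rawDiff hf.fst.fst hB hA
  have hi := rawPorts hf.fst.snd hA hD hf.snd.fst
  have ho := rawPorts hf.fst.snd (rawDiff hf.fst.fst (range hf.fst.fst) hB) hD hf.snd.snd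
  exact rawGadget hf.fst.fst hf.fst.snd hD (headD hi hf.snd.fst) (getLastD hi hf.snd.fst)
    (headD ho hf.snd.snd) (getLastD ho hf.snd.snd) (rawShared hf.fst.snd hA hB)

end PolyTime

theorem bits_eq {n : ℕ} {S : Finset (Fin n)} {p : ℕ → Bool}
    (h : ∀ v : Fin n, p v = true ↔ v ∈ S) : (List.range n).map p = bits S := by
  rw [bits, List.ofFn_eq_map, ← List.map_coe_finRange_eq_range, List.map_map]
  refine List.map_congr_left fun v _ => ?_
  rw [Function.comp_apply, Bool.eq_iff_iff, h, decide_eq_true_eq]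

theorem getD_bits {n : ℕ} {S : Finset (Fin n)} (v : Fin n) {d : Bool} :
    (bits S).getD v d = true ↔ v ∈ S := by
  have : (v : ℕ) < (bits S).length := by simp [bits]
  rw [List.getD_eq_getElem _ _ this]
  simp [bits]

namespace CostGraph

variable {G : CostGraph} {s t : G.Vert} {A B : Finset G.Vert}

theorem rawDiff_toL {n : ℕ} {S T : Finset (Fin n)} :
    rawDiff n (toL S) (toL T) = toL (S \ T) :=
  filter_range_eq_toL fun v => by
    simp only [Bool.and_eq_true, Bool.not_eq_true', decide_eq_true_eq, decide_eq_false_iff_not,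
      val_mem_toL, Finset.mem_sdiff]

theorem range_eq_toL (n : ℕ) : List.range n = toL (Finset.univ : Finset (Fin n)) := by
  rw [← filter_range_eq_toL (p := fun _ => true) (by simp)]
  simp

theorem rawSD_out (B : Finset G.Vert) : (G.rawSD s t).out (toL B) = toL Bᶜ := by
  rw [RawSD.out, range_eq_toL]
  exact rawDiff_toL

theorem raw_snd : G.raw.2 = (List.finRange G.m).map fun e =>
    (((G.ends e).1 : ℕ), ((G.ends e).2 : ℕ), G.cost e) := List.ofFn_eq_map

theorem rawPorts_toL (A D : Finset G.Vert) (x : G.Vert) :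
    rawPorts G.raw.2 (toL A) (toL D) x = (G.ports A D x).map Fin.val := by
  rw [rawPorts, ports, List.map_append, raw_snd, List.flatMap_map, List.map_flatMap]
  congr 1
  · by_cases h : x ∈ D <;> simp [val_mem_toL, h]
  · congr 1
    funext e
    simp only [endsIn, List.map_append, Bool.and_eq_true, decide_eq_true_eq, val_mem_toL]
    congr 1 <;> split_ifs <;> rfl

theorem headD_map_val {n : ℕ} (l : List (Fin n)) (x : Fin n) :
    (l.map Fin.val).headD x = (l.headD x : ℕ) := by cases l <;> rfl

theorem getLastD_map_val {n : ℕ} (l : List (Fin n)) (x : Fin n) :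
    (l.map Fin.val).getLastD x = (l.getLastD x : ℕ) := by
  rw [List.getLastD_eq_getLast?, List.getLastD_eq_getLast?, List.getLast?_map]
  cases l.getLast? <;> rfl

theorem rawShared_toL : rawShared G.raw.2 (toL A) (toL B) = true ↔ G.Shared A B := by
  simp only [rawShared, List.any_eq_true, Bool.or_eq_true, Bool.and_eq_true, Bool.not_eq_true',
    decide_eq_true_eq, decide_eq_false_iff_not, Shared, mem_raw]
  constructor
  · rintro ⟨_, ⟨e, rfl⟩, h⟩
    simp only [val_mem_toL] at h
    rcases h with h | h
    · exact ⟨e, _, h.1, _, h.2, joins_ends e⟩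
    · exact ⟨e, _, h.1, _, h.2, joins_comm.1 (joins_ends e)⟩
  · rintro ⟨e, u, hu, v, hv, hj⟩
    refine ⟨_, ⟨e, rfl⟩, ?_⟩
    simp only [val_mem_toL]
    rcases hj with hj | hj <;> rw [hj]
    · exact Or.inl ⟨hu, hv⟩
    · exact Or.inr ⟨hu, hv⟩

/-- An edge with its ends and cost. -/
def rawEdge (G : CostGraph) (e : G.Edge) : ℕ × ℕ × ℚ≥0 :=
  (((G.ends e).1 : ℕ), ((G.ends e).2 : ℕ), G.cost e)

namespace gadget

theorem raw_snd_eq : (G.gadget s t A B).raw.2 =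
    (List.finRange G.m).map (fun e => (G.gadget s t A B).rawEdge (real s t A B e)) ++
    ((List.finRange 5).map (fun i => (G.gadget s t A B).rawEdge (link s t A B i)) ++
    ((List.finRange G.n).map (fun v => (G.gadget s t A B).rawEdge (pend₁ s t A B v)) ++
    ((List.finRange G.n).map (fun v => (G.gadget s t A B).rawEdge (pend₂ s t A B v)) ++
    (List.finRange G.n).map (fun v => (G.gadget s t A B).rawEdge (pend₃ s t A B v))))) := by
  simp only [← List.ofFn_eq_map]
  refine (List.ofFn_add (n := G.m) (m := 5 + (G.n + (G.n + G.n)))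
    (f := (G.gadget s t A B).rawEdge)).trans (congrArg₂ _ rfl ?_)
  refine List.ofFn_add.trans (congrArg₂ _ rfl ?_)
  refine List.ofFn_add.trans (congrArg₂ _ rfl ?_)
  exact List.ofFn_add

theorem rawReal_eq : (List.finRange G.m).map (fun e =>
    (G.gadget s t A B).rawEdge (real s t A B e)) = rawReal G.raw.2 (toL (B \ A)) := by
  rw [rawReal, raw_snd, List.map_map]
  refine List.map_congr_left fun e _ => ?_
  rw [Function.comp_apply, rawEdge, ends_real, cost_real]
  simp only [Bool.and_eq_true, decide_eq_true_eq, val_mem_toL]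
  split_ifs <;> rfl

theorem rawLinks_eq : (List.finRange 5).map (fun i =>
    (G.gadget s t A B).rawEdge (link s t A B i)) =
    rawLinks G.n (G.port₁ A (B \ A) s) (G.port₂ A (B \ A) s) (G.port₁ Bᶜ (B \ A) t)
      (G.port₂ Bᶜ (B \ A) t) (rawShared G.raw.2 (toL A) (toL B)) := by
  classical
  have h5 : List.finRange 5 = [0, 1, 2, 3, 4] := rfl
  simp only [h5, List.map_cons, List.map_nil, rawEdge, ends_link, cost_link, rawLinks]
  simp only [rawShared_toL]
  by_cases h : G.Shared A B
  · simp only [if_pos h]; rfl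
  · simp only [if_neg h]; rfl

theorem rawPend_eq {f : G.Vert → (G.gadget s t A B).Edge}
    (h : ∀ v, (G.gadget s t A B).ends (f v) =
      (old s t A B v, old s t A B (if v ∈ B \ A then v else G.port₁ A (B \ A) s)))
    (h' : ∀ v, (G.gadget s t A B).cost (f v) = 0) :
    (List.finRange G.n).map (fun v => (G.gadget s t A B).rawEdge (f v)) =
      rawPend G.n (toL (B \ A)) (G.port₁ A (B \ A) s) := by
  rw [rawPend, ← List.map_coe_finRange_eq_range, List.map_map]
  refine List.map_congr_left fun v _ => ?_
  rw [Function.comp_apply, rawEdge, h, h']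
  simp only [decide_eq_true_eq, val_mem_toL]
  split_ifs <;> rfl

theorem mem_terminals_val {v : (G.gadget s t A B).Vert} : v ∈ terminals G s t A B ↔
    (v : ℕ) = G.port₁ A (B \ A) s ∨ (v : ℕ) = G.port₂ A (B \ A) s ∨
      (v : ℕ) = G.port₁ Bᶜ (B \ A) t ∨ (v : ℕ) = G.port₂ Bᶜ (B \ A) t := by
  simp only [terminals, Finset.mem_insert, Finset.mem_singleton, Fin.ext_iff]
  rfl

/-- The list construction reproduces the gadget with the same order of vertices and edges, so the
two encodings agree literally. -/
theorem rawSD_gadget : (G.rawSD s t).gadget (toL A) (toL B) =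
    ((G.gadget s t A B).raw, bits (terminals G s t A B)) := by
  have h1 : (G.rawSD s t).ins (toL A) (toL B) = (G.ports A (B \ A) s).map Fin.val := by
    rw [RawSD.ins, ← rawPorts_toL, ← rawDiff_toL]; rfl
  have h2 : (G.rawSD s t).outs (toL A) (toL B) = (G.ports Bᶜ (B \ A) t).map Fin.val := by
    rw [RawSD.outs, rawSD_out, ← rawPorts_toL, ← rawDiff_toL]; rfl
  have h3 : rawDiff (G.rawSD s t).1.1 (toL B) (toL A) = toL (B \ A) := rawDiff_toL
  have h4 : (G.rawSD s t).2.1 = (s : ℕ) := rfl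
  have h5 : (G.rawSD s t).2.2 = (t : ℕ) := rfl
  rw [RawSD.gadget, h1, h2, h3, h4, h5, headD_map_val, headD_map_val, getLastD_map_val,
    getLastD_map_val, rawGadget]
  refine Prod.ext (Prod.ext rfl ?_) (bits_eq fun v => ?_)
  · rw [raw_snd_eq, rawReal_eq, rawLinks_eq, rawPend_eq ends_pend₁ cost_pend₁,
      rawPend_eq ends_pend₂ cost_pend₂, rawPend_eq ends_pend₃ cost_pend₃]
    rfl
  · simp only [Bool.or_eq_true, decide_eq_true_eq]
    exact mem_terminals_val.symm

theorem enc_inst : Enc.enc ((G.rawSD s t).gadget (toL A) (toL B)) =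
    Subset3EC.encInst (inst G s t A B) := by
  rw [rawSD_gadget]
  change Data.cons (Enc.enc (G.gadget s t A B).raw) (Enc.enc (bits _)) = _
  rw [enc_raw, enc_bits]
  rfl

end gadget

end CostGraph

/-! ### Assembling solutions of the pieces, and their cost -/

namespace CostGraph

variable {G : CostGraph} {s t : G.Vert}

theorem Solves.mono {H H' : Finset G.Edge} {A B : Finset G.Vert} (h : G.Solves s t H A B)
    (hH : ∀ e ∈ H, (G.ends e).1 ∈ B \ A → (G.ends e).2 ∈ B \ A → e ∈ H') :
    G.Solves s t H' A B := by
  intro Y hY hu hv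
  have h1 := h Y hY hu hv
  have h2 : G.inner H (B \ A) Y ≤ G.inner H' (B \ A) Y := by
    rw [inner, inner, ← Finset.sum_filter, ← Finset.sum_filter]
    refine Finset.sum_le_sum_of_subset fun e he => ?_
    rw [Finset.mem_filter] at he ⊢
    exact ⟨hH e he.1 he.2.1 he.2.2, he.2⟩
  unfold linked at h1 ⊢
  omega

variable (G s t) in
open scoped Classical in
/-- The union of the cuts of a chain and of solutions of its pieces. -/
noncomputable def assemble (A : ℕ → Finset G.Vert) (k : ℕ)
    (S : ∀ j, G.Piece s t (A j) (A (j + 1)) → Finset (G.gadget s t (A j) (A (j + 1))).Edge) :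
    Finset G.Edge :=
  Finset.univ.filter fun e => ∃ j < k, ∃ h : G.Piece s t (A j) (A (j + 1)),
    e ∈ G.cut Finset.univ (A j) ∨ ((G.ends e).1 ∈ A (j + 1) \ A j ∧ (G.ends e).2 ∈ A (j + 1) \ A j) ∧
      gadget.real s t _ _ e ∈ S j h

variable {A : ℕ → Finset G.Vert} {k : ℕ}
  {S : ∀ j, G.Piece s t (A j) (A (j + 1)) → Finset (G.gadget s t (A j) (A (j + 1))).Edge}

theorem mem_assemble {e : G.Edge} : e ∈ G.assemble s t A k S ↔
    ∃ j < k, ∃ h : G.Piece s t (A j) (A (j + 1)),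
      e ∈ G.cut Finset.univ (A j) ∨
        ((G.ends e).1 ∈ A (j + 1) \ A j ∧ (G.ends e).2 ∈ A (j + 1) \ A j) ∧
          gadget.real s t _ _ e ∈ S j h := by simp [assemble]

namespace Chain

theorem lt_of_piece (hA : G.Chain s t A k) {j : ℕ} (h : G.Piece s t (A j) (A (j + 1))) : j < k := by
  by_contra! hk
  have h1 := hA.monotone hk
  rw [hA.last] at h1
  exact h.ssubset.not_subset (h.tightB.subset.trans h1)

/-- The members of a chain that are not followed by a piece are trivial. -/
theorem piece_or_cut_eq_empty (hA : G.Chain s t A k) (j : ℕ) :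
    G.Piece s t (A j) (A (j + 1)) ∨ G.cut Finset.univ (A j) = ∅ ∨
      ∃ i, A i = A j ∧ G.Piece s t (A i) (A (i + 1)) := by
  by_cases hV : A j = G.comp Finset.univ s
  · right; left; rw [hV, comp_closed]
  · right; right
    have h1 : ∃ i, A (j + i) ≠ A j := by
      refine ⟨k, fun h => hV ?_⟩
      rw [← h]
      refine Finset.Subset.antisymm (hA.tight _).subset ?_
      rw [← hA.last]
      exact hA.monotone (Nat.le_add_left k j)
    classical
    obtain ⟨i, hi, hmin⟩ : ∃ i, A (j + i) ≠ A j ∧ ∀ i' < i, A (j + i') = A j :=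
      ⟨Nat.find h1, Nat.find_spec h1, fun i' hi' => not_not.1 (Nat.find_min h1 hi')⟩
    obtain ⟨i, rfl⟩ : ∃ i', i = i' + 1 := Nat.exists_eq_succ_of_ne_zero (by rintro rfl; exact hi rfl)
    have h2 := hmin i (Nat.lt_succ_self i)
    refine ⟨j + i, h2, (hA.step (j + i)).resolve_left fun h => hi ?_⟩
    rw [← h2, h]; rfl

/-- The chain may pause before its next proper step. Then the cut is taken along with the last
repetition of the same set; the cut of the whole component is empty. -/
theorem cut_subset_assemble (hA : G.Chain s t A k) (j : ℕ) :
    G.cut Finset.univ (A j) ⊆ G.assemble s t A k S := by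
  intro e he
  rcases hA.piece_or_cut_eq_empty j with h | h | ⟨i, hi, h⟩
  · exact mem_assemble.2 ⟨j, hA.lt_of_piece h, h, Or.inl he⟩
  · rw [h] at he; simp at he
  · exact mem_assemble.2 ⟨i, hA.lt_of_piece h, h, Or.inl (by rwa [hi])⟩

/-- Feasible solutions of the pieces give a feasible solution. -/
theorem relFeasible_assemble (hA : G.Chain s t A k)
    (hS : ∀ j h, (G.gadget s t (A j) (A (j + 1))).EdgeConnectedSubset (S j h) 3
      (gadget.terminals G s t (A j) (A (j + 1)))) :
    G.RelFeasible [(s, t, 3)] (G.assemble s t A k S) :=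
  hA.relFeasible hA.cut_subset_assemble fun j h => (gadget.solves h (hS j h)).mono
    fun _ he h1 h2 => mem_assemble.2
      ⟨j, hA.lt_of_piece h, h, Or.inr ⟨⟨h1, h2⟩, gadget.mem_realPart.1 he⟩⟩

theorem feasible_lift (hA : G.Chain s t A k) {H : Finset G.Edge}
    (hH : G.RelFeasible [(s, t, 3)] H) {j : ℕ} (h : G.Piece s t (A j) (A (j + 1))) :
    (G.gadget s t (A j) (A (j + 1))).EdgeConnectedSubset (gadget.lift s t _ _ H) 3
      (gadget.terminals G s t (A j) (A (j + 1))) :=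
  gadget.edgeConnectedSubset_lift h (h.solves_of_relFeasible ((hA.tight j).cut_subset hA.reach hH)
    ((hA.tight (j + 1)).cut_subset hA.reach hH) hH)

end Chain

theorem totalCost_eq (H : Finset G.Edge) : G.totalCost H = ∑ e, if e ∈ H then G.cost e else 0 :=
  (sum_ite_mem_univ _ _).symm

namespace Chain

/-- Edges inside a layer cross no member of the chain. -/
theorem notMem_cut (hA : G.Chain s t A k) {e : G.Edge} {j : ℕ} (h1 : (G.ends e).1 ∈ A (j + 1) \ A j)
    (h2 : (G.ends e).2 ∈ A (j + 1) \ A j) (i : ℕ) : e ∉ G.cut Finset.univ (A i) := by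
  rw [Finset.mem_sdiff] at h1 h2
  intro he
  refine (mem_cut.1 he).2 ?_
  rcases Nat.lt_or_ge j i with h | h
  · exact iff_of_true (hA.monotone h h1.1) (hA.monotone h h2.1)
  · exact iff_of_false (fun h' => h1.2 (hA.monotone h h')) fun h' => h2.2 (hA.monotone h h')

theorem layer_unique (hA : G.Chain s t A k) {v : G.Vert} {i j : ℕ} (hi : v ∈ A (i + 1) \ A i)
    (hj : v ∈ A (j + 1) \ A j) : i = j := by
  rw [Finset.mem_sdiff] at hi hj
  rcases lt_trichotomy i j with h | h | h
  · exact absurd (hA.monotone h hi.1) hj.2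
  · exact h
  · exact absurd (hA.monotone h hj.1) hi.2

open scoped Classical in
/-- The cost of the assembled solution. -/
theorem totalCost_assemble_le (hA : G.Chain s t A k) {ρ : ℝ} (hρ : 1 ≤ ρ) {H : Finset G.Edge}
    (hH : G.RelFeasible [(s, t, 3)] H)
    (hS : ∀ j h, ((G.gadget s t (A j) (A (j + 1))).totalCost (S j h) : ℝ) ≤
      ρ * (G.gadget s t (A j) (A (j + 1))).totalCost (gadget.lift s t _ _ H)) :
    (G.totalCost (G.assemble s t A k S) : ℝ) ≤ ρ * G.totalCost H := by
  let F : Finset G.Edge := Finset.univ.filter fun e => ∃ j, e ∈ G.cut Finset.univ (A j)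
  let P : ℕ → Finset G.Edge := fun j =>
    if h : G.Piece s t (A j) (A (j + 1)) then gadget.realPart (S j h) else ∅
  let Q : ℕ → Finset G.Edge := fun j =>
    H.filter fun e => (G.ends e).1 ∈ A (j + 1) \ A j ∧ (G.ends e).2 ∈ A (j + 1) \ A j
  have h1 : G.totalCost (G.assemble s t A k S) ≤
      G.totalCost F + ∑ j ∈ Finset.range k, G.totalCost (P j) := by
    simp only [totalCost_eq]
    rw [Finset.sum_comm, ← Finset.sum_add_distrib]
    refine Finset.sum_le_sum fun e _ => ?_
    split_ifs with he hF
    · exact le_add_of_nonneg_right (zero_le)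
    · obtain ⟨j, hj, h, h' | ⟨-, h'⟩⟩ := mem_assemble.1 he
      · exact absurd (Finset.mem_filter.2 ⟨Finset.mem_univ e, j, h'⟩) hF
      · rw [zero_add]
        have h2 : e ∈ P j := by
          simp only [P, dif_pos h]
          exact gadget.mem_realPart.2 h'
        refine le_trans ?_ (Finset.single_le_sum (fun _ _ => zero_le) (Finset.mem_range.2 hj))
        rw [if_pos h2]
    · exact zero_le
    · exact zero_le
  -- Any feasible `H` contains the tight cuts `F`, and its parts inside the layers are disjoint from
  -- these and from each other.
  have h2 : G.totalCost F + ∑ j ∈ Finset.range k, G.totalCost (Q j) ≤ G.totalCost H := by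
    simp only [totalCost_eq]
    rw [Finset.sum_comm, ← Finset.sum_add_distrib]
    refine Finset.sum_le_sum fun e _ => ?_
    have hQ : ∀ j, e ∈ Q j → e ∈ H ∧ ((G.ends e).1 ∈ A (j + 1) \ A j ∧ (G.ends e).2 ∈ A (j + 1) \ A j) :=
      fun j h => Finset.mem_filter.1 h
    by_cases hF : e ∈ F
    · obtain ⟨j, hj⟩ := (Finset.mem_filter.1 hF).2
      rw [if_pos hF, if_pos ((hA.tight j).cut_subset hA.reach hH hj), Finset.sum_eq_zero, add_zero]
      exact fun i _ => if_neg fun h => hA.notMem_cut (hQ i h).2.1 (hQ i h).2.2 j hj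
    · rw [if_neg hF, zero_add]
      by_cases hex : ∃ j, e ∈ Q j
      · obtain ⟨j, hj⟩ := hex
        rw [if_pos (hQ j hj).1]
        refine (Finset.sum_le_sum (g := fun i => if i = j then G.cost e else 0) fun i _ => ?_).trans ?_
        · split_ifs with h3 h4
          · exact le_rfl
          · exact absurd (hA.layer_unique (hQ i h3).2.1 (hQ j hj).2.1) h4
          · exact zero_le
          · exact le_rfl
        · rw [Finset.sum_ite_eq']
          split_ifs
          · exact le_rfl
          · exact zero_le
      · rw [Finset.sum_eq_zero fun i _ => if_neg fun h => hex ⟨i, h⟩]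
        exact zero_le
  have h3 : ∀ j, (G.totalCost (P j) : ℝ) ≤ ρ * G.totalCost (Q j) := by
    intro j
    by_cases h : G.Piece s t (A j) (A (j + 1))
    · simp only [P, dif_pos h]
      refine le_trans ?_ ((hS j h).trans_eq ?_)
      · exact_mod_cast gadget.totalCost_realPart_le (S j h)
      · rw [gadget.totalCost_lift]
    · simp only [P, dif_neg h]
      have : G.totalCost ∅ = 0 := Finset.sum_empty
      rw [this, NNRat.cast_zero]
      positivity
  have h1' : (G.totalCost (G.assemble s t A k S) : ℝ) ≤
      G.totalCost F + ∑ j ∈ Finset.range k, (G.totalCost (P j) : ℝ) := by exact_mod_cast h1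
  have h2' : (G.totalCost F : ℝ) + ∑ j ∈ Finset.range k, (G.totalCost (Q j) : ℝ) ≤ G.totalCost H := by
    exact_mod_cast h2
  have h4 : ∑ j ∈ Finset.range k, (G.totalCost (P j) : ℝ) ≤
      ρ * ∑ j ∈ Finset.range k, (G.totalCost (Q j) : ℝ) := by
    rw [Finset.mul_sum]
    exact Finset.sum_le_sum fun j _ => h3 j
  -- The tight cuts are bought at full price, which `1 ≤ ρ` covers.
  have h5 : (G.totalCost F : ℝ) ≤ ρ * G.totalCost F :=
    le_mul_of_one_le_left (by positivity) hρ
  calc (G.totalCost (G.assemble s t A k S) : ℝ)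
      ≤ ρ * (G.totalCost F + ∑ j ∈ Finset.range k, (G.totalCost (Q j) : ℝ)) := by
        rw [mul_add]; linarith
    _ ≤ ρ * G.totalCost H := mul_le_mul_of_nonneg_left h2' (by linarith)

end Chain

end CostGraph

/-! ### The algorithm for SD-3-RSND -/

namespace SDInstance

/-- The chain of separation sides of the instance. -/
noncomputable def chain (I : SDInstance) (j : ℕ) : Finset I.G.Vert := I.G.sepChain I.s I.t j

/-- There is a piece at position `j` of the chain. -/
def IsPiece (I : SDInstance) (j : ℕ) : Prop := I.G.Piece I.s I.t (I.chain j) (I.chain (j + 1))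

/-- The instance without dependent types. -/
def toRaw (I : SDInstance) : RawSD := I.G.rawSD I.s I.t

theorem enc_toRaw (I : SDInstance) : Enc.enc I.toRaw = Enc.enc I := by
  change Data.cons (Enc.enc I.G.raw) _ = _
  rw [CostGraph.enc_raw]
  rfl

theorem toRaw_chain (I : SDInstance) (j : ℕ) : I.toRaw.chain j = toL (I.chain j) :=
  CostGraph.rawSD_chain j

theorem polyTime_toRaw : PolyTime toRaw := PolyTime.of_enc enc_toRaw

/-- Positions of pieces. -/
abbrev PiecePos : Type := {p : SDInstance × ℕ // p.1.IsPiece p.2}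

instance : Enc PiecePos := ⟨fun p => Enc.enc p.1⟩

open scoped Classical in
/-- All positions of pieces. -/
noncomputable def positions (I : SDInstance) : List PiecePos :=
  (List.range I.G.n).filterMap fun j => if h : I.IsPiece j then some ⟨(I, j), h⟩ else none

/-- Test for `IsPiece`. -/
def _root_.RawSD.isPiece (I : RawSD) (j : ℕ) : Bool :=
  decide (I.2.2 ∈ I.comp) && !(decide (I.chain j = I.chain (j + 1)))

/-- If `t` is reachable, a step of the chain that is not stationary is a piece, so comparing two
lists decides it. -/
theorem isPiece_iff (I : SDInstance) (j : ℕ) : I.toRaw.isPiece j = true ↔ I.IsPiece j := by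
  have h1 : I.toRaw.comp = toL (I.G.comp Finset.univ I.s) := CostGraph.rawSD_comp
  have h2 : I.toRaw.2.2 = (I.t : ℕ) := rfl
  rw [RawSD.isPiece, Bool.and_eq_true, decide_eq_true_eq, Bool.not_eq_true', decide_eq_false_iff_not,
    toRaw_chain, toRaw_chain, toL_injective.eq_iff, h1, h2, val_mem_toL, CostGraph.mem_comp]
  constructor
  · rintro ⟨hr, hne⟩
    exact ((CostGraph.chain_sepChain hr).step j).resolve_left hne
  · intro h
    exact ⟨h.reach, h.ssubset.ne⟩

theorem enc_positions (I : SDInstance) : Enc.enc I.positions =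
    Enc.enc (((List.range I.G.n).filter I.toRaw.isPiece).map fun j => (I, j)) := by
  have : I.positions.map Subtype.val =
      ((List.range I.G.n).filter I.toRaw.isPiece).map fun j => (I, j) := by
    rw [positions]
    induction List.range I.G.n with
    | nil => rfl
    | cons j l ih =>
      by_cases h : I.IsPiece j
      · rw [List.filterMap_cons_some (by rw [dif_pos h]), List.filter_cons_of_pos
          ((isPiece_iff I j).2 h), List.map_cons, List.map_cons, ih]
      · rw [List.filterMap_cons_none (by rw [dif_neg h]), List.filter_cons_of_neg
          (fun h' => h ((isPiece_iff I j).1 h')), ih]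
  rw [← this]
  simp only [Enc.enc, List.map_map]
  rfl

theorem polyTime_positions : PolyTime positions := by
  have hc : PolyTime fun z : SDInstance × ℕ => z.1.toRaw := polyTime_toRaw.comp PolyTime.id.fst
  have h1 : PolyTime fun I : SDInstance =>
      ((List.range I.G.n).filter I.toRaw.isPiece).map fun j => (I, j) := by
    refine PolyTime.map (f := fun I j => (I, j)) (PolyTime.filter
      (f := fun I : SDInstance => I.toRaw.isPiece) (PolyTime.range polyTime_toRaw.fst.fst) ?_)
      PolyTime.id
    exact (PolyTime.mem hc.snd.snd hc.sdComp).band (PolyTime.decide_eq (hc.sdChain PolyTime.id.snd)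
      (hc.sdChain PolyTime.id.snd.succ)).bnot
  exact h1.congr_enc enc_positions

/-- The instance of 3-Subset 3-EC of a piece. -/
noncomputable def pieceInst (c : PiecePos) :
    (Subset3EC.restrict SubsetInstance.Special).FeasInst :=
  ⟨⟨CostGraph.gadget.inst c.1.1.G c.1.1.s c.1.1.t (c.1.1.chain c.1.2) (c.1.1.chain (c.1.2 + 1)),
    CostGraph.gadget.special c.2⟩,
    CostGraph.gadget.lift c.1.1.s c.1.1.t _ _ Finset.univ,
    (CostGraph.chain_sepChain c.2.reach).feasible_lift (CostGraph.relFeasible_univ _ _ _) c.2⟩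

/-- The argument carries the proof that there is a piece, so the algorithm for the special instances
is called only where it is guaranteed to answer correctly. -/
theorem polyTime_pieceInst : PolyTime pieceInst := by
  have hp : PolyTime fun c : PiecePos => c.1 := PolyTime.of_enc fun _ => rfl
  have hr : PolyTime fun c : PiecePos => c.1.1.toRaw := polyTime_toRaw.comp hp.fst
  refine (hr.sdGadget (hr.sdChain hp.snd) (hr.sdChain hp.snd.succ)).congr_enc fun c => ?_
  rw [toRaw_chain, toRaw_chain]
  exact CostGraph.gadget.enc_inst.symm

section Assemble

variable (O : ∀ X : (Subset3EC.restrict SubsetInstance.Special).FeasInst, Finset X.1.1.J.Edge)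

/-- The solutions of the pieces. -/
noncomputable def results (I : SDInstance) : List (List ℕ × List ℕ × List Bool) :=
  I.positions.map fun c =>
    (c.1.1.toRaw.chain c.1.2, c.1.1.toRaw.chain (c.1.2 + 1), bits (O (pieceInst c)))

/-- The assembled solution. -/
noncomputable def solution (I : SDInstance) : Finset I.G.Edge :=
  I.G.assemble I.s I.t I.chain I.G.n fun j h => O (pieceInst ⟨(I, j), h⟩)

theorem mem_solution {I : SDInstance} {e : I.G.Edge} : e ∈ I.solution O ↔
    ∃ j < I.G.n, ∃ h : I.IsPiece j, e ∈ I.G.cut Finset.univ (I.chain j) ∨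
      ((I.G.ends e).1 ∈ I.chain (j + 1) \ I.chain j ∧
        (I.G.ends e).2 ∈ I.chain (j + 1) \ I.chain j) ∧
        CostGraph.gadget.real I.s I.t _ _ e ∈ O (pieceInst ⟨(I, j), h⟩) :=
  CostGraph.mem_assemble

/-- Test whether an edge belongs to the solution of a piece. -/
def _root_.rawSelected (e : ℕ) (x : ℕ × ℕ × ℚ≥0) (r : List ℕ × List ℕ × List Bool) : Bool :=
  !(decide (decide (x.1 ∈ r.1) = decide (x.2.1 ∈ r.1))) ||
    ((decide (x.1 ∈ r.2.1) && !(decide (x.1 ∈ r.1))) &&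
      (decide (x.2.1 ∈ r.2.1) && !(decide (x.2.1 ∈ r.1)))) && r.2.2.getD e false

theorem bits_solution (I : SDInstance) : (List.range I.toRaw.1.2.length).map (fun e =>
    (I.results O).any (rawSelected e (I.toRaw.1.2.getD e (0, 0, 0)))) = bits (I.solution O) := by
  have hm : I.toRaw.1.2.length = I.G.m := CostGraph.length_raw
  rw [hm]
  refine bits_eq fun e => ?_
  have he : I.toRaw.1.2.getD e (0, 0, 0) = I.G.rawEdge e := CostGraph.getD_raw e
  rw [he, List.any_eq_true, mem_solution]
  have key : ∀ j (h : I.IsPiece j), rawSelected e (I.G.rawEdge e)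
      (toL (I.chain j), toL (I.chain (j + 1)), bits (O (pieceInst ⟨(I, j), h⟩))) = true ↔
      (e ∈ I.G.cut Finset.univ (I.chain j) ∨ ((I.G.ends e).1 ∈ I.chain (j + 1) \ I.chain j ∧
        (I.G.ends e).2 ∈ I.chain (j + 1) \ I.chain j) ∧
          CostGraph.gadget.real I.s I.t _ _ e ∈ O (pieceInst ⟨(I, j), h⟩)) := by
    intro j h
    -- An edge has the same number in the gadget as in the original graph.
    have hb : (bits (O (pieceInst ⟨(I, j), h⟩))).getD e false = true ↔
        CostGraph.gadget.real I.s I.t (I.chain j) (I.chain (j + 1)) e ∈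
          O (pieceInst ⟨(I, j), h⟩) :=
      getD_bits (CostGraph.gadget.real I.s I.t (I.chain j) (I.chain (j + 1)) e)
    simp only [rawSelected, CostGraph.rawEdge, hb, Bool.or_eq_true, Bool.and_eq_true,
      Bool.not_eq_true', decide_eq_true_eq, decide_eq_false_iff_not, val_mem_toL,
      CostGraph.mem_cut, Finset.mem_univ, true_and, Finset.mem_sdiff, decide_eq_decide]
  constructor
  · rintro ⟨r, hr, hr'⟩
    obtain ⟨c, hc, rfl⟩ := List.mem_map.1 hr
    obtain ⟨j, hj, hc⟩ := List.mem_filterMap.1 hc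
    split_ifs at hc with h
    cases hc
    refine ⟨j, List.mem_range.1 hj, h, (key j h).1 ?_⟩
    rwa [toRaw_chain, toRaw_chain] at hr'
  · rintro ⟨j, hj, h, h'⟩
    refine ⟨_, List.mem_map.2 ⟨⟨(I, j), h⟩, List.mem_filterMap.2
      ⟨j, List.mem_range.2 hj, dif_pos h⟩, rfl⟩, ?_⟩
    rw [toRaw_chain, toRaw_chain]
    exact (key j h).2 h'

theorem _root_.PolyTime.rawSelected {α : Type} [Enc α] {e : α → ℕ} {x : α → ℕ × ℕ × ℚ≥0}
    {r : α → List ℕ × List ℕ × List Bool} (he : PolyTime e) (hx : PolyTime x) (hr : PolyTime r) :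
    PolyTime fun a => _root_.rawSelected (e a) (x a) (r a) := by
  have h1 := PolyTime.mem hx.fst hr.fst
  have h2 := PolyTime.mem hx.snd.fst hr.fst
  have h3 := PolyTime.mem hx.fst hr.snd.fst
  have h4 := PolyTime.mem hx.snd.fst hr.snd.fst
  exact (h1.decide_eq h2).bnot.bor (((h3.band h1.bnot).band (h4.band h2.bnot)).band
    (hr.snd.snd.getD he (PolyTime.const false)))

theorem polyTime_solution (hO : PolyTime fun X => bits (O X)) :
    PolyTime fun I : SDInstance => bits (I.solution O) := by
  have hp : PolyTime fun c : PiecePos => c.1 := PolyTime.of_enc fun _ => rfl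
  have hr : PolyTime fun c : PiecePos => c.1.1.toRaw := polyTime_toRaw.comp hp.fst
  have hR : PolyTime (results O) := by
    refine PolyTime.map (f := fun (_ : SDInstance) (c : PiecePos) =>
      (c.1.1.toRaw.chain c.1.2, c.1.1.toRaw.chain (c.1.2 + 1), bits (O (pieceInst c))))
      polyTime_positions ?_
    have := (hr.sdChain hp.snd).pair ((hr.sdChain hp.snd.succ).pair (hO.comp polyTime_pieceInst))
    exact this.comp PolyTime.id.snd
  refine PolyTime.of_eq ?_ fun I => (I.bits_solution O).symm
  refine PolyTime.map (f := fun (I : SDInstance) e =>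
    (I.results O).any (_root_.rawSelected e (I.toRaw.1.2.getD e (0, 0, 0))))
    (PolyTime.range (PolyTime.length polyTime_toRaw.fst.snd)) ?_
  refine PolyTime.any (l := fun z : SDInstance × ℕ => z.1.results O)
    (f := fun z => _root_.rawSelected z.2 (z.1.toRaw.1.2.getD z.2 (0, 0, 0)))
    (hR.comp PolyTime.id.fst) ?_
  exact PolyTime.rawSelected PolyTime.id.fst.snd (PolyTime.getD
    (polyTime_toRaw.comp PolyTime.id.fst.fst).fst.snd PolyTime.id.fst.snd (PolyTime.const _))
    PolyTime.id.snd

end Assemble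

end SDInstance

theorem admitsRatio_of_subset {ρ : ℝ} (hρ : 1 ≤ ρ)
    (h : (Subset3EC.restrict SubsetInstance.Special).AdmitsRatio ρ) :
    (SDRSND 3).AdmitsRatio ρ := by
  obtain ⟨O, hO, hf⟩ := h.exists_polyTime
  have hO' : PolyTime fun X : (Subset3EC.restrict SubsetInstance.Special).FeasInst =>
      bits (k := X.1.1.J.m) (O X) := hO.congr_enc fun X => enc_bits _
  have h1 := SDInstance.polyTime_solution O hO'
  have h2 : PolyTime (β := SDInstance) fun I : (SDRSND 3).FeasInst => I.1 :=
    PolyTime.of_enc fun _ => rfl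
  refine MinProblem.AdmitsRatio.of_polyTime (P := SDRSND 3)
    (S := fun I => SDInstance.solution O I.1) ?_ ?_
  · exact (h1.comp h2).congr_enc fun I => (enc_bits (SDInstance.solution O I.1)).symm
  · rintro ⟨I, hI⟩
    by_cases hr : I.G.Reach Finset.univ I.s I.t
    · have hc : I.G.Chain I.s I.t I.chain I.G.n := CostGraph.chain_sepChain hr
      refine ⟨hc.relFeasible_assemble fun j h => (hf (SDInstance.pieceInst ⟨(I, j), h⟩)).1,
        fun H hH => hc.totalCost_assemble_le hρ hH fun j h => ?_⟩
      exact (hf (SDInstance.pieceInst ⟨(I, j), h⟩)).2 _ (hc.feasible_lift hH h)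
    -- If `t` cannot be reached, there are no pieces; the empty set is assembled, which is feasible
    -- and free.
    · have h0 : SDInstance.solution O I = ∅ := by
        refine Finset.eq_empty_of_forall_notMem fun e he => ?_
        obtain ⟨j, -, h, -⟩ := CostGraph.mem_assemble.1 he
        exact hr h.reach
      constructor
      · intro d hd F _ hF
        rw [List.mem_singleton] at hd
        subst hd
        refine absurd (Relation.ReflTransGen.mono ?_ _ _ hF) hr
        rintro u v ⟨e, -, he⟩
        exact ⟨e, Finset.mem_univ e, he⟩
      · intro H _
        have h3 : I.G.totalCost (SDInstance.solution O I) = 0 := by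
          rw [h0]; exact Finset.sum_empty
        change (I.G.totalCost (SDInstance.solution O I) : ℝ) ≤ _
        rw [h3, NNRat.cast_zero]
        positivity

/-! ### Finding `s` and `t` in a special instance -/

/-- Number of edges with exactly one end equal to `a`. -/
def rawDeg (es : List (ℕ × ℕ × ℚ≥0)) (a : ℕ) : ℕ :=
  (es.filter fun e => !(decide (decide (e.1 = a) = decide (e.2.1 = a)))).length

/-- Test for adjacency. -/
def rawAdj (es : List (ℕ × ℕ × ℚ≥0)) (a v : ℕ) : Bool :=
  es.any fun e => (decide (e.1 = a) && decide (e.2.1 = v)) || (decide (e.1 = v) && decide (e.2.1 = a))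

/-- Test whether all edges with exactly one end equal to `a` have cost zero. -/
def rawFree (es : List (ℕ × ℕ × ℚ≥0)) (a : ℕ) : Bool :=
  es.all fun e => decide (decide (e.1 = a) = decide (e.2.1 = a)) || decide (e.2.2 = 0)

/-- Test for property (A) and free forced edges. -/
def rawGood (Z : CostGraph.Raw × List Bool) (a b : ℕ) : Bool :=
  !(decide (a = b)) && (decide (rawDeg Z.1.2 a = 2) && (decide (rawDeg Z.1.2 b = 2) &&
    (rawFree Z.1.2 a && (rawFree Z.1.2 b && (List.range Z.1.1).all fun v =>
      decide (Z.2.getD v false = ((!(decide (v = a)) && rawAdj Z.1.2 a v) ||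
        (!(decide (v = b)) && rawAdj Z.1.2 b v)))))))

/-- Two vertices that pass the test. -/
def rawPick (Z : CostGraph.Raw × List Bool) : ℕ × ℕ :=
  (((List.range Z.1.1).product (List.range Z.1.1)).filter fun p => rawGood Z p.1 p.2).headD (0, 0)

namespace PolyTime

variable {α : Type} [Enc α] {es : α → List (ℕ × ℕ × ℚ≥0)} {x y : α → ℕ}

theorem rawDeg (hes : PolyTime es) (hx : PolyTime x) :
    PolyTime fun a => _root_.rawDeg (es a) (x a) := by
  refine length (filter (f := fun a e => !(decide (decide (e.1 = x a) = decide (e.2.1 = x a)))) hes ?_)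
  exact bnot (decide_eq (decide_eq id.snd.fst (hx.comp id.fst))
    (decide_eq id.snd.snd.fst (hx.comp id.fst)))

theorem rawAdj (hes : PolyTime es) (hx : PolyTime x) (hy : PolyTime y) :
    PolyTime fun a => _root_.rawAdj (es a) (x a) (y a) := by
  refine any (f := fun a e => (decide (e.1 = x a) && decide (e.2.1 = y a)) ||
    (decide (e.1 = y a) && decide (e.2.1 = x a))) hes ?_
  exact bor (band (decide_eq id.snd.fst (hx.comp id.fst)) (decide_eq id.snd.snd.fst (hy.comp id.fst)))
    (band (decide_eq id.snd.fst (hy.comp id.fst)) (decide_eq id.snd.snd.fst (hx.comp id.fst)))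

theorem rawFree (hes : PolyTime es) (hx : PolyTime x) :
    PolyTime fun a => _root_.rawFree (es a) (x a) := by
  refine all (f := fun a e => decide (decide (e.1 = x a) = decide (e.2.1 = x a)) ||
    decide (e.2.2 = 0)) hes ?_
  exact bor (decide_eq (decide_eq id.snd.fst (hx.comp id.fst))
    (decide_eq id.snd.snd.fst (hx.comp id.fst))) (decide_eq id.snd.snd.snd (const 0))

theorem rawGood {Z : α → CostGraph.Raw × List Bool} (hZ : PolyTime Z) (hx : PolyTime x)
    (hy : PolyTime y) : PolyTime fun a => _root_.rawGood (Z a) (x a) (y a) := by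
  have hes := hZ.fst.snd
  refine (decide_eq hx hy).bnot.band (((hes.rawDeg hx).decide_eq (const 2)).band
    (((hes.rawDeg hy).decide_eq (const 2)).band ((hes.rawFree hx).band ((hes.rawFree hy).band ?_))))
  refine all (f := fun a v => decide ((Z a).2.getD v false =
    ((!(decide (v = x a)) && _root_.rawAdj (Z a).1.2 (x a) v) ||
      (!(decide (v = y a)) && _root_.rawAdj (Z a).1.2 (y a) v)))) (range hZ.fst.fst) ?_
  have hx' := hx.comp (id (α := α × ℕ)).fst
  have hy' := hy.comp (id (α := α × ℕ)).fst
  have hes' := hes.comp (id (α := α × ℕ)).fst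
  exact decide_eq ((hZ.snd.comp id.fst).getD id.snd (const false))
    (((decide_eq id.snd hx').bnot.band (hes'.rawAdj hx' id.snd)).bor
      ((decide_eq id.snd hy').bnot.band (hes'.rawAdj hy' id.snd)))

theorem rawPick {Z : α → CostGraph.Raw × List Bool} (hZ : PolyTime Z) :
    PolyTime fun a => _root_.rawPick (Z a) :=
  headD (filter (f := fun a p => _root_.rawGood (Z a) p.1 p.2)
    (product (range hZ.fst.fst) (range hZ.fst.fst))
    ((hZ.comp id.fst).rawGood id.snd.fst id.snd.snd)) (const (0, 0))

end PolyTime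

namespace CostGraph

variable {G : CostGraph}

theorem mem_cut_singleton {e : G.Edge} {a : G.Vert} : e ∈ G.cut Finset.univ {a} ↔
    ¬(decide (((G.ends e).1 : ℕ) = a) = decide (((G.ends e).2 : ℕ) = a)) := by
  simp only [mem_cut, Finset.mem_univ, true_and, Finset.mem_singleton, decide_eq_decide, Fin.ext_iff]

theorem rawDeg_eq (a : G.Vert) : rawDeg G.raw.2 a = (G.cut Finset.univ {a}).card := by
  rw [rawDeg, raw_snd, List.filter_map, List.length_map]
  have h1 : (List.finRange G.m).filter (fun e => decide (e ∈ G.cut Finset.univ {a})) =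
      (List.finRange G.m).filter ((fun e : ℕ × ℕ × ℚ≥0 =>
        !(decide (decide (e.1 = a) = decide (e.2.1 = a)))) ∘
          fun e => (((G.ends e).1 : ℕ), ((G.ends e).2 : ℕ), G.cost e)) := by
    refine List.filter_congr fun e _ => ?_
    rw [Bool.eq_iff_iff, decide_eq_true_eq, mem_cut_singleton, Function.comp_apply,
      Bool.not_eq_true', decide_eq_false_iff_not]
  rw [← h1, ← List.toFinset_card_of_nodup ((List.nodup_finRange _).filter _)]
  congr 1
  ext e
  simp

theorem rawAdj_iff (a v : G.Vert) : rawAdj G.raw.2 a v = true ↔ ∃ e, G.Joins e a v := by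
  simp only [rawAdj, List.any_eq_true, mem_raw, Bool.or_eq_true, Bool.and_eq_true,
    decide_eq_true_eq]
  constructor
  · rintro ⟨_, ⟨e, rfl⟩, h⟩
    refine ⟨e, h.imp (fun h => ?_) fun h => ?_⟩
    · exact Prod.ext (Fin.ext h.1) (Fin.ext h.2)
    · exact Prod.ext (Fin.ext h.1) (Fin.ext h.2)
  · rintro ⟨e, h⟩
    refine ⟨_, ⟨e, rfl⟩, ?_⟩
    rcases h with h | h <;> rw [h]
    · exact Or.inl ⟨rfl, rfl⟩
    · exact Or.inr ⟨rfl, rfl⟩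

theorem rawFree_iff (a : G.Vert) :
    rawFree G.raw.2 a = true ↔ ∀ e ∈ G.cut Finset.univ {a}, G.cost e = 0 := by
  simp only [rawFree, List.all_eq_true, mem_raw, Bool.or_eq_true, decide_eq_true_eq,
    forall_exists_index, forall_apply_eq_imp_iff]
  refine forall_congr' fun e => ?_
  rw [mem_cut_singleton, or_iff_not_imp_left]

theorem rawGood_iff {R : Finset G.Vert} (a b : G.Vert) :
    rawGood (G.raw, bits R) a b = true ↔ G.Terminals a b R ∧
      (∀ e ∈ G.cut Finset.univ {a}, G.cost e = 0) ∧ ∀ e ∈ G.cut Finset.univ {b}, G.cost e = 0 := by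
  have h1 : (List.range G.raw.1).all (fun v => decide ((bits R).getD v false =
      ((!(decide (v = (a : ℕ))) && rawAdj G.raw.2 a v) ||
        (!(decide (v = (b : ℕ))) && rawAdj G.raw.2 b v)))) = true ↔
      ∀ v : G.Vert, v ∈ R ↔ (v ≠ a ∧ ∃ e, G.Joins e a v) ∨ (v ≠ b ∧ ∃ e, G.Joins e b v) := by
    rw [List.all_eq_true]
    have h2 : ∀ v : G.Vert, decide ((bits R).getD v false =
      ((!(decide ((v : ℕ) = (a : ℕ))) && rawAdj G.raw.2 a v) ||
        (!(decide ((v : ℕ) = (b : ℕ))) && rawAdj G.raw.2 b v))) = true ↔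
        (v ∈ R ↔ (v ≠ a ∧ ∃ e, G.Joins e a v) ∨ (v ≠ b ∧ ∃ e, G.Joins e b v)) := by
      intro v
      rw [decide_eq_true_eq, Bool.eq_iff_iff, getD_bits, Bool.or_eq_true, Bool.and_eq_true,
        Bool.and_eq_true, rawAdj_iff, rawAdj_iff, Bool.not_eq_true', Bool.not_eq_true',
        decide_eq_false_iff_not, decide_eq_false_iff_not, ← Fin.ext_iff, ← Fin.ext_iff]
    constructor
    · exact fun h v => (h2 v).1 (h v (List.mem_range.2 v.isLt))
    · exact fun h v hv => (h2 ⟨v, List.mem_range.1 hv⟩).2 (h _)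
  rw [rawGood, Bool.and_eq_true, Bool.and_eq_true, Bool.and_eq_true, Bool.and_eq_true,
    Bool.and_eq_true, h1, rawFree_iff, rawFree_iff, rawDeg_eq, rawDeg_eq, decide_eq_true_eq,
    decide_eq_true_eq, Bool.not_eq_true', decide_eq_false_iff_not, ← Fin.ext_iff]
  constructor
  · rintro ⟨h1, h2, h3, h4, h5, h6⟩
    exact ⟨⟨h1, h2, h3, h6⟩, h4, h5⟩
  · rintro ⟨⟨h1, h2, h3, h6⟩, h4, h5⟩
    exact ⟨h1, h2, h3, h4, h5, h6⟩

theorem EdgeConnectedSubset.mono {H H' : Finset G.Edge} {k : ℕ} {R : Finset G.Vert}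
    (h : G.EdgeConnectedSubset H k R) (hH : H ⊆ H') : G.EdgeConnectedSubset H' k R := by
  rw [edgeConnectedSubset_iff] at h ⊢
  exact fun C u hu v hv h1 h2 => (h C u hu v hv h1 h2).trans (Finset.card_le_card (cut_mono hH C))

end CostGraph

namespace SubsetInstance

/-- The pair found may differ from the one in the definition of `Special`; property (A) and free
forced edges are what the reduction needs of it. -/
theorem exists_rawPick {I : SubsetInstance} (h : I.Special) : ∃ s t : I.J.Vert,
    rawPick (I.J.raw, bits I.R) = (s.val, t.val) ∧ I.J.Terminals s t I.R ∧
      (∀ e ∈ I.J.cut Finset.univ {s}, I.J.cost e = 0) ∧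
      ∀ e ∈ I.J.cut Finset.univ {t}, I.J.cost e = 0 := by
  obtain ⟨a, b, hne, hA, -, hF⟩ := h
  have h1 : rawGood (I.J.raw, bits I.R) a b = true := (CostGraph.rawGood_iff a b).2
    ⟨⟨hne, hA.1, hA.2.1, hA.2.2⟩, fun e he => hF e (Finset.mem_union_left _ he),
      fun e he => hF e (Finset.mem_union_right _ he)⟩
  have h2 : ((a : ℕ), (b : ℕ)) ∈ ((List.range I.J.n).product (List.range I.J.n)).filter
      fun p => rawGood (I.J.raw, bits I.R) p.1 p.2 := by
    rw [List.mem_filter, List.pair_mem_product, List.mem_range, List.mem_range]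
    exact ⟨⟨a.isLt, b.isLt⟩, h1⟩
  have h3 : rawPick (I.J.raw, bits I.R) ∈ ((List.range I.J.n).product (List.range I.J.n)).filter
      fun p => rawGood (I.J.raw, bits I.R) p.1 p.2 := by
    have h4 : rawPick (I.J.raw, bits I.R) = (((List.range I.J.n).product (List.range I.J.n)).filter
      fun p => rawGood (I.J.raw, bits I.R) p.1 p.2).headD (0, 0) := rfl
    rw [h4]
    generalize ((List.range I.J.n).product (List.range I.J.n)).filter
      (fun p => rawGood (I.J.raw, bits I.R) p.1 p.2) = l at h2
    cases l with
    | nil => simp at h2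
    | cons p l => exact List.mem_cons_self
  generalize rawPick (I.J.raw, bits I.R) = p at h3
  obtain ⟨i, j⟩ := p
  rw [List.mem_filter, List.pair_mem_product, List.mem_range, List.mem_range] at h3
  exact ⟨⟨i, h3.1.1⟩, ⟨j, h3.1.2⟩, rfl, (CostGraph.rawGood_iff ⟨i, h3.1.1⟩ ⟨j, h3.1.2⟩).1 h3.2⟩

end SubsetInstance

/-- The graph and the solution are passed on unchanged; only the terminals are replaced by the pair
`s`, `t`. -/
theorem admitsRatio_subset {ρ : ℝ} (h : (SDRSND 3).AdmitsRatio ρ) :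
    (Subset3EC.restrict SubsetInstance.Special).AdmitsRatio ρ := by
  obtain ⟨O, hO, hf⟩ := h.exists_polyTime
  choose s t hp hT hs ht using
    fun X : (Subset3EC.restrict SubsetInstance.Special).FeasInst => SubsetInstance.exists_rawPick X.1.2
  let f : (Subset3EC.restrict SubsetInstance.Special).FeasInst → (SDRSND 3).FeasInst := fun X =>
    ⟨⟨X.1.1.J, s X, t X, (hT X).ne⟩, Finset.univ, CostGraph.relFeasible_univ _ _ _⟩
  have hZ : PolyTime fun X : (Subset3EC.restrict SubsetInstance.Special).FeasInst =>
      (X.1.1.J.raw, bits X.1.1.R) := PolyTime.of_enc fun X => by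
    change Data.cons (Enc.enc X.1.1.J.raw) (Enc.enc (bits X.1.1.R)) = _
    rw [CostGraph.enc_raw, enc_bits]
    rfl
  have hpf : PolyTime f := (hZ.fst.pair hZ.rawPick).congr_enc fun X => by
    change Data.cons X.1.1.J.enc (Data.cons (Data.unary (s X)) (Data.unary (t X))) =
      Data.cons (Enc.enc X.1.1.J.raw) (Enc.enc (rawPick _))
    rw [CostGraph.enc_raw, hp]
    rfl
  have hR : ∀ X : (Subset3EC.restrict SubsetInstance.Special).FeasInst,
      X.1.1.J.EdgeConnectedSubset Finset.univ 3 X.1.1.R := fun X =>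
    CostGraph.EdgeConnectedSubset.mono X.2.choose_spec (Finset.subset_univ _)
  refine MinProblem.AdmitsRatio.of_polyTime (S := fun X => O (f X)) (hO.comp hpf) fun X =>
    ⟨(hT X).edgeConnectedSubset (hR X) (hf (f X)).1, fun S hS => ?_⟩
  -- Adding the free forced edges makes a competing solution feasible for the demand at no cost.
  let S' : Finset X.1.1.J.Edge :=
    S ∪ (X.1.1.J.cut Finset.univ {s X} ∪ X.1.1.J.cut Finset.univ {t X})
  have h1 : X.1.1.J.RelFeasible [(s X, t X, 3)] S' :=
    (hT X).relFeasible hS Finset.subset_union_left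
      (Finset.subset_union_left.trans Finset.subset_union_right)
      (Finset.subset_union_right.trans Finset.subset_union_right)
  have h2 : X.1.1.J.totalCost S' = X.1.1.J.totalCost S := by
    refine (Finset.sum_subset Finset.subset_union_left fun e he he' => ?_).symm
    rcases Finset.mem_union.1 ((Finset.mem_union.1 he).resolve_left he') with h | h
    · exact hs X e h
    · exact ht X e h
  have h3 := (hf (f X)).2 S' h1
  change (X.1.1.J.totalCost (O (f X)) : ℝ) ≤ ρ * X.1.1.J.totalCost S
  rw [← h2]
  exact h3

theorem theorem4 (ρ : ℝ) (hρ : 1 ≤ ρ) :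
    (SDRSND 3).AdmitsRatio ρ ↔ (Subset3EC.restrict SubsetInstance.Special).AdmitsRatio ρ :=
  ⟨admitsRatio_subset, admitsRatio_of_subset hρ⟩
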